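/- Let $\Bbbk=\mathbb R$ or $\mathbb C$, let $(L,A)$ be a Lie pair over a smooth manifold $M$, that is, $L$ is a Lie algebroid over $\Bbbk$ with base $M$ and anchor $\rho$, and $A\subseteq L$ is a Lie subalgebroid. Put $B=L/A$ with projection $p:L\to B$. **The function algebra.** Let $\mathcal R=\Gamma(\Lambda^\bullet L^\vee\otimes\widehat S B^\vee)=\prod_{k\ge0}\Gamma(\Lambda^\bullet L^\vee\otimes S^kB^\vee)$, graded by the degree of forms, with the $\mathcal I$-adic topology, in which the subspaces $\mathcal I^k=\Gamma(\Lambda^\bullet L^\vee\otimes\widehat S^{\ge k}B^\vee)$ form a basis of neighbourhoods of $0$ (with $\mathcal I^k=\mathcal R$ for $k\le 0$). A *vertical operator* is a continuous $\Gamma(\Lambda^\bullet L^\vee)$-linear (with Koszul signs) operator on $\mathcal R$. It is *filtration-shifting* if, for some $N\in\mathbb Z$, it maps $\Gamma(\Lambda^\bullet L^\vee\otimes S^kB^\vee)$ into $\mathcal I^{k+N}$ for all $k\ge0$. Such an operator is uniquely a sum $\sum_{q\ge0}D_q$ with $D_q\in\Gamma(\Lambda^\bullet L^\vee\otimes\widehat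 SB^\vee\otimes S^qB)$, where $S^qB$ acts on $\widehat SB^\vee$ by fibrewise differential operators of order $q$ with constant coefficients. A *vertical vector field* is a vertical operator that is a graded derivation; those of degree $p$ are the elements of $\Gamma(\Lambda^pL^\vee\otimes\widehat SB^\vee\otimes B)$. **The operators $\mathsf k$ and $\mathsf h$.** The Koszul vector field $\mathsf k$ is the vertical vector field of degree $1$ with $\mathsf k(\eta)=p^\vee\eta\in\Gamma(L^\vee)$ for $\eta\in\Gamma(B^\vee)$. A splitting $j:B\to L$ of $0\to A\to L\to B\to0$ gives an isomorphism $\Lambda^pL^\vee\cong\bigoplus_{p_1+p_2=p}\Lambda^{p_1}A^\vee\otimes\Lambda^{p_2}B^\vee$ and a derivation $\hat{\mathsf k}$ of $\mathcal R$ of degree $-1$ with $\hat{\mathsf k}(\xi)=j^\vee\xi\in\Gamma(B^\vee)$ for $\xi\in\Gamma(L^\vee)$ and $\hat{\mathsf k}=0$ on $\Gamma(\widehat SB^\vee)$. Let $\mathsf h=\frac1{p_2+q}\hat{\mathsf k}$ on $\Gamma(\Lambda^{p_1}A^\vee\otimes\Lambda^{p_2}B^\vee\otimes S^qB^\vee)$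 if $p_2+q>0$, and $\mathsf h=0$ if $p_2=q=0$. On filtration-shifting vertical operators let $\mathsf h_\natural\big(\sum_qD_q\big)=\sum_q(\mathsf h\otimes\mathrm{id}_{S^qB})(D_q)$. **Fedosov dg manifolds.** Let $j$ be a splitting and $\nabla$ an $L$-connection on $B$ that is torsion-free, i.e. $\nabla_{l_1}p(l_2)-\nabla_{l_2}p(l_1)=p([l_1,l_2])$. The Fedosov vector field of $(j,\nabla)$ is the operator $Q=-\mathsf k+d_L^\nabla+X$ on $\mathcal R$, where $d_L^\nabla$ is the covariant derivative of the induced connection on $\widehat SB^\vee$ and $X\in\Gamma(L^\vee\otimes\widehat S^{\ge2}B^\vee\otimes B)$ is the vertical vector field such that $\mathsf h_\natural(X)=0$ (with $\mathsf h$ taken for $j$) and $Q\circ Q=0$. Let $Q_1,Q_2$ be the Fedosov vector fields of two choices $(j_1,\nabla^1)$, $(j_2,\nabla^2)$. A *vertical isomorphism* $\phi:(\mathcal R,Q_2)\to(\mathcal R,Q_1)$ is a vertical operator that is an automorphism of the graded algebra $\mathcal R$ with $\phi\circ Q_2=Q_1\circ\phi$. Put $\Delta Q=Q_1-Q_2$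 and $\eth(\psi)=\Delta Q\circ\psi+[\mathsf k+Q_2,\psi]$ (graded commutator). **Corollary.** Let $\phi:(\mathcal R,Q_2)\to(\mathcal R,Q_1)$ be a vertical isomorphism. Then there is exactly one vertical vector field $Y\in\Gamma(\widehat S^{\ge2}B^\vee\otimes B)$ with $$\phi=e^Y=\sum_{n\ge0}\frac1{n!}Y^n .$$ Moreover, for every splitting $j$ (in particular $j=j_1$ or $j=j_2$), with $\mathsf h_\natural$ taken for $j$, $$Y=\log\phi=\sum_{k\ge1}\frac{(-1)^{k+1}}k(\phi-1)^k=\sum_{k\ge1}\ \sum_{n_1,\dots,n_k\ge0}\frac{(-1)^{k+1}}k\,(\mathsf h_\natural\eth)^{n_1}\big(\mathsf h_\natural(\Delta Q)\big)\circ\cdots\circ(\mathsf h_\natural\eth)^{n_k}\big(\mathsf h_\natural(\Delta Q)\big).$$ All these series converge unconditionally, and uniformly on $\mathcal R$ for the $\mathcal I$-adic topology. -/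

import Mathlib

open scoped TensorProduct

noncomputable section

/-! ## Lie algebroids, Lie pairs and connections, through modules of sections

Below, `R` plays the role of `C^∞(M, 𝕜)` and `L` of the `R`-module `Γ(L)` of sections of a vector
bundle; `A` is the submodule `Γ(A)` of sections of a subbundle, so that `L ⧸ A` is the module of
sections of `B = L / A`. Duals of bundles correspond to `R`-linear duals, vector fields to
`𝕜`-linear derivations of `R`, and bundle maps to `R`-linear maps; as `Γ(L)` is a finitely generated
projective module, `Γ(Λ^p L^∨)` and `Γ(S^k B^∨)` are the `R`-linear exterior and symmetric powers of
the duals.  The bundles themselves are introduced in the last section of this file. -/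

section Algebroid

variable (𝕜 R L : Type*) [Field 𝕜] [CommRing R] [Algebra 𝕜 R] [AddCommGroup L] [Module R L]

/-- A Lie algebroid structure on the module of sections `L`: a Lie bracket and an anchor.
(`𝕜`-bilinearity of the bracket follows from additivity, `lie_self` and the Leibniz rule.) -/
structure LieAlgebroid where
  bracket : L → L → L
  anchor : L →ₗ[R] Derivation 𝕜 R R
  add_left : ∀ l₁ l₂ l, bracket (l₁ + l₂) l = bracket l₁ l + bracket l₂ l
  add_right : ∀ l l₁ l₂, bracket l (l₁ + l₂) = bracket l l₁ + bracket l l₂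
  lie_self : ∀ l, bracket l l = 0
  jacobi : ∀ l₁ l₂ l₃, bracket l₁ (bracket l₂ l₃) =
    bracket (bracket l₁ l₂) l₃ + bracket l₂ (bracket l₁ l₃)
  leibniz : ∀ l₁ l₂ (f : R), bracket l₁ (f • l₂) = f • bracket l₁ l₂ + anchor l₁ f • l₂
  anchor_bracket : ∀ l₁ l₂, anchor (bracket l₁ l₂) = ⁅anchor l₁, anchor l₂⁆

variable {𝕜 R L}

/-- A splitting `j : B → L` of `0 → A → L → B → 0`. -/
structure LieSplitting (A : Submodule R L) where
  toLin : (L ⧸ A) →ₗ[R] L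
  mkQ_toLin : ∀ b, A.mkQ (toLin b) = b

/-- An `L`-connection on `B = L / A`. -/
structure LConnection (𝓛 : LieAlgebroid 𝕜 R L) (A : Submodule R L) where
  nabla : L → (L ⧸ A) → (L ⧸ A)
  add_left : ∀ l₁ l₂ b, nabla (l₁ + l₂) b = nabla l₁ b + nabla l₂ b
  add_right : ∀ l b₁ b₂, nabla l (b₁ + b₂) = nabla l b₁ + nabla l b₂
  smul_left : ∀ (f : R) l b, nabla (f • l) b = f • nabla l b
  leibniz : ∀ l (f : R) b, nabla l (f • b) = 𝓛.anchor l f • b + f • nabla l b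

/-- Vanishing of the torsion `∇_{l₁} p(l₂) - ∇_{l₂} p(l₁) - p[l₁, l₂]`. -/
def LConnection.IsTorsionFree {𝓛 : LieAlgebroid 𝕜 R L} {A : Submodule R L}
    (D : LConnection 𝓛 A) : Prop :=
  ∀ l₁ l₂, D.nabla l₁ (A.mkQ l₂) - D.nabla l₂ (A.mkQ l₁) - A.mkQ (𝓛.bracket l₁ l₂) = 0

/-- The dual connection on `B^∨`: `⟨∇_l η, b⟩ = ρ(l)⟨η, b⟩ - ⟨η, ∇_l b⟩`. -/
def LConnection.dual {𝓛 : LieAlgebroid 𝕜 R L} {A : Submodule R L} (D : LConnection 𝓛 A)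
    (l : L) (η : Module.Dual R (L ⧸ A)) : Module.Dual R (L ⧸ A) where
  toFun b := 𝓛.anchor l (η b) - η (D.nabla l b)
  map_add' b₁ b₂ := by rw [D.add_right]; simp only [map_add]; abel
  map_smul' f b := by
    rw [D.leibniz]
    simp only [map_smul, map_add, smul_eq_mul, Derivation.leibniz, RingHom.id_apply]
    ring

/-- `ω(l₁, …, l_p)` for a `p`-form `ω`; here `(ξ₁ ∧ ⋯ ∧ ξ_p)(l₁, …, l_p) = det (ξ_i(l_j))`. -/
def evalForm {p : ℕ} (ω : ⋀[R]^p (Module.Dual R L)) (l : Fin p → L) : R :=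
  exteriorPower.pairingDual R L p ω (exteriorPower.ιMulti R p l)

/-- The defining property of the Chevalley--Eilenberg differential on `Γ(Λ^• L^∨)`:
`(dω)(l₀, …, l_p) = ∑ᵢ (-1)^i ρ(l_i) ω(l₀, …, l̂_i, …, l_p)
  + ∑_{i<j} (-1)^{i+j} ω([l_i, l_j], l₀, …, l̂_i, …, l̂_j, …, l_p)`.
In the second sum the bracket is put in the place of `l_i`, and not in the first place, which
changes the sign `(-1)^{i+j}` to `(-1)^j`. -/
def LieAlgebroid.IsChevalleyEilenberg (𝓛 : LieAlgebroid 𝕜 R L)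
    (d : ExteriorAlgebra R (Module.Dual R L) →+ ExteriorAlgebra R (Module.Dual R L)) : Prop :=
  ∀ (p : ℕ) (ω : ⋀[R]^p (Module.Dual R L)), ∃ θ : ⋀[R]^(p + 1) (Module.Dual R L),
    d ω = θ ∧ ∀ l : Fin (p + 1) → L,
      evalForm θ l =
        ∑ i : Fin (p + 1), (-1) ^ (i : ℕ) * 𝓛.anchor (l i) (evalForm ω fun k => l (i.succAbove k)) +
        ∑ j : Fin (p + 1), ∑ i : Fin p, if i.castSucc < j then
          (-1) ^ (j : ℕ) * evalForm ω
            (Function.update (fun k => l (j.succAbove k)) i (𝓛.bracket (l i.castSucc) (l j)))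
          else 0

open Classical in
/-- The Chevalley--Eilenberg differential `d_L` of a Lie algebroid.  For the module of sections of
a vector bundle (more generally, for a finitely generated projective module) forms are determined
by their values and there is exactly one operator with the defining property. -/
def LieAlgebroid.dCE (𝓛 : LieAlgebroid 𝕜 R L) :
    ExteriorAlgebra R (Module.Dual R L) →+ ExteriorAlgebra R (Module.Dual R L) :=
  if h : ∃ d, 𝓛.IsChevalleyEilenberg d then h.choose else 0

end Algebroid

/-! ## The function algebra `Γ(Λ^• L^∨ ⊗ Ŝ B^∨)` of the Fedosov manifold `L[1] ⊕ B` -/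

section FunctionAlgebra

variable {𝕜 R L : Type*} [Field 𝕜] [CommRing R] [Algebra 𝕜 R] [AddCommGroup L] [Module R L]

/-- `Γ(Λ^• L^∨ ⊗ S B^∨)`. -/
def PolyFun (A : Submodule R L) : Type _ :=
  ExteriorAlgebra R (Module.Dual R L) ⊗[R] SymmetricAlgebra R (Module.Dual R (L ⧸ A))

instance (A : Submodule R L) : Ring (PolyFun A) :=
  inferInstanceAs (Ring (ExteriorAlgebra R (Module.Dual R L) ⊗[R]
    SymmetricAlgebra R (Module.Dual R (L ⧸ A))))

instance {S : Type*} [CommRing S] [Algebra S R] (A : Submodule R L) : Algebra S (PolyFun A) :=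
  inferInstanceAs (Algebra S (ExteriorAlgebra R (Module.Dual R L) ⊗[R]
    SymmetricAlgebra R (Module.Dual R (L ⧸ A))))

instance {S : Type*} [CommRing S] [Algebra S R] (A : Submodule R L) :
    IsScalarTower S R (PolyFun A) :=
  inferInstanceAs (IsScalarTower S R (ExteriorAlgebra R (Module.Dual R L) ⊗[R]
    SymmetricAlgebra R (Module.Dual R (L ⧸ A))))

/-- The identity, as an isomorphism. -/
def PolyFun.equiv (A : Submodule R L) :
    (ExteriorAlgebra R (Module.Dual R L) ⊗[R] SymmetricAlgebra R (Module.Dual R (L ⧸ A))) ≃ₐ[R]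
      PolyFun A :=
  (AlgEquiv.refl : (ExteriorAlgebra R (Module.Dual R L) ⊗[R]
    SymmetricAlgebra R (Module.Dual R (L ⧸ A))) ≃ₐ[R] _)

/-- `ω ⊗ f`. -/
def polyTmul (A : Submodule R L) (ω : ExteriorAlgebra R (Module.Dual R L))
    (f : SymmetricAlgebra R (Module.Dual R (L ⧸ A))) : PolyFun A :=
  PolyFun.equiv A (ω ⊗ₜ[R] f)

/-- The inclusion `ω ↦ ω ⊗ 1` of `Γ(Λ^• L^∨)`. -/
def polyForm (A : Submodule R L) : ExteriorAlgebra R (Module.Dual R L) →ₐ[R] PolyFun A :=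
  (PolyFun.equiv A).toAlgHom.comp Algebra.TensorProduct.includeLeft

/-- The inclusion `f ↦ 1 ⊗ f` of `Γ(S B^∨)`. -/
def polySym (A : Submodule R L) :
    SymmetricAlgebra R (Module.Dual R (L ⧸ A)) →ₐ[R] PolyFun A :=
  (PolyFun.equiv A).toAlgHom.comp Algebra.TensorProduct.includeRight

theorem polyForm_mul_polySym (A : Submodule R L) (ω : ExteriorAlgebra R (Module.Dual R L))
    (f : SymmetricAlgebra R (Module.Dual R (L ⧸ A))) :
    polyForm A ω * polySym A f = polyTmul A ω f := by
  change PolyFun.equiv A (ω ⊗ₜ[R] 1) * PolyFun.equiv A (1 ⊗ₜ[R] f) = _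
  rw [← map_mul, Algebra.TensorProduct.tmul_mul_tmul, mul_one, one_mul]
  rfl

theorem polySym_mul_polyForm (A : Submodule R L) (ω : ExteriorAlgebra R (Module.Dual R L))
    (f : SymmetricAlgebra R (Module.Dual R (L ⧸ A))) :
    polySym A f * polyForm A ω = polyTmul A ω f := by
  change PolyFun.equiv A (1 ⊗ₜ[R] f) * PolyFun.equiv A (ω ⊗ₜ[R] 1) = _
  rw [← map_mul, Algebra.TensorProduct.tmul_mul_tmul, mul_one, one_mul]
  rfl

theorem polyTmul_mul (A : Submodule R L) (ω ω' : ExteriorAlgebra R (Module.Dual R L))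
    (f f' : SymmetricAlgebra R (Module.Dual R (L ⧸ A))) :
    polyTmul A ω f * polyTmul A ω' f' = polyTmul A (ω * ω') (f * f') := by
  unfold polyTmul
  rw [← map_mul, Algebra.TensorProduct.tmul_mul_tmul]

/-- The `R`-linear map on `Γ(Λ^• L^∨ ⊗ S B^∨)` with a given value `b ω f` on `ω ⊗ f`. -/
def PolyFun.lift {A : Submodule R L} {N : Type*} [AddCommGroup N] [Module R N]
    (b : ExteriorAlgebra R (Module.Dual R L) →ₗ[R]
      SymmetricAlgebra R (Module.Dual R (L ⧸ A)) →ₗ[R] N) : PolyFun A →ₗ[R] N :=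
  TensorProduct.lift b ∘ₗ (PolyFun.equiv A).symm.toLinearMap

theorem PolyFun.lift_tmul {A : Submodule R L} {N : Type*} [AddCommGroup N] [Module R N]
    (b : ExteriorAlgebra R (Module.Dual R L) →ₗ[R]
      SymmetricAlgebra R (Module.Dual R (L ⧸ A)) →ₗ[R] N)
    (ω : ExteriorAlgebra R (Module.Dual R L))
    (f : SymmetricAlgebra R (Module.Dual R (L ⧸ A))) :
    PolyFun.lift b (polyTmul A ω f) = b ω f := by
  simp [PolyFun.lift, polyTmul]

/-- The operator `ω ⊗ f ↦ g(ω) ⊗ f`. -/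
def PolyFun.mapForm (A : Submodule R L)
    (g : ExteriorAlgebra R (Module.Dual R L) →ₗ[R] ExteriorAlgebra R (Module.Dual R L)) :
    PolyFun A →ₗ[R] PolyFun A :=
  PolyFun.lift ((LinearMap.mul R (PolyFun A)).compl₁₂ ((polyForm A).toLinearMap ∘ₗ g)
    (polySym A).toLinearMap)

theorem PolyFun.mapForm_tmul (A : Submodule R L)
    (g : ExteriorAlgebra R (Module.Dual R L) →ₗ[R] ExteriorAlgebra R (Module.Dual R L))
    (ω : ExteriorAlgebra R (Module.Dual R L))
    (f : SymmetricAlgebra R (Module.Dual R (L ⧸ A))) :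
    PolyFun.mapForm A g (polyTmul A ω f) = polyTmul A (g ω) f := by
  rw [← polyForm_mul_polySym A (g ω) f, PolyFun.mapForm, PolyFun.lift_tmul]
  rfl

/-- The product `η₁ ⊙ ⋯ ⊙ η_k` in `Γ(S^k B^∨)` of the elements of a multiset. -/
def symProd (A : Submodule R L) (m : Multiset (Module.Dual R (L ⧸ A))) :
    SymmetricAlgebra R (Module.Dual R (L ⧸ A)) :=
  (m.map (SymmetricAlgebra.ι R (Module.Dual R (L ⧸ A)))).prod

/-- `Γ(Λ^• L^∨ ⊗ S^k B^∨)`. -/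
def symPart (A : Submodule R L) (k : ℕ) : Submodule R (PolyFun A) :=
  Submodule.span R {t | ∃ (ω : ExteriorAlgebra R (Module.Dual R L))
    (m : Multiset (Module.Dual R (L ⧸ A))), m.card = k ∧ t = polyTmul A ω (symProd A m)}

/-- `Γ(Λ^p L^∨ ⊗ S B^∨)`. -/
def formPart (A : Submodule R L) (p : ℕ) : Submodule R (PolyFun A) :=
  Submodule.span R {t | ∃ ω ∈ ⋀[R]^p (Module.Dual R L), ∃ f, t = polyTmul A ω f}

theorem polyTmul_mem_symPart (A : Submodule R L) (ω : ExteriorAlgebra R (Module.Dual R L))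
    (m : Multiset (Module.Dual R (L ⧸ A))) : polyTmul A ω (symProd A m) ∈ symPart A m.card :=
  Submodule.subset_span ⟨ω, m, rfl, rfl⟩

theorem polyForm_mem_symPart (A : Submodule R L) (ω : ExteriorAlgebra R (Module.Dual R L)) :
    polyForm A ω ∈ symPart A 0 :=
  polyTmul_mem_symPart A ω 0

theorem polySym_mem_symPart (A : Submodule R L) (m : Multiset (Module.Dual R (L ⧸ A))) :
    polySym A (symProd A m) ∈ symPart A m.card :=
  polyTmul_mem_symPart A 1 m

theorem one_mem_symPart (A : Submodule R L) : (1 : PolyFun A) ∈ symPart A 0 := by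
  rw [← map_one (polyForm A)]
  exact polyForm_mem_symPart A 1

theorem symPart_mul_mem (A : Submodule R L) {i j : ℕ} {s t : PolyFun A}
    (hs : s ∈ symPart A i) (ht : t ∈ symPart A j) : s * t ∈ symPart A (i + j) := by
  have h : symPart A i * symPart A j ≤ symPart A (i + j) := by
    unfold symPart
    rw [Submodule.span_mul_span]
    refine Submodule.span_mono ?_
    rintro _ ⟨_, ⟨ω, m, rfl, rfl⟩, _, ⟨ω', m', rfl, rfl⟩, rfl⟩
    exact ⟨ω * ω', m + m', by simp, by simp [symProd, polyTmul_mul]⟩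
  exact h (Submodule.mul_mem_mul hs ht)

/-- A linear map sends `Γ(Λ^• L^∨ ⊗ S^k B^∨)` into a submodule if it does so on generators. -/
theorem map_symPart_mem {A : Submodule R L} {N : Type*} [AddCommGroup N] [Module R N]
    (g : PolyFun A →ₗ[R] N) (P : Submodule R N) {k : ℕ}
    (h : ∀ ω m, m.card = k → g (polyTmul A ω (symProd A m)) ∈ P) {t : PolyFun A}
    (ht : t ∈ symPart A k) : g t ∈ P := by
  have h' : symPart A k ≤ P.comap g := by
    refine Submodule.span_le.2 ?_
    rintro _ ⟨ω, m, hm, rfl⟩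
    exact h ω m hm
  exact h' ht

/-- The algebra `𝓡 = Γ(Λ^• L^∨ ⊗ Ŝ B^∨) = ∏_k Γ(Λ^• L^∨ ⊗ S^k B^∨)` of functions on the Fedosov
manifold, realised as the algebra of those formal power series `∑ F_k t^k` over
`Γ(Λ^• L^∨ ⊗ S B^∨)` with `F_k ∈ Γ(Λ^• L^∨ ⊗ S^k B^∨)` for all `k`. -/
def FedosovFun (A : Submodule R L) : Subalgebra R (PowerSeries (PolyFun A)) where
  carrier := {F | ∀ k, PowerSeries.coeff k F ∈ symPart A k}
  mul_mem' := by
    intro F G hF hG k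
    rw [PowerSeries.coeff_mul]
    refine Submodule.sum_mem _ fun x hx => ?_
    have hx' := Finset.HasAntidiagonal.mem_antidiagonal.1 hx
    have := symPart_mul_mem A (hF x.1) (hG x.2)
    rwa [hx'] at this
  add_mem' := by
    intro F G hF hG k
    rw [map_add]
    exact add_mem (hF k) (hG k)
  algebraMap_mem' := by
    intro r k
    rw [Algebra.algebraMap_eq_smul_one]
    change r • PowerSeries.coeff k (1 : PowerSeries (PolyFun A)) ∈ _
    rw [PowerSeries.coeff_one]
    refine Submodule.smul_mem _ _ ?_
    split_ifs with h
    · subst h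
      exact one_mem_symPart A
    · exact zero_mem _

/-- The component of `F ∈ 𝓡` in `Γ(Λ^• L^∨ ⊗ S^k B^∨)`. -/
def symCoeff (A : Submodule R L) (k : ℕ) : FedosovFun A →ₗ[R] PolyFun A :=
  (PowerSeries.coeff (R := PolyFun A) k).restrictScalars R ∘ₗ (FedosovFun A).val.toLinearMap

theorem symCoeff_mem (A : Submodule R L) (k : ℕ) (F : FedosovFun A) :
    symCoeff A k F ∈ symPart A k := F.2 k

/-- The element `ω ⊗ η₁ ⊙ ⋯ ⊙ η_k` of `𝓡`. -/
def fedMono (A : Submodule R L) (ω : ExteriorAlgebra R (Module.Dual R L))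
    (m : Multiset (Module.Dual R (L ⧸ A))) : FedosovFun A :=
  ⟨PowerSeries.monomial m.card (polyTmul A ω (symProd A m)), by
    intro k
    rw [PowerSeries.coeff_monomial]
    split_ifs with h
    · subst h; exact polyTmul_mem_symPart A ω m
    · exact zero_mem _⟩

/-- `𝓘^k = Γ(Λ^• L^∨ ⊗ Ŝ^{≥ k} B^∨)`, which is all of `𝓡` for `k ≤ 0`. -/
def adicIdeal (A : Submodule R L) (k : ℤ) : Submodule R (FedosovFun A) where
  carrier := {F | ∀ i : ℕ, (i : ℤ) < k → symCoeff A i F = 0}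
  add_mem' hF hG i hi := by rw [map_add, hF i hi, hG i hi, add_zero]
  zero_mem' i _ := map_zero _
  smul_mem' r F hF i hi := by rw [map_smul, hF i hi, smul_zero]

/-- `Γ(Λ^p L^∨ ⊗ Ŝ B^∨)`, the homogeneous functions of degree `p`. -/
def degreePart (A : Submodule R L) (p : ℕ) : Submodule R (FedosovFun A) where
  carrier := {F | ∀ k : ℕ, symCoeff A k F ∈ formPart A p}
  add_mem' hF hG k := by rw [map_add]; exact add_mem (hF k) (hG k)
  zero_mem' k := by rw [map_zero]; exact zero_mem _
  smul_mem' r F hF k := by rw [map_smul]; exact Submodule.smul_mem _ _ (hF k)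

/-- The parity operator: multiplication by `(-1)^p` on `Γ(Λ^p L^∨ ⊗ S B^∨)`. -/
def parityPoly (A : Submodule R L) : PolyFun A →ₗ[R] PolyFun A :=
  PolyFun.mapForm A
    (CliffordAlgebra.involute (Q := (0 : QuadraticForm R (Module.Dual R L)))).toLinearMap

theorem parityPoly_mem (A : Submodule R L) {k : ℕ} {t : PolyFun A} (ht : t ∈ symPart A k) :
    parityPoly A t ∈ symPart A k := by
  refine map_symPart_mem _ _ (fun ω m hm => ?_) ht
  subst hm
  rw [parityPoly, PolyFun.mapForm_tmul]
  exact polyTmul_mem_symPart A _ m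

/-- The parity operator of `𝓡`: multiplication by `(-1)^p` on functions of degree `p`. -/
def parity (A : Submodule R L) : FedosovFun A →ₗ[R] FedosovFun A where
  toFun F := ⟨PowerSeries.mk fun k => parityPoly A (symCoeff A k F), fun k => by
    rw [PowerSeries.coeff_mk]; exact parityPoly_mem A (symCoeff_mem A k F)⟩
  map_add' F G := by ext k; simp
  map_smul' r F := by ext k; simp

/-! ### The Koszul vector field `k = ∑ ξ^i ∂/∂η^i` -/

/-- The morphism from a symmetric algebra to a noncommutative algebra that extends a linear map
with commuting values. -/
def symLift {N T : Type*} [AddCommGroup N] [Module R N] [Ring T] [Algebra R T] (f : N →ₗ[R] T)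
    (hf : ∀ x y, f x * f y = f y * f x) : SymmetricAlgebra R N →ₐ[R] T :=
  RingCon.liftₐEquiv (TensorAlgebra.symRingCon R N) ⟨TensorAlgebra.lift R f, by
    refine RingCon.ringConGen_le.2 (fun x y h => ?_)
    induction h with
    | mul_comm x y => simp [RingCon.ker_apply, hf x y]⟩

theorem symLift_ι {N T : Type*} [AddCommGroup N] [Module R N] [Ring T] [Algebra R T]
    (f : N →ₗ[R] T) (hf : ∀ x y, f x * f y = f y * f x) (x : N) :
    symLift f hf (SymmetricAlgebra.ι R N x) = f x := by
  change TensorAlgebra.lift R f (TensorAlgebra.ι R x) = f x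
  simp

/-- The matrix `[[η, p^∨(η)], [0, η]]`, where `p : L → B` is the projection. -/
def koszulMatrix (A : Submodule R L) :
    Module.Dual R (L ⧸ A) →ₗ[R] Matrix (Fin 2) (Fin 2) (PolyFun A) where
  toFun η :=
    !![polySym A (SymmetricAlgebra.ι R _ η), polyForm A (ExteriorAlgebra.ι R (A.mkQ.dualMap η));
       0, polySym A (SymmetricAlgebra.ι R _ η)]
  map_add' η η' := by
    ext a b
    fin_cases a <;> fin_cases b <;> simp
  map_smul' r η := by
    ext a b
    fin_cases a <;> fin_cases b <;> simp

/-- The algebra morphism `f ↦ [[f, k(f)], [0, f]]`, which encodes the derivation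
`η₁ ⊙ ⋯ ⊙ η_k ↦ ∑_i p^∨(η_i) ⊗ η₁ ⊙ ⋯ η̂_i ⋯ ⊙ η_k` on `Γ(S B^∨)`. -/
def koszulHom (A : Submodule R L) :
    SymmetricAlgebra R (Module.Dual R (L ⧸ A)) →ₐ[R] Matrix (Fin 2) (Fin 2) (PolyFun A) :=
  symLift (koszulMatrix A) fun η η' => by
    have h1 : polySym A (SymmetricAlgebra.ι R _ η) * polySym A (SymmetricAlgebra.ι R _ η') =
        polySym A (SymmetricAlgebra.ι R _ η') * polySym A (SymmetricAlgebra.ι R _ η) := by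
      rw [← map_mul, mul_comm, map_mul]
    ext a b
    fin_cases a <;> fin_cases b <;>
      simp [koszulMatrix, Matrix.mul_apply, Fin.sum_univ_two, h1]
    rw [polySym_mul_polyForm, polySym_mul_polyForm, polyForm_mul_polySym, polyForm_mul_polySym,
      add_comm]

/-- The Koszul vector field on `Γ(Λ^• L^∨ ⊗ S B^∨)`:
`ω ⊗ η₁ ⊙ ⋯ ⊙ η_k ↦ ∑_i (p^∨(η_i) ∧ ω) ⊗ η₁ ⊙ ⋯ η̂_i ⋯ ⊙ η_k`. -/
def koszulPoly (A : Submodule R L) : PolyFun A →ₗ[R] PolyFun A :=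
  PolyFun.lift ((LinearMap.mul R (PolyFun A)).flip.compl₁₂ (polyForm A).toLinearMap
    (Matrix.entryLinearMap R (PolyFun A) 0 1 ∘ₗ (koszulHom A).toLinearMap))

theorem koszulHom_mem (A : Submodule R L) (m : Multiset (Module.Dual R (L ⧸ A))) :
    koszulHom A (symProd A m) 0 0 = polySym A (symProd A m) ∧
    koszulHom A (symProd A m) 1 1 = polySym A (symProd A m) ∧
    (∀ k, m.card = k + 1 → koszulHom A (symProd A m) 0 1 ∈ symPart A k) ∧
    (m.card = 0 → koszulHom A (symProd A m) 0 1 = 0) := by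
  induction m using Multiset.induction with
  | empty => simp [symProd]
  | cons η m ih =>
    obtain ⟨h0, h1, h2, h3⟩ := ih
    have e : koszulHom A (symProd A (η ::ₘ m)) = koszulMatrix A η * koszulHom A (symProd A m) := by
      rw [symProd, Multiset.map_cons, Multiset.prod_cons, map_mul, koszulHom, symLift_ι]
      rfl
    have e' : polySym A (symProd A (η ::ₘ m)) =
        polySym A (SymmetricAlgebra.ι R _ η) * polySym A (symProd A m) := by
      rw [symProd, Multiset.map_cons, Multiset.prod_cons, map_mul]
      rfl
    have h10 : koszulHom A (symProd A m) 1 0 = 0 := by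
      clear h0 h1 h2 h3 e e'
      induction m using Multiset.induction with
      | empty => simp [symProd]
      | cons η m ih =>
        rw [symProd, Multiset.map_cons, Multiset.prod_cons, map_mul, Matrix.mul_apply,
          Fin.sum_univ_two]
        have : koszulHom A (SymmetricAlgebra.ι R _ η) 1 0 = 0 := by
          rw [koszulHom, symLift_ι]; rfl
        rw [this]
        change _ + _ * koszulHom A (symProd A m) 1 0 = 0
        rw [ih, zero_mul, mul_zero, add_zero]
    rw [e, e']
    simp only [Matrix.mul_apply, Fin.sum_univ_two, h0, h1, h10]
    refine ⟨?_, ?_, ?_, ?_⟩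
    · simp [koszulMatrix]
    · simp [koszulMatrix]
    · intro k hk
      obtain rfl : m.card = k := by simpa using hk
      refine add_mem ?_ ?_
      · rcases Nat.eq_zero_or_pos m.card with h | h
        · rw [h3 h, mul_zero]; exact zero_mem _
        · obtain ⟨n, hn⟩ := Nat.exists_eq_succ_of_ne_zero h.ne'
          have := symPart_mul_mem A (polySym_mem_symPart A {η}) (h2 n hn)
          rw [hn, Nat.succ_eq_one_add]
          rw [symProd, Multiset.map_singleton, Multiset.prod_singleton] at this
          exact this
      · have := symPart_mul_mem A
          (polyForm_mem_symPart A (ExteriorAlgebra.ι R (A.mkQ.dualMap η)))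
          (polySym_mem_symPart A m)
        rwa [zero_add] at this
    · intro h; simp at h

theorem koszulPoly_tmul (A : Submodule R L) (ω : ExteriorAlgebra R (Module.Dual R L))
    (f : SymmetricAlgebra R (Module.Dual R (L ⧸ A))) :
    koszulPoly A (polyTmul A ω f) = koszulHom A f 0 1 * polyForm A ω := by
  rw [koszulPoly, PolyFun.lift_tmul]
  simp only [LinearMap.compl₁₂_apply, LinearMap.flip_apply, LinearMap.mul_apply',
    LinearMap.comp_apply, AlgHom.toLinearMap_apply, Matrix.entryLinearMap_apply]

theorem koszulPoly_mem (A : Submodule R L) {k : ℕ} {t : PolyFun A} (ht : t ∈ symPart A (k + 1)) :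
    koszulPoly A t ∈ symPart A k := by
  refine map_symPart_mem _ _ (fun ω m hm => ?_) ht
  rw [koszulPoly_tmul, ← zero_add k, add_comm 0 k]
  exact symPart_mul_mem A ((koszulHom_mem A m).2.2.1 k hm) (polyForm_mem_symPart A ω)

/-- The Koszul vector field `k` on `𝓡`; it maps the `S^{k+1}`-component to the `S^k`-component. -/
def koszul (A : Submodule R L) : FedosovFun A →ₗ[R] FedosovFun A where
  toFun F := ⟨PowerSeries.mk fun k => koszulPoly A (symCoeff A (k + 1) F), fun k => by
    rw [PowerSeries.coeff_mk]; exact koszulPoly_mem A (symCoeff_mem A _ F)⟩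
  map_add' F G := by ext k; simp
  map_smul' r F := by ext k; simp

/-! ### The homotopy operator `h` -/

/-- The component `ξ ↦ ξ^B = p^∨(j^∨(ξ))` of `L^∨ = A^∨ ⊕ B^∨` determined by a splitting `j`. -/
def LieSplitting.projB {A : Submodule R L} (j : LieSplitting A) :
    Module.Dual R L →ₗ[R] Module.Dual R L :=
  A.mkQ.dualMap ∘ₗ j.toLin.dualMap

/-- The algebra morphism `ξ ↦ ξ^A + X ξ^B` from `Λ^• L^∨` to polynomials over `Λ^• L^∨`: the
coefficient of `X^q` in the image of `ω` is the component of `ω` in `Λ^• A^∨ ⊗ Λ^q B^∨`. -/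
def LieSplitting.weight {A : Submodule R L} (j : LieSplitting A) :
    ExteriorAlgebra R (Module.Dual R L) →ₐ[R] Polynomial (ExteriorAlgebra R (Module.Dual R L)) :=
  ExteriorAlgebra.lift R
    ⟨(Polynomial.monomial (R := ExteriorAlgebra R (Module.Dual R L)) 0).restrictScalars R ∘ₗ
        ExteriorAlgebra.ι R ∘ₗ (LinearMap.id - j.projB) +
      (Polynomial.monomial (R := ExteriorAlgebra R (Module.Dual R L)) 1).restrictScalars R ∘ₗ
        ExteriorAlgebra.ι R ∘ₗ j.projB, fun ξ => by
    simp only [LinearMap.add_apply, LinearMap.comp_apply, LinearMap.restrictScalars_apply,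
      mul_add, add_mul, Polynomial.monomial_mul_monomial, ExteriorAlgebra.ι_sq_zero,
      Polynomial.monomial_zero_right, zero_add, add_zero]
    rw [← map_add, add_comm, ExteriorAlgebra.ι_add_mul_swap, map_zero]⟩

/-- The matrix `[[-ξ, j^∨(ξ)], [0, ξ]]`. -/
def LieSplitting.contrMatrix {A : Submodule R L} (j : LieSplitting A) :
    Module.Dual R L →ₗ[R] Matrix (Fin 2) (Fin 2) (PolyFun A) where
  toFun ξ :=
    !![-polyForm A (ExteriorAlgebra.ι R ξ),
         polySym A (SymmetricAlgebra.ι R _ (j.toLin.dualMap ξ));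
       0, polyForm A (ExteriorAlgebra.ι R ξ)]
  map_add' ξ ξ' := by
    ext a b
    fin_cases a <;> fin_cases b <;> simp
    abel
  map_smul' r ξ := by
    ext a b
    fin_cases a <;> fin_cases b <;> simp

/-- The algebra morphism `ω ↦ [[(-1)^{|ω|} ω, k̂(ω)], [0, ω]]`, which encodes the graded derivation
`k̂` of degree `-1` with `k̂(ξ) = j^∨(ξ) ∈ Γ(B^∨)` for `ξ ∈ Γ(L^∨)`. -/
def LieSplitting.contrHom {A : Submodule R L} (j : LieSplitting A) :
    ExteriorAlgebra R (Module.Dual R L) →ₐ[R] Matrix (Fin 2) (Fin 2) (PolyFun A) :=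
  ExteriorAlgebra.lift R ⟨j.contrMatrix, fun ξ => by
    have h : polyForm A (ExteriorAlgebra.ι R ξ) * polyForm A (ExteriorAlgebra.ι R ξ) = 0 := by
      rw [← map_mul, ExteriorAlgebra.ι_sq_zero, map_zero]
    ext a b
    fin_cases a <;> fin_cases b <;>
      simp [LieSplitting.contrMatrix, Matrix.mul_apply, Fin.sum_univ_two, h]
    rw [polySym_mul_polyForm, polyForm_mul_polySym, neg_add_cancel]⟩

/-- The vector field `k̂ = ∑ η^i ∂/∂ξ^i` on `Γ(Λ^• L^∨ ⊗ S B^∨)`, i.e. `ξ₁ ∧ ⋯ ∧ ξ_p ⊗ f ↦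
∑_i (-1)^{i-1} ξ₁ ∧ ⋯ ξ̂_i ⋯ ∧ ξ_p ⊗ j^∨(ξ_i) ⊙ f`. -/
def LieSplitting.hatK {A : Submodule R L} (j : LieSplitting A) : PolyFun A →ₗ[R] PolyFun A :=
  PolyFun.lift ((LinearMap.mul R (PolyFun A)).compl₁₂
    (Matrix.entryLinearMap R (PolyFun A) 0 1 ∘ₗ j.contrHom.toLinearMap) (polySym A).toLinearMap)

theorem LieSplitting.hatK_tmul {A : Submodule R L} (j : LieSplitting A)
    (ω : ExteriorAlgebra R (Module.Dual R L))
    (f : SymmetricAlgebra R (Module.Dual R (L ⧸ A))) :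
    j.hatK (polyTmul A ω f) = j.contrHom ω 0 1 * polySym A f := by
  rw [LieSplitting.hatK, PolyFun.lift_tmul]
  simp only [LinearMap.compl₁₂_apply, LinearMap.mul_apply',
    LinearMap.comp_apply, AlgHom.toLinearMap_apply, Matrix.entryLinearMap_apply]

theorem LieSplitting.contrHom_mem {A : Submodule R L} (j : LieSplitting A)
    (ω : ExteriorAlgebra R (Module.Dual R L)) :
    j.contrHom ω 0 0 ∈ symPart A 0 ∧ j.contrHom ω 0 1 ∈ symPart A 1 ∧
      j.contrHom ω 1 0 = 0 ∧ j.contrHom ω 1 1 ∈ symPart A 0 := by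
  induction ω using ExteriorAlgebra.induction with
  | algebraMap r =>
    rw [AlgHom.commutes, Algebra.algebraMap_eq_smul_one]
    simp only [Matrix.smul_apply, Matrix.one_apply_eq]
    exact ⟨Submodule.smul_mem _ _ (one_mem_symPart A), by simp, by simp,
      Submodule.smul_mem _ _ (one_mem_symPart A)⟩
  | ι ξ =>
    have h1 := polySym_mem_symPart A {j.toLin.dualMap ξ}
    simp only [symProd, Multiset.map_singleton, Multiset.prod_singleton,
      Multiset.card_singleton] at h1
    have e : j.contrHom (ExteriorAlgebra.ι R ξ) = j.contrMatrix ξ := by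
      simp [LieSplitting.contrHom]
    rw [e]
    have e00 : j.contrMatrix ξ 0 0 = -polyForm A (ExteriorAlgebra.ι R ξ) := rfl
    have e01 : j.contrMatrix ξ 0 1 = polySym A (SymmetricAlgebra.ι R _ (j.toLin.dualMap ξ)) := rfl
    have e10 : j.contrMatrix ξ 1 0 = 0 := rfl
    have e11 : j.contrMatrix ξ 1 1 = polyForm A (ExteriorAlgebra.ι R ξ) := rfl
    rw [e00, e01, e10, e11]
    exact ⟨neg_mem (polyForm_mem_symPart A _), h1, rfl, polyForm_mem_symPart A _⟩
  | mul a b ha hb =>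
    obtain ⟨a1, a2, a3, a4⟩ := ha
    obtain ⟨b1, b2, b3, b4⟩ := hb
    have h00 := symPart_mul_mem A a1 b1
    have h01 := symPart_mul_mem A a1 b2
    have h01' := symPart_mul_mem A a2 b4
    have h11 := symPart_mul_mem A a4 b4
    rw [zero_add] at h00 h01 h11
    rw [add_zero] at h01'
    simp only [map_mul, Matrix.mul_apply, Fin.sum_univ_two, a3, b3, mul_zero, zero_mul, add_zero,
      zero_add]
    exact ⟨h00, add_mem h01 h01', trivial, h11⟩
  | add a b ha hb =>
    obtain ⟨a1, a2, a3, a4⟩ := ha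
    obtain ⟨b1, b2, b3, b4⟩ := hb
    simp only [map_add, Matrix.add_apply, a3, b3, add_zero]
    exact ⟨add_mem a1 b1, add_mem a2 b2, trivial, add_mem a4 b4⟩

variable (𝕜) in
/-- The operator `ω ↦ ∑_{p₂} (p₂ + q)⁻¹ ω_{p₂}` on `Λ^• L^∨`, where `ω_{p₂}` is the component of
`ω` in `Λ^• A^∨ ⊗ Λ^{p₂} B^∨` and the term `p₂ = q = 0` is zero (as `0⁻¹ = 0` in `𝕜`). -/
def LieSplitting.scale {A : Submodule R L} (j : LieSplitting A) (q : ℕ) :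
    ExteriorAlgebra R (Module.Dual R L) →ₗ[R] ExteriorAlgebra R (Module.Dual R L) :=
  Polynomial.lsum (fun p₂ => algebraMap 𝕜 R (((p₂ : 𝕜) + (q : 𝕜))⁻¹) • LinearMap.id) ∘ₗ
    j.weight.toLinearMap

variable (𝕜) in
/-- The operator `h` on `Γ(Λ^• L^∨ ⊗ S^q B^∨)`: on `Γ(Λ^{p₁} A^∨ ⊗ Λ^{p₂} B^∨ ⊗ S^q B^∨)` it is
`(p₂ + q)⁻¹ k̂` if `p₂ + q > 0`, and zero if `p₂ = q = 0`. -/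
def LieSplitting.homotopyPoly {A : Submodule R L} (j : LieSplitting A) (q : ℕ) :
    PolyFun A →ₗ[R] PolyFun A :=
  j.hatK ∘ₗ PolyFun.mapForm A (j.scale 𝕜 q)

theorem LieSplitting.homotopyPoly_mem {A : Submodule R L} (j : LieSplitting A) {q : ℕ}
    {t : PolyFun A} (ht : t ∈ symPart A q) : j.homotopyPoly 𝕜 q t ∈ symPart A (q + 1) := by
  refine map_symPart_mem _ _ (fun ω m hm => ?_) ht
  subst hm
  rw [LieSplitting.homotopyPoly, LinearMap.comp_apply, PolyFun.mapForm_tmul,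
    LieSplitting.hatK_tmul, add_comm]
  exact symPart_mul_mem A (j.contrHom_mem _).2.1 (polySym_mem_symPart A m)

variable (𝕜) in
/-- The operator `h` on `𝓡`. -/
def LieSplitting.homotopy {A : Submodule R L} (j : LieSplitting A) :
    FedosovFun A →ₗ[R] FedosovFun A where
  toFun F := ⟨PowerSeries.mk fun k => match k with
      | 0 => 0
      | q + 1 => j.homotopyPoly 𝕜 q (symCoeff A q F), fun k => by
    rw [PowerSeries.coeff_mk]
    match k with
    | 0 => exact zero_mem _
    | q + 1 => exact j.homotopyPoly_mem (symCoeff_mem A q F)⟩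
  map_add' F G := by ext k; cases k <;> simp
  map_smul' r F := by ext k; cases k <;> simp

end FunctionAlgebra

/-! ## Operators on the function algebra -/

section Operators

variable {𝕜 R L : Type*} [Field 𝕜] [CommRing R] [Algebra 𝕜 R] [AddCommGroup L] [Module R L]

variable (𝕜) in
/-- The `𝕜`-linear operators on `𝓡`; the product is the composition. -/
abbrev FedosovOp (A : Submodule R L) : Type _ := Module.End 𝕜 (FedosovFun A)

/-- Continuity of a linear operator in the `𝓘`-adic topology. -/
def IsAdicContinuous {A : Submodule R L} (φ : FedosovOp 𝕜 A) : Prop :=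
  ∀ k : ℕ, ∃ m : ℕ, ∀ F ∈ adicIdeal A m, φ F ∈ adicIdeal A k

/-- `φ` is homogeneous of degree `p` for the degree of forms. -/
def HasFormDegree {A : Submodule R L} (p : ℕ) (φ : FedosovOp 𝕜 A) : Prop :=
  ∀ q, ∀ F ∈ degreePart A q, φ F ∈ degreePart A (q + p)

/-- Vertical operators: continuous and linear over `Γ(Λ^• L^∨)`.  Coefficients in `Γ(Λ^• L^∨)` of an
operator are written to the left (`D = ω ⊗ f ⊗ b` sends `ω' ⊗ f'` to `(ω ∧ ω') ⊗ f ι_b(f')`), so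
that linearity, which follows the Koszul sign rule, is linearity for the multiplication by
`Γ(Λ^• L^∨)` from the right. -/
structure IsVerticalOp {A : Submodule R L} (φ : FedosovOp 𝕜 A) : Prop where
  continuous : IsAdicContinuous φ
  map_mul_form : ∀ F (ω : ExteriorAlgebra R (Module.Dual R L)),
    φ (F * fedMono A ω 0) = φ F * fedMono A ω 0

/-- `φ` shifts the `𝓘`-adic filtration by `N`:
it maps `Γ(Λ^• L^∨ ⊗ S^k B^∨)` into `Γ(Λ^• L^∨ ⊗ Ŝ^{≥ k + N} B^∨)` for all `k`. -/
def ShiftsBy {A : Submodule R L} (N : ℤ) (φ : FedosovOp 𝕜 A) : Prop :=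
  ∀ (k : ℕ) (F : FedosovFun A), (∀ i, i ≠ k → symCoeff A i F = 0) → φ F ∈ adicIdeal A (k + N)

/-- The algebra of `𝓘`-adic filtration-shifting vertical operators. -/
def IsShiftingOp {A : Submodule R L} (φ : FedosovOp 𝕜 A) : Prop :=
  IsVerticalOp φ ∧ ∃ N : ℤ, ShiftsBy N φ

/-- `X` is a vertical vector field of degree `p` that belongs to
`Γ(Λ^p L^∨ ⊗ Ŝ^{≥ n} B^∨ ⊗ B)`: a vertical operator that is a derivation of degree `p` and maps
`Γ(B^∨)` into `Γ(Λ^p L^∨ ⊗ Ŝ^{≥ n} B^∨)`. -/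
structure IsVerticalField {A : Submodule R L} (p n : ℕ) (X : FedosovOp 𝕜 A) : Prop where
  vertical : IsVerticalOp X
  degree : HasFormDegree p X
  leibniz : ∀ F G, X (F * G) = X F * G + (⇑(parity A))^[p] F * X G
  order : ∀ η, X (fedMono A 1 {η}) ∈ adicIdeal A n

/-- `φ = ∑_q D_q`, where `D_q ∈ Γ(Λ^• L^∨ ⊗ Ŝ B^∨ ⊗ S^q B)` is the vertical differential operator
whose restriction to `Γ(S^q B^∨)` is the restriction of the `R`-linear map `s`.
An element `D_q` of `Γ(Λ^• L^∨ ⊗ Ŝ B^∨ ⊗ S^q B)` is the same thing as an `R`-linear map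
`s_q : Γ(S^q B^∨) → 𝓡`, and it operates on `𝓡` by
`D_q(ω ⊗ η₁ ⊙ ⋯ ⊙ η_n) = ∑_{I ⊆ {1, …, n}, |I| = q} s_q(⨀_{i ∈ I} η_i) · (ω ⊗ ⨀_{i ∉ I} η_i)`. -/
def HasSymbol {A : Submodule R L} (φ : FedosovOp 𝕜 A)
    (s : SymmetricAlgebra R (Module.Dual R (L ⧸ A)) →ₗ[R] FedosovFun A) : Prop :=
  ∀ (ω : ExteriorAlgebra R (Module.Dual R L)) (m : Multiset (Module.Dual R (L ⧸ A))),
    φ (fedMono A ω m) =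
      (m.antidiagonal.map fun I => s (symProd A I.1) * fedMono A ω I.2).sum

open Classical in
/-- The operator `h_♮` on filtration-shifting vertical operators:
`h_♮(∑_q D_q) = ∑_q h_♮(D_q)`, where `h_♮ = h ⊗ id` on `Γ(Λ^• L^∨ ⊗ Ŝ B^∨ ⊗ S^q B)`, that is,
`s_q` is replaced by `h ∘ s_q`. The decomposition of a filtration-shifting vertical operator exists
and is unique; the value at other operators is irrelevant and set to zero. -/
def LieSplitting.hNat {A : Submodule R L} (j : LieSplitting A) (φ : FedosovOp 𝕜 A) :
    FedosovOp 𝕜 A :=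
  if h : ∃ ψ : FedosovOp 𝕜 A, IsShiftingOp φ ∧ IsShiftingOp ψ ∧
      ∃ s, HasSymbol φ s ∧ HasSymbol ψ (j.homotopy 𝕜 ∘ₗ s)
  then h.choose else 0

variable (𝕜) in
/-- The Koszul vector field as an operator. -/
def koszulOp (A : Submodule R L) : FedosovOp 𝕜 A := (koszul A).restrictScalars 𝕜

variable (𝕜) in
/-- The parity operator as an operator. -/
def parityOp (A : Submodule R L) : FedosovOp 𝕜 A := (parity A).restrictScalars 𝕜

/-- The graded commutator `[D, φ] = D ∘ φ - (-1)^{|φ|} φ ∘ D` of an operator `D` of odd degree with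
an operator `φ`; conjugation with the parity operator multiplies `φ` by `(-1)^{|φ|}`. -/
def oddCommutator {A : Submodule R L} (D φ : FedosovOp 𝕜 A) : FedosovOp 𝕜 A :=
  D * φ - parityOp 𝕜 A * φ * parityOp 𝕜 A * D

/-- The contraction `ι_l` with `l ∈ Γ(L)` on `Γ(Λ^• L^∨ ⊗ S B^∨)`. -/
def contractPoly (A : Submodule R L) (l : L) : PolyFun A →ₗ[R] PolyFun A :=
  PolyFun.mapForm A (CliffordAlgebra.contractLeft
    (Q := (0 : QuadraticForm R (Module.Dual R L))) (Module.Dual.eval R L l))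

/-- `d` is the covariant derivative `d_L^∇` on `𝓡 = Γ(Λ^• L^∨ ⊗ Ŝ B^∨)`: it acts on each
`Γ(Λ^• L^∨ ⊗ S^k B^∨)` separately, it is a derivation of degree `1`, it extends `d_L`, and
`ι_l(d η) = ∇_l η` for all `l ∈ Γ(L)` and `η ∈ Γ(B^∨)`. -/
structure LConnection.IsCovariantDerivative {𝓛 : LieAlgebroid 𝕜 R L} {A : Submodule R L}
    (D : LConnection 𝓛 A) (d : FedosovOp 𝕜 A) : Prop where
  symCoeff_eq_zero : ∀ F k, symCoeff A k F = 0 → symCoeff A k (d F) = 0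
  degree : HasFormDegree 1 d
  leibniz : ∀ F G, d (F * G) = d F * G + parity A F * d G
  form : ∀ ω : ExteriorAlgebra R (Module.Dual R L), d (fedMono A ω 0) = fedMono A (𝓛.dCE ω) 0
  dual : ∀ η l, contractPoly A l (symCoeff A 1 (d (fedMono A 1 {η}))) =
    symCoeff A 1 (fedMono A 1 {D.dual l η})

/-- `Q = -k + d_L^∇ + X` is the Fedosov vector field of the splitting `j` and the torsion-free
connection `∇`: `X ∈ Γ(L^∨ ⊗ Ŝ^{≥ 2} B^∨ ⊗ B)`, `h_♮(X) = 0` and `Q² = 0`.  (For a vertical vector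
field `X`, `h_♮(X) = (h ⊗ id_B)(X)` vanishes if and only if `h(X(η)) = 0` for all
`η ∈ Γ(B^∨)`.) -/
def IsFedosovField {𝓛 : LieAlgebroid 𝕜 R L} {A : Submodule R L} (j : LieSplitting A)
    (D : LConnection 𝓛 A) (Q : FedosovOp 𝕜 A) : Prop :=
  ∃ d X : FedosovOp 𝕜 A, D.IsCovariantDerivative d ∧ IsVerticalField 1 2 X ∧
    (∀ η, j.homotopy 𝕜 (X (fedMono A 1 {η})) = 0) ∧
    Q = -koszulOp 𝕜 A + d + X ∧ Q * Q = 0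

/-- `φ` is a vertical isomorphism of dg algebras `(𝓡, Q₂) → (𝓡, Q₁)`. -/
structure IsVerticalIso {A : Submodule R L} (Q₂ Q₁ φ : FedosovOp 𝕜 A) : Prop where
  vertical : IsVerticalOp φ
  degree : HasFormDegree 0 φ
  map_one : φ 1 = 1
  map_mul : ∀ F G, φ (F * G) = φ F * φ G
  bijective : Function.Bijective φ
  comm : φ * Q₂ = Q₁ * φ

/-- The operator `ð(φ) = ΔQ ∘ φ + [k + Q₂, φ]`, where `ΔQ = Q₁ - Q₂`. -/
def ethOp {A : Submodule R L} (Q₁ Q₂ φ : FedosovOp 𝕜 A) : FedosovOp 𝕜 A :=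
  (Q₁ - Q₂) * φ + oddCommutator (koszulOp 𝕜 A + Q₂) φ

/-- `(h_♮ ð)^n (h_♮(ΔQ))`. -/
def LieSplitting.iterTerm {A : Submodule R L} (j : LieSplitting A) (Q₁ Q₂ : FedosovOp 𝕜 A)
    (n : ℕ) : FedosovOp 𝕜 A :=
  (fun φ => j.hNat (ethOp Q₁ Q₂ φ))^[n] (j.hNat (Q₁ - Q₂))

/-- The series `∑_i a_i` of operators converges to `φ`, unconditionally and uniformly for the
`𝓘`-adic topology. -/
def HasUniformSum {A : Submodule R L} {ι : Type*} (a : ι → FedosovOp 𝕜 A) (φ : FedosovOp 𝕜 A) :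
    Prop :=
  ∀ k : ℕ, ∃ s₀ : Finset ι, ∀ s : Finset ι, s₀ ⊆ s →
    ∀ F, (φ - ∑ i ∈ s, a i) F ∈ adicIdeal A k

end Operators

/-! ## Vector bundles and Lie pairs over a smooth manifold -/

open scoped Manifold ContDiff Topology

section Bundles

variable (𝕜 : Type*) [RCLike 𝕜]
  {E : Type*} [NormedAddCommGroup E] [NormedSpace ℝ E]
  (M : Type*) [TopologicalSpace M] [ChartedSpace E M]

variable (E) in
/-- The algebra `C^∞(M, 𝕜)`, as a subalgebra of the algebra of all functions. -/
def smoothFunSubalgebra : Subalgebra 𝕜 (M → 𝕜) where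
  carrier := {f | ContMDiff 𝓘(ℝ, E) 𝓘(ℝ, 𝕜) ∞ f}
  mul_mem' hf hg := contDiff_mul.comp_contMDiff (hf.prodMk_space hg)
  add_mem' hf hg := hf.add hg
  algebraMap_mem' _ := contMDiff_const

variable (E) in
/-- The algebra `C^∞(M, 𝕜)` of smooth functions. -/
def SmoothFun : Type _ := smoothFunSubalgebra 𝕜 E M

instance : CommRing (SmoothFun 𝕜 E M) :=
  inferInstanceAs (CommRing (smoothFunSubalgebra 𝕜 E M))

instance : Algebra 𝕜 (SmoothFun 𝕜 E M) :=
  inferInstanceAs (Algebra 𝕜 (smoothFunSubalgebra 𝕜 E M))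

variable {M}
variable (F : Type*) [NormedAddCommGroup F] [NormedSpace ℝ F] [NormedSpace 𝕜 F]
  [IsScalarTower ℝ 𝕜 F]
  (V : M → Type*) [TopologicalSpace (Bundle.TotalSpace F V)]
  [∀ x, AddCommGroup (V x)] [∀ x, Module ℝ (V x)] [∀ x, Module 𝕜 (V x)]
  [∀ x, TopologicalSpace (V x)] [FiberBundle F V] [VectorBundle ℝ F V] [VectorBundle 𝕜 F V]

variable (E) in
/-- The smooth sections of a `𝕜`-vector bundle `V` over the real manifold `M`, as a submodule of the
module of all sections. -/
def smoothSecSubmodule : Submodule (smoothFunSubalgebra 𝕜 E M) (∀ x, V x) where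
  carrier := {s | ContMDiff 𝓘(ℝ, E) (𝓘(ℝ, E).prod 𝓘(ℝ, F)) ∞
    fun x => Bundle.TotalSpace.mk' F x (s x)}
  add_mem' hs ht := ContMDiff.add_section hs ht
  zero_mem' := Bundle.contMDiff_zeroSection ℝ V
  smul_mem' f s hs := by
    intro x₀
    have h := hs x₀
    rw [Bundle.contMDiffAt_section] at h ⊢
    have hf : ContMDiffAt 𝓘(ℝ, E) 𝓘(ℝ, 𝕜) ∞ f.1 x₀ := f.2 x₀
    have hsm : ContDiff ℝ ∞ fun p : 𝕜 × F => p.1 • p.2 :=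
      (isBoundedBilinearMap_smul (𝕜 := ℝ) (A := 𝕜) (E := F)).contDiff
    refine ((hsm.contMDiff (x := (f.1 x₀, _))).comp x₀ (hf.prodMk_space h)).congr_of_eventuallyEq ?_
    filter_upwards [(trivializationAt F V x₀).open_baseSet.mem_nhds
      (FiberBundle.mem_baseSet_trivializationAt' x₀)] with x hx
    exact ((trivializationAt F V x₀).linear 𝕜 hx).2 (f.1 x) (s x)

variable (E) in
/-- The `C^∞(M, 𝕜)`-module `Γ(V)` of smooth sections of a `𝕜`-vector bundle `V`. -/
def SmoothSec : Type _ := smoothSecSubmodule 𝕜 E F V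

instance : AddCommGroup (SmoothSec 𝕜 E F V) :=
  inferInstanceAs (AddCommGroup (smoothSecSubmodule 𝕜 E F V))

instance : Module (SmoothFun 𝕜 E M) (SmoothSec 𝕜 E F V) :=
  inferInstanceAs (Module (smoothFunSubalgebra 𝕜 E M) (smoothSecSubmodule 𝕜 E F V))

/-- A family of subspaces `A x ⊆ V x` is a smooth vector subbundle of `V`: locally, it has a frame
that consists of smooth sections of `V`. -/
def IsSmoothSubbundle (A : ∀ x, Submodule 𝕜 (V x)) : Prop :=
  ∀ x₀ : M, ∃ U ∈ 𝓝 x₀, ∃ (r : ℕ) (s : Fin r → SmoothSec 𝕜 E F V), ∀ x ∈ U,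
    LinearIndependent 𝕜 (fun i => (s i).1 x) ∧ Submodule.span 𝕜 (Set.range fun i => (s i).1 x) = A x

variable (E) in
/-- The module `Γ(A)` of smooth sections of a subbundle `A` of `V`, as a submodule of `Γ(V)`. -/
def SubbundleSec (A : ∀ x, Submodule 𝕜 (V x)) :
    Submodule (SmoothFun 𝕜 E M) (SmoothSec 𝕜 E F V) where
  carrier := {s | ∀ x, s.1 x ∈ A x}
  add_mem' hs ht x := add_mem (hs x) (ht x)
  zero_mem' x := zero_mem (A x)
  smul_mem' f _ hs x := (A x).smul_mem (f.1 x) (hs x)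

/-- `(L, A)` is a Lie pair, where `L` is the bundle `V` with the Lie algebroid structure `𝓛`: `A` is
a vector subbundle of `L` and `Γ(A)` is closed under the Lie bracket. -/
structure IsLiePair (𝓛 : LieAlgebroid 𝕜 (SmoothFun 𝕜 E M) (SmoothSec 𝕜 E F V))
    (A : ∀ x, Submodule 𝕜 (V x)) : Prop where
  subbundle : IsSmoothSubbundle (E := E) 𝕜 F V A
  bracket_mem : ∀ l₁ ∈ SubbundleSec 𝕜 E F V A, ∀ l₂ ∈ SubbundleSec 𝕜 E F V A,
    𝓛.bracket l₁ l₂ ∈ SubbundleSec 𝕜 E F V A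

end Bundles

end

open scoped Manifold ContDiff

/-!
The argument is algebraic and uses no more about `M` than that `R = C^∞(M, 𝕜)` is reduced and has
characteristic zero (`Fedosov.verticalIso_exp_log`). It takes place in the algebra of operators that
map `𝓘^k` into `𝓘^(k + N)` for all `k`, called `Fedosov.raising 𝕜 A N`.

*A vertical isomorphism is unipotent.* As `φ` is continuous and multiplicative, a power of `φ(η)`
lies in `𝓘` for `η ∈ Γ(B^∨)`; as `R` is reduced, `φ(η)` itself does, and so `φ` preserves the
filtration. Now `Q_i = -k` up to operators that preserve the filtration, and `φ` fixes `k(η)`, which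
is a form on `L`. Hence `φ Q₂ = Q₁ φ` gives `k(φ(η) - η) ∈ 𝓘`, and the homotopy formula
`h k = id`, valid for functions of form degree zero that vanish on the zero section, gives
`φ(η) - η ∈ 𝓘²`. So `ψ = φ - 1` raises the filtration by one
(`Fedosov.verticalIso_sub_one_mem_raising`).

*The perturbation series.* The relation `φ Q₂ = Q₁ φ` can be written `[k, ψ] = ΔQ + ð ψ`. A vertical
operator is determined by its symbol `s : Γ(S B^∨) → 𝓡`, the convolution of its restriction to
`Γ(S B^∨)` with the antipode, and `h_♮` replaces `s` by `h ∘ s`. If `s` is the symbol of `ψ`, then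
`k ∘ s` is that of `[k, ψ]`, whence `h_♮[k, ψ] = ψ` by the homotopy formula
(`Fedosov.hNat_koszul`). Thus `ψ = h_♮(ΔQ) + h_♮ ð ψ`, and as `h_♮ ð` raises the filtration by one,
iterating gives `ψ = ∑_n (h_♮ ð)^n (h_♮(ΔQ))` (`Fedosov.verticalIso_sub_sum_mem_raising`).
Nothing relates the splitting that defines `h_♮` to those of `Q₁` and `Q₂`.

*Logarithm and exponential.* The series `φ^t = ∑_k (t choose k) ψ^k` is, modulo operators that raise
the filtration by `K`, a polynomial in `t` which is the power `φ^n` at every natural number `n`. A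
polynomial with values in a vector space that lies in a subspace at all natural numbers has its
coefficients there (`Fedosov.functional_sum_sub_sum_mem`). So the identities
`φ^t(F G) = φ^t(F) φ^t(G)` and `φ^(s + t) = φ^s φ^t` hold for polynomials; the coefficient of `t` in
the first says that `Y = log φ` is a derivation (`Fedosov.logOp_leibniz`), and the second gives
`φ^t = ∑_m t^m Y^m / m!`, thus `φ = e^Y` (`Fedosov.sub_exp_logOp_mem`).

*Uniqueness.* If `e^Y = e^Y'` and `Y' - Y` raises the filtration by `r`, then the terms of order at
least two of the two series differ by operators that raise it by `r + 1`, and hence so does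
`Y' - Y` (`Fedosov.exp_injective`).
-/

noncomputable section

namespace Fedosov

/-! ### Polynomials with values in a vector space -/

section Polynomials

open Polynomial

variable {𝕜 : Type*} [Field 𝕜]

/-- If a polynomial with values in a vector space takes its values at the natural numbers in a
subspace, then so does every linear functional of its coefficients. -/
theorem functional_sum_sub_sum_mem [CharZero 𝕜] {V ι κ : Type*} [AddCommGroup V] [Module 𝕜 V]
    (W : Submodule 𝕜 V) (s : Finset ι) (t : Finset κ) (p : ι → 𝕜[X]) (q : κ → 𝕜[X])
    (v : ι → V) (w : κ → V)
    (h : ∀ n : ℕ, ∑ i ∈ s, (p i).eval (n : 𝕜) • v i - ∑ i ∈ t, (q i).eval (n : 𝕜) • w i ∈ W)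
    (f : 𝕜[X] →ₗ[𝕜] 𝕜) :
    ∑ i ∈ s, f (p i) • v i - ∑ i ∈ t, f (q i) • w i ∈ W := by
  rw [← Submodule.Quotient.mk_eq_zero, ← Submodule.mkQ_apply,
    ← Module.forall_dual_apply_eq_zero_iff 𝕜]
  intro g
  have hP : ∑ i ∈ s, g (W.mkQ (v i)) • p i - ∑ i ∈ t, g (W.mkQ (w i)) • q i = 0 := by
    refine Polynomial.eq_zero_of_infinite_isRoot _
      (Set.infinite_of_injective_forall_mem (f := fun n : ℕ => (n : 𝕜)) Nat.cast_injective
        fun n => ?_)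
    have h1 := congrArg g ((Submodule.Quotient.mk_eq_zero W).2 (h n))
    rw [← Submodule.mkQ_apply, map_zero] at h1
    simp only [map_sub, map_sum, map_smul, smul_eq_mul] at h1
    simp only [Set.mem_ofPred_eq, IsRoot.def, eval_sub, eval_finsetSum, eval_smul, smul_eq_mul]
    simpa only [mul_comm] using h1
  have h2 := congrArg f hP
  simp only [map_sub, map_sum, map_smul, smul_eq_mul, map_zero] at h2
  simp only [map_sub, map_sum, map_smul, smul_eq_mul]
  simpa only [mul_comm] using h2

variable (𝕜) in
/-- The binomial coefficient `t ↦ t (t - 1) ⋯ (t - k + 1) / k!` as a polynomial. -/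
def binomialPoly (k : ℕ) : 𝕜[X] := C ((k.factorial : 𝕜)⁻¹) * descPochhammer 𝕜 k

theorem binomialPoly_eval [CharZero 𝕜] (k n : ℕ) :
    (binomialPoly 𝕜 k).eval (n : 𝕜) = n.choose k := by
  have h : (k.factorial : 𝕜) ≠ 0 := Nat.cast_ne_zero.2 k.factorial_ne_zero
  rw [binomialPoly, eval_mul, eval_C, descPochhammer_eval_eq_descFactorial,
    Nat.descFactorial_eq_factorial_mul_choose, Nat.cast_mul, inv_mul_cancel_left₀ h]

theorem binomialPoly_coeff_zero [CharZero 𝕜] (k : ℕ) :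
    (binomialPoly 𝕜 k).coeff 0 = if k = 0 then 1 else 0 := by
  have h := binomialPoly_eval (𝕜 := 𝕜) k 0
  rw [Nat.cast_zero, ← coeff_zero_eq_eval_zero] at h
  rw [h]
  cases k <;> simp

theorem binomialPoly_zero_coeff_one : (binomialPoly 𝕜 0).coeff 1 = 0 := by
  simp [binomialPoly, coeff_one]

theorem binomialPoly_succ_coeff_one [CharZero 𝕜] (k : ℕ) :
    (binomialPoly 𝕜 (k + 1)).coeff 1 = (-1) ^ k / ((k : 𝕜) + 1) := by
  have h1 : (descPochhammer 𝕜 k).eval (-1) = (-1) ^ k * (k.factorial : 𝕜) := by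
    induction k with
    | zero => simp
    | succ k ih =>
      rw [descPochhammer_succ_right, eval_mul, ih, Nat.factorial_succ]
      simp only [eval_sub, eval_X, eval_natCast]
      push_cast
      ring
  have h2 : ((k + 1 : ℕ) : 𝕜) ≠ 0 := Nat.cast_ne_zero.2 k.succ_ne_zero
  have h3 : (k.factorial : 𝕜) ≠ 0 := Nat.cast_ne_zero.2 k.factorial_ne_zero
  rw [binomialPoly, coeff_C_mul, descPochhammer_succ_left, coeff_X_mul, coeff_zero_eq_eval_zero,
    eval_comp]
  simp only [eval_sub, eval_X, eval_one, zero_sub]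
  rw [h1, Nat.factorial_succ]
  push_cast at h2 ⊢
  field_simp

theorem binomialPoly_natDegree_lt {k K : ℕ} (h : k < K) : (binomialPoly 𝕜 k).natDegree < K :=
  (natDegree_C_mul_le _ _).trans_lt (by rwa [descPochhammer_natDegree])

end Polynomials

variable {𝕜 R L : Type*} [Field 𝕜] [CommRing R] [Algebra 𝕜 R] [AddCommGroup L] [Module R L]
  {A : Submodule R L}

/-- The ring of operators, as a shortcut for instance search, which does not see quickly that the
additive structures obtained through the ring and through the semiring of endomorphisms agree. -/
abbrev opRing : Ring (FedosovOp 𝕜 A) := Module.End.instRing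

/-- The additive group of operators, as a shortcut for instance search. -/
abbrev opAddCommGroup : AddCommGroup (FedosovOp 𝕜 A) := LinearMap.addCommGroup

attribute [local instance low] opRing opAddCommGroup

/-! ### Components and the adic filtration -/

theorem ext_symCoeff {F G : FedosovFun A} (h : ∀ k, symCoeff A k F = symCoeff A k G) : F = G :=
  Subtype.ext (PowerSeries.ext h)

theorem symCoeff_mul (k : ℕ) (F G : FedosovFun A) :
    symCoeff A k (F * G) =
      ∑ x ∈ Finset.HasAntidiagonal.antidiagonal k, symCoeff A x.1 F * symCoeff A x.2 G :=
  PowerSeries.coeff_mul k F.1 G.1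

/-- The function with given components. -/
def ofComponents (f : ℕ → PolyFun A) (h : ∀ k, f k ∈ symPart A k) : FedosovFun A :=
  ⟨PowerSeries.mk f, fun k => by rw [PowerSeries.coeff_mk]; exact h k⟩

theorem symCoeff_ofComponents (k : ℕ) (f : ℕ → PolyFun A) (h : ∀ k, f k ∈ symPart A k) :
    symCoeff A k (ofComponents f h) = f k :=
  PowerSeries.coeff_mk k f

theorem symCoeff_smul (c : 𝕜) (k : ℕ) (F : FedosovFun A) :
    symCoeff A k (c • F) = c • symCoeff A k F := rfl

theorem symCoeff_fedMono (k : ℕ) (θ : ExteriorAlgebra R (Module.Dual R L))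
    (m : Multiset (Module.Dual R (L ⧸ A))) :
    symCoeff A k (fedMono A θ m) = if k = m.card then polyTmul A θ (symProd A m) else 0 :=
  PowerSeries.coeff_monomial k m.card _

theorem symProd_zero : symProd A 0 = 1 := rfl

theorem symProd_cons (η : Module.Dual R (L ⧸ A)) (m : Multiset (Module.Dual R (L ⧸ A))) :
    symProd A (η ::ₘ m) = SymmetricAlgebra.ι R _ η * symProd A m := by
  rw [symProd, Multiset.map_cons, Multiset.prod_cons]; rfl

theorem symProd_add (m m' : Multiset (Module.Dual R (L ⧸ A))) :
    symProd A (m + m') = symProd A m * symProd A m' := by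
  simp [symProd]

theorem fedMono_mul (θ θ' : ExteriorAlgebra R (Module.Dual R L))
    (m m' : Multiset (Module.Dual R (L ⧸ A))) :
    fedMono A θ m * fedMono A θ' m' = fedMono A (θ * θ') (m + m') := by
  refine Subtype.ext ?_
  change PowerSeries.monomial _ _ * PowerSeries.monomial _ _ = PowerSeries.monomial _ _
  rw [PowerSeries.monomial_mul_monomial, polyTmul_mul, symProd_add, Multiset.card_add]

theorem fedMono_one_zero : fedMono A 1 0 = 1 := by
  refine Subtype.ext ?_
  change PowerSeries.monomial (R := PolyFun A) 0 (polyTmul A 1 1) = 1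
  rw [← polyForm_mul_polySym, map_one, map_one, one_mul]
  ext k
  rw [PowerSeries.coeff_monomial, PowerSeries.coeff_one]

theorem fedMono_one_cons (η : Module.Dual R (L ⧸ A)) (m : Multiset (Module.Dual R (L ⧸ A))) :
    fedMono A 1 (η ::ₘ m) = fedMono A 1 {η} * fedMono A 1 m := by
  rw [fedMono_mul, mul_one, Multiset.singleton_add]

theorem fedMono_eq_mul (θ : ExteriorAlgebra R (Module.Dual R L))
    (m : Multiset (Module.Dual R (L ⧸ A))) :
    fedMono A θ m = fedMono A 1 m * fedMono A θ 0 := by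
  rw [fedMono_mul, one_mul, add_zero]

theorem polyTmul_smul (r : R) (θ : ExteriorAlgebra R (Module.Dual R L))
    (f : SymmetricAlgebra R (Module.Dual R (L ⧸ A))) :
    polyTmul A (r • θ) f = r • polyTmul A θ f := by
  rw [polyTmul, polyTmul, ← map_smul, TensorProduct.smul_tmul']

theorem fedMono_smul (r : R) (θ : ExteriorAlgebra R (Module.Dual R L))
    (m : Multiset (Module.Dual R (L ⧸ A))) :
    fedMono A (r • θ) m = r • fedMono A θ m := by
  refine ext_symCoeff fun k => ?_
  rw [map_smul, symCoeff_fedMono, symCoeff_fedMono]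
  split_ifs
  · exact polyTmul_smul r θ _
  · simp

theorem fedMono_add (θ θ' : ExteriorAlgebra R (Module.Dual R L))
    (m : Multiset (Module.Dual R (L ⧸ A))) :
    fedMono A (θ + θ') m = fedMono A θ m + fedMono A θ' m := by
  refine ext_symCoeff fun k => ?_
  rw [map_add, symCoeff_fedMono, symCoeff_fedMono, symCoeff_fedMono]
  split_ifs
  · simp [polyTmul, TensorProduct.add_tmul]
  · simp

theorem mul_fedMono_algebraMap (r : R) (F : FedosovFun A) :
    F * fedMono A (algebraMap R _ r) 0 = r • F := by
  rw [Algebra.algebraMap_eq_smul_one, fedMono_smul, mul_smul_comm, fedMono_one_zero, mul_one]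

theorem span_symProd : Submodule.span R (Set.range (symProd A)) = ⊤ := by
  refine eq_top_iff.2 fun f _ => ?_
  induction f using SymmetricAlgebra.induction with
  | algebraMap r =>
    rw [Algebra.algebraMap_eq_smul_one]
    exact Submodule.smul_mem _ _ (Submodule.subset_span ⟨0, rfl⟩)
  | ι η =>
    refine Submodule.subset_span ⟨{η}, ?_⟩
    simp [symProd]
  | mul a b ha hb =>
    have h : Submodule.span R (Set.range (symProd A)) * Submodule.span R (Set.range (symProd A)) ≤
        Submodule.span R (Set.range (symProd A)) := by
      rw [Submodule.span_mul_span]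
      refine Submodule.span_mono ?_
      rintro _ ⟨_, ⟨m, rfl⟩, _, ⟨m', rfl⟩, rfl⟩
      exact ⟨m + m', symProd_add m m'⟩
    exact h (Submodule.mul_mem_mul (ha trivial) (hb trivial))
  | add a b ha hb => exact add_mem (ha trivial) (hb trivial)

theorem linearMap_ext_symProd {N : Type*} [AddCommGroup N] [Module R N]
    {g h : SymmetricAlgebra R (Module.Dual R (L ⧸ A)) →ₗ[R] N}
    (H : ∀ m, g (symProd A m) = h (symProd A m)) : g = h :=
  LinearMap.ext_on span_symProd (by rintro _ ⟨m, rfl⟩; exact H m)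

theorem polyFun_induction {motive : PolyFun A → Prop} (t : PolyFun A) (zero : motive 0)
    (tmul : ∀ θ m, motive (polyTmul A θ (symProd A m)))
    (add : ∀ s t, motive s → motive t → motive (s + t)) : motive t := by
  have key : ∀ t : ExteriorAlgebra R (Module.Dual R L) ⊗[R]
      SymmetricAlgebra R (Module.Dual R (L ⧸ A)), motive (PolyFun.equiv A t) := by
    intro t
    induction t with
    | zero => simpa using zero
    | add s t hs ht => rw [map_add]; exact add _ _ hs ht
    | tmul θ f =>
      have hf : f ∈ Submodule.span R (Set.range (symProd A)) := by
        rw [span_symProd]; trivial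
      induction hf using Submodule.span_induction generalizing θ with
      | mem x hx => obtain ⟨m, rfl⟩ := hx; exact tmul θ m
      | zero => simpa using zero
      | add x y _ _ hx hy => rw [TensorProduct.tmul_add, map_add]; exact add _ _ (hx θ) (hy θ)
      | smul r x _ hx => rw [← TensorProduct.smul_tmul]; exact hx (r • θ)
  exact key ((PolyFun.equiv A).symm t)

theorem mem_adicIdeal {n : ℕ} {F : FedosovFun A} :
    F ∈ adicIdeal A (n : ℤ) ↔ ∀ i < n, symCoeff A i F = 0 := by
  refine forall_congr' fun i => ?_
  rw [Nat.cast_lt]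

theorem adicIdeal_anti {a b : ℕ} (h : a ≤ b) :
    adicIdeal A (b : ℤ) ≤ adicIdeal A (a : ℤ) := fun _ hF =>
  mem_adicIdeal.2 fun i hi => mem_adicIdeal.1 hF i (hi.trans_le h)

theorem mem_adicIdeal_zero (F : FedosovFun A) : F ∈ adicIdeal A ((0 : ℕ) : ℤ) :=
  mem_adicIdeal.2 fun i hi => absurd hi (Nat.not_lt_zero i)

theorem eq_zero_of_forall_mem {F : FedosovFun A} (h : ∀ n : ℕ, F ∈ adicIdeal A (n : ℤ)) : F = 0 :=
  ext_symCoeff fun k => by rw [map_zero]; exact mem_adicIdeal.1 (h (k + 1)) k k.lt_succ_self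

theorem mul_mem_adicIdeal {a b : ℕ} {F G : FedosovFun A} (hF : F ∈ adicIdeal A (a : ℤ))
    (hG : G ∈ adicIdeal A (b : ℤ)) : F * G ∈ adicIdeal A ((a + b : ℕ) : ℤ) := by
  refine mem_adicIdeal.2 fun i hi => ?_
  rw [symCoeff_mul]
  refine Finset.sum_eq_zero fun x hx => ?_
  have hx' := Finset.HasAntidiagonal.mem_antidiagonal.1 hx
  rcases lt_or_ge x.1 a with h | h
  · rw [mem_adicIdeal.1 hF _ h, zero_mul]
  · rw [mem_adicIdeal.1 hG x.2 (by omega), mul_zero]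

theorem mul_mem_adicIdeal_left {a : ℕ} {F : FedosovFun A} (G : FedosovFun A)
    (hF : F ∈ adicIdeal A (a : ℤ)) : F * G ∈ adicIdeal A (a : ℤ) :=
  mul_mem_adicIdeal (b := 0) hF (mem_adicIdeal_zero G)

theorem mul_mem_adicIdeal_right {a : ℕ} {F : FedosovFun A} (G : FedosovFun A)
    (hF : F ∈ adicIdeal A (a : ℤ)) : G * F ∈ adicIdeal A (a : ℤ) := by
  have := mul_mem_adicIdeal (a := 0) (mem_adicIdeal_zero G) hF
  rwa [zero_add] at this

theorem fedMono_mem_adicIdeal (θ : ExteriorAlgebra R (Module.Dual R L))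
    (m : Multiset (Module.Dual R (L ⧸ A))) : fedMono A θ m ∈ adicIdeal A (m.card : ℤ) :=
  mem_adicIdeal.2 fun i hi => by rw [symCoeff_fedMono, if_neg hi.ne]

/-- The adic ideals as subspaces over the ground field. -/
def adicSpace (𝕜 : Type*) [Field 𝕜] [Algebra 𝕜 R] (A : Submodule R L) (k : ℕ) :
    Submodule 𝕜 (FedosovFun A) :=
  (adicIdeal A (k : ℤ)).restrictScalars 𝕜

theorem smul_mem_adicIdeal (c : 𝕜) {n : ℤ} {F : FedosovFun A} (hF : F ∈ adicIdeal A n) :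
    c • F ∈ adicIdeal A n :=
  Submodule.smul_of_tower_mem _ c hF

theorem polyTmul_one_commute (f : SymmetricAlgebra R (Module.Dual R (L ⧸ A))) (t : PolyFun A) :
    polyTmul A 1 f * t = t * polyTmul A 1 f := by
  induction t using polyFun_induction with
  | zero => simp
  | tmul θ m' => rw [polyTmul_mul, polyTmul_mul, one_mul, mul_one, mul_comm]
  | add s t hs ht => rw [mul_add, add_mul, hs, ht]

theorem fedMono_one_commute (m : Multiset (Module.Dual R (L ⧸ A))) (F : FedosovFun A) :
    fedMono A 1 m * F = F * fedMono A 1 m := by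
  refine ext_symCoeff fun k => ?_
  rw [symCoeff_mul, symCoeff_mul, ← Finset.Nat.sum_antidiagonal_swap]
  refine Finset.sum_congr rfl fun x _ => ?_
  simp only [Prod.fst_swap, Prod.snd_swap, symCoeff_fedMono]
  split_ifs
  · exact polyTmul_one_commute _ _
  · simp

/-! ### Density of polynomial functions -/

/-- Functions in `𝓘^k` are polynomial functions of order at least `k`, up to `𝓘^n`. -/
theorem exists_polynomial_approx {k : ℕ} {F : FedosovFun A} (hF : F ∈ adicIdeal A (k : ℤ))
    (n : ℕ) :
    ∃ G ∈ AddSubgroup.closure {G | ∃ θ m, k ≤ m.card ∧ G = fedMono A θ m},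
      F - G ∈ adicIdeal A (n : ℤ) := by
  set S := AddSubgroup.closure {G | ∃ θ m, k ≤ m.card ∧ G = fedMono A θ m} with hS
  induction n with
  | zero => exact ⟨0, zero_mem _, mem_adicIdeal_zero _⟩
  | succ n ih =>
    obtain ⟨G, hG, hFG⟩ := ih
    have hGk : G ∈ adicIdeal A (k : ℤ) := by
      have : S ≤ (adicIdeal A (k : ℤ)).toAddSubgroup := by
        rw [hS, AddSubgroup.closure_le]
        rintro _ ⟨θ, m, hm, rfl⟩
        exact adicIdeal_anti hm (fedMono_mem_adicIdeal θ m)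
      exact this hG
    -- homogeneous elements of order `n` come from finite sums of monomials
    have hom : ∀ t ∈ symPart A n, ∃ H ∈ AddSubgroup.closure
        {G | ∃ θ m, n = m.card ∧ G = fedMono A θ m},
        ∀ i, symCoeff A i H = if i = n then t else 0 := by
      intro t ht
      induction ht using Submodule.span_induction with
      | mem x hx =>
        obtain ⟨θ, m, rfl, rfl⟩ := hx
        exact ⟨_, AddSubgroup.subset_closure ⟨θ, m, rfl, rfl⟩, fun i => symCoeff_fedMono i θ m⟩
      | zero => exact ⟨0, zero_mem _, fun i => by simp⟩
      | add x y _ _ hx hy =>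
        obtain ⟨H, hH, h⟩ := hx
        obtain ⟨H', hH', h'⟩ := hy
        refine ⟨H + H', add_mem hH hH', fun i => ?_⟩
        rw [map_add, h, h']; split_ifs <;> simp
      | smul r x _ hx =>
        obtain ⟨H, hH, h⟩ := hx
        refine ⟨r • H, ?_, fun i => by rw [map_smul, h]; split_ifs <;> simp⟩
        clear h
        induction hH using AddSubgroup.closure_induction with
        | mem H hH =>
          obtain ⟨θ, m, hm, rfl⟩ := hH
          exact AddSubgroup.subset_closure ⟨r • θ, m, hm, (fedMono_smul r θ m).symm⟩
        | zero => rw [smul_zero]; exact zero_mem _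
        | add x y _ _ hx hy => rw [smul_add]; exact add_mem hx hy
        | neg x _ hx => rw [smul_neg]; exact neg_mem hx
    rcases lt_or_ge n k with hnk | hnk
    · exact ⟨0, zero_mem _, by rw [sub_zero]; exact adicIdeal_anti hnk hF⟩
    · obtain ⟨H, hH, h⟩ := hom _ (symCoeff_mem A n (F - G))
      refine ⟨G + H, add_mem hG (AddSubgroup.closure_mono ?_ hH), mem_adicIdeal.2 fun i hi => ?_⟩
      · rintro _ ⟨θ, m, hm, rfl⟩
        exact ⟨θ, m, hm ▸ hnk, rfl⟩
      · rw [← sub_sub, map_sub, h]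
        split_ifs with hin
        · rw [hin, sub_self]
        · rw [mem_adicIdeal.1 hFG i (by omega), sub_zero]

/-- Values of a continuous operator on `𝓘^k` are controlled by the values on monomials. -/
theorem IsAdicContinuous.mem_of_mono {ψ : FedosovOp 𝕜 A} (hψ : IsAdicContinuous ψ)
    {k n : ℕ} (h : ∀ θ m, k ≤ m.card → ψ (fedMono A θ m) ∈ adicIdeal A (n : ℤ))
    {F : FedosovFun A} (hF : F ∈ adicIdeal A (k : ℤ)) : ψ F ∈ adicIdeal A (n : ℤ) := by
  obtain ⟨p, hp⟩ := hψ n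
  obtain ⟨G, hG, hFG⟩ := exists_polynomial_approx hF p
  have h1 : ψ G ∈ adicIdeal A (n : ℤ) := by
    clear hFG
    induction hG using AddSubgroup.closure_induction with
    | mem x hx => obtain ⟨θ, m, hm, rfl⟩ := hx; exact h θ m hm
    | zero => rw [map_zero]; exact zero_mem _
    | add x y _ _ hx hy => rw [map_add]; exact add_mem hx hy
    | neg x _ hx => rw [map_neg]; exact neg_mem hx
  have h2 := add_mem (hp _ hFG) h1
  rwa [← map_add, sub_add_cancel] at h2

/-! ### Operators raising the filtration; vertical operators -/

variable (𝕜 A) in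
/-- The operators that map `𝓘^k` into `𝓘^{k + N}` for all `k`. -/
def raising (N : ℕ) : Submodule 𝕜 (FedosovOp 𝕜 A) where
  carrier := {ψ | ∀ k : ℕ, ∀ F ∈ adicIdeal A (k : ℤ), ψ F ∈ adicIdeal A ((k + N : ℕ) : ℤ)}
  add_mem' hψ hχ k F hF := add_mem (hψ k F hF) (hχ k F hF)
  zero_mem' _ _ _ := zero_mem _
  smul_mem' c _ hψ k F hF := smul_mem_adicIdeal c (hψ k F hF)

theorem raising_apply {N : ℕ} {ψ : FedosovOp 𝕜 A} (hψ : ψ ∈ raising 𝕜 A N) {k : ℕ}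
    {F : FedosovFun A} (hF : F ∈ adicIdeal A (k : ℤ)) : ψ F ∈ adicIdeal A ((k + N : ℕ) : ℤ) :=
  hψ k F hF

theorem raising_apply_mem {N : ℕ} {ψ : FedosovOp 𝕜 A} (hψ : ψ ∈ raising 𝕜 A N)
    (F : FedosovFun A) : ψ F ∈ adicIdeal A (N : ℤ) :=
  adicIdeal_anti (by omega) (hψ 0 F (mem_adicIdeal_zero F))

theorem raising_anti {a b : ℕ} (h : a ≤ b) : raising 𝕜 A b ≤ raising 𝕜 A a :=
  fun _ hψ k F hF => adicIdeal_anti (by omega) (hψ k F hF)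

theorem mul_mem_raising {a b : ℕ} {ψ χ : FedosovOp 𝕜 A} (hψ : ψ ∈ raising 𝕜 A a)
    (hχ : χ ∈ raising 𝕜 A b) : ψ * χ ∈ raising 𝕜 A (a + b) := fun k F hF =>
  adicIdeal_anti (by omega) (hψ _ _ (hχ k F hF))

theorem one_mem_raising : (1 : FedosovOp 𝕜 A) ∈ raising 𝕜 A 0 := fun _ _ hF => hF

theorem pow_mem_raising {ψ : FedosovOp 𝕜 A} (hψ : ψ ∈ raising 𝕜 A 1) (n : ℕ) :
    ψ ^ n ∈ raising 𝕜 A n := by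
  induction n with
  | zero => exact one_mem_raising
  | succ n ih => rw [pow_succ]; exact mul_mem_raising ih hψ

theorem eq_zero_of_forall_raising {ψ : FedosovOp 𝕜 A} (h : ∀ n, ψ ∈ raising 𝕜 A n) : ψ = 0 :=
  LinearMap.ext fun F => eq_zero_of_forall_mem fun n => raising_apply_mem (h n) F

theorem isAdicContinuous_of_raising {N : ℕ} {ψ : FedosovOp 𝕜 A} (hψ : ψ ∈ raising 𝕜 A N) :
    IsAdicContinuous ψ := fun k => ⟨k, fun F hF => adicIdeal_anti (by omega) (hψ k F hF)⟩

theorem shiftsBy_of_raising {N : ℕ} {ψ : FedosovOp 𝕜 A} (hψ : ψ ∈ raising 𝕜 A N) :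
    ShiftsBy N ψ := fun k F hF => by
  have := hψ k F (mem_adicIdeal.2 fun i hi => hF i hi.ne)
  rwa [Nat.cast_add] at this

theorem isVerticalOp_add {ψ χ : FedosovOp 𝕜 A} (hψ : IsVerticalOp ψ) (hχ : IsVerticalOp χ) :
    IsVerticalOp (ψ + χ) where
  continuous k := by
    obtain ⟨m, hm⟩ := hψ.continuous k
    obtain ⟨n, hn⟩ := hχ.continuous k
    exact ⟨max m n, fun F hF => add_mem (hm _ (adicIdeal_anti (le_max_left _ _) hF))
      (hn _ (adicIdeal_anti (le_max_right _ _) hF))⟩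
  map_mul_form F θ := by
    rw [LinearMap.add_apply, hχ.map_mul_form, hψ.map_mul_form, LinearMap.add_apply, add_mul]

theorem isVerticalOp_smul (c : 𝕜) {ψ : FedosovOp 𝕜 A} (hψ : IsVerticalOp ψ) :
    IsVerticalOp (c • ψ) where
  continuous k := by
    obtain ⟨m, hm⟩ := hψ.continuous k
    exact ⟨m, fun F hF => smul_mem_adicIdeal c (hm F hF)⟩
  map_mul_form F θ := by
    rw [LinearMap.smul_apply, hψ.map_mul_form, LinearMap.smul_apply, smul_mul_assoc]

theorem isVerticalOp_sub {ψ χ : FedosovOp 𝕜 A} (hψ : IsVerticalOp ψ) (hχ : IsVerticalOp χ) :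
    IsVerticalOp (ψ - χ) := by
  have h := isVerticalOp_add hψ (isVerticalOp_smul (-1) hχ)
  rwa [neg_smul, one_smul, ← sub_eq_add_neg] at h

theorem isVerticalOp_mul {ψ χ : FedosovOp 𝕜 A} (hψ : IsVerticalOp ψ) (hχ : IsVerticalOp χ) :
    IsVerticalOp (ψ * χ) where
  continuous k := by
    obtain ⟨m, hm⟩ := hψ.continuous k
    obtain ⟨n, hn⟩ := hχ.continuous m
    exact ⟨n, fun F hF => hm _ (hn F hF)⟩
  map_mul_form F θ := by
    change ψ (χ _) = ψ (χ F) * _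
    rw [hχ.map_mul_form, hψ.map_mul_form]

theorem isVerticalOp_one : IsVerticalOp (1 : FedosovOp 𝕜 A) where
  continuous k := ⟨k, fun _ hF => hF⟩
  map_mul_form _ _ := rfl

theorem isVerticalOp_pow {ψ : FedosovOp 𝕜 A} (hψ : IsVerticalOp ψ) (n : ℕ) :
    IsVerticalOp (ψ ^ n) := by
  induction n with
  | zero => exact isVerticalOp_one
  | succ n ih => rw [pow_succ]; exact isVerticalOp_mul ih hψ

theorem vertical_apply_fedMono {ψ : FedosovOp 𝕜 A} (hψ : IsVerticalOp ψ)
    (θ : ExteriorAlgebra R (Module.Dual R L)) (m : Multiset (Module.Dual R (L ⧸ A))) :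
    ψ (fedMono A θ m) = ψ (fedMono A 1 m) * fedMono A θ 0 := by
  rw [fedMono_eq_mul, hψ.map_mul_form]

theorem vertical_smul {ψ : FedosovOp 𝕜 A} (hψ : IsVerticalOp ψ) (r : R) (F : FedosovFun A) :
    ψ (r • F) = r • ψ F := by
  rw [← mul_fedMono_algebraMap, hψ.map_mul_form, mul_fedMono_algebraMap]

/-- For a vertical operator, raising the filtration can be tested on products of elements of
`Γ(B^∨)`. -/
theorem raising_of_fedMono {ψ : FedosovOp 𝕜 A} (hψ : IsVerticalOp ψ) {N : ℕ}
    (h : ∀ m, ψ (fedMono A 1 m) ∈ adicIdeal A ((m.card + N : ℕ) : ℤ)) : ψ ∈ raising 𝕜 A N :=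
  fun k F hF => IsAdicContinuous.mem_of_mono hψ.continuous (fun θ m hm => by
    rw [vertical_apply_fedMono hψ]
    exact mul_mem_adicIdeal_left _ (adicIdeal_anti (by omega) (h m))) hF

theorem vertical_eq_zero {ψ : FedosovOp 𝕜 A} (hψ : IsVerticalOp ψ)
    (h : ∀ m, ψ (fedMono A 1 m) = 0) : ψ = 0 :=
  eq_zero_of_forall_raising fun n => raising_of_fedMono hψ fun m => by rw [h m]; exact zero_mem _

/-- A vertical operator is determined by its restriction to `Γ(S B^∨)`. -/
theorem vertical_ext {ψ χ : FedosovOp 𝕜 A} (hψ : IsVerticalOp ψ) (hχ : IsVerticalOp χ)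
    (h : ∀ m, ψ (fedMono A 1 m) = χ (fedMono A 1 m)) : ψ = χ := by
  exact sub_eq_zero.1 (vertical_eq_zero (isVerticalOp_sub hψ hχ) fun m => by
    rw [LinearMap.sub_apply, h, sub_self])

/-! ### Infinite sums of operators -/

/-- The sum `∑_n a_n` of operators such that `a_n` takes its values in `𝓘^n`. -/
def adicSum (a : ℕ → FedosovOp 𝕜 A) : FedosovOp 𝕜 A where
  toFun F := ofComponents (fun i => ∑ n ∈ Finset.range (i + 1), symCoeff A i (a n F))
    fun i => Submodule.sum_mem _ fun _ _ => symCoeff_mem A i _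
  map_add' F G := ext_symCoeff fun i => by
    rw [map_add, symCoeff_ofComponents, symCoeff_ofComponents,
      symCoeff_ofComponents, ← Finset.sum_add_distrib]
    simp only [map_add]
  map_smul' c F := ext_symCoeff fun i => by
    rw [RingHom.id_apply, symCoeff_smul, symCoeff_ofComponents,
      symCoeff_ofComponents, Finset.smul_sum]
    simp only [map_smul, symCoeff_smul]

theorem symCoeff_adicSum (a : ℕ → FedosovOp 𝕜 A) (i : ℕ) (F : FedosovFun A) :
    symCoeff A i (adicSum a F) = ∑ n ∈ Finset.range (i + 1), symCoeff A i (a n F) :=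
  symCoeff_ofComponents i (fun i => ∑ n ∈ Finset.range (i + 1), symCoeff A i (a n F))
    fun i => Submodule.sum_mem _ fun _ _ => symCoeff_mem A i _

theorem adicSum_sub_mem {a : ℕ → FedosovOp 𝕜 A} (ha : ∀ (n : ℕ) F, a n F ∈ adicIdeal A (n : ℤ))
    (N : ℕ) (F : FedosovFun A) :
    adicSum a F - ∑ n ∈ Finset.range N, a n F ∈ adicIdeal A (N : ℤ) := by
  refine mem_adicIdeal.2 fun i hi => ?_
  rw [map_sub, symCoeff_adicSum, map_sum, sub_eq_zero]
  refine Finset.sum_subset (Finset.range_subset_range.2 hi) fun n _ hn => ?_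
  rw [Finset.mem_range, not_lt] at hn
  exact mem_adicIdeal.1 (ha n F) i (by omega)

theorem adicSum_sub_mem_raising {a : ℕ → FedosovOp 𝕜 A} (ha : ∀ n, a n ∈ raising 𝕜 A n) (N : ℕ) :
    adicSum a - ∑ n ∈ Finset.range N, a n ∈ raising 𝕜 A N := by
  intro k F hF
  have h1 := adicSum_sub_mem (fun n F => raising_apply_mem (ha n) F) (k + N) F
  have h2 : ∑ n ∈ Finset.Ico N (k + N), a n F ∈ adicIdeal A ((k + N : ℕ) : ℤ) :=
    Submodule.sum_mem _ fun n hn => adicIdeal_anti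
      (Nat.add_le_add_left (Finset.mem_Ico.1 hn).1 k) (ha n k F hF)
  have h3 := add_mem h1 h2
  rw [← Finset.sum_range_add_sum_Ico _ (show N ≤ k + N by omega)] at h3
  rw [LinearMap.sub_apply, LinearMap.sum_apply]
  convert h3 using 1
  abel

theorem adicSum_mem_raising {a : ℕ → FedosovOp 𝕜 A} (ha : ∀ (n : ℕ) F, a n F ∈ adicIdeal A (n : ℤ))
    {N : ℕ} (h : ∀ n, a n ∈ raising 𝕜 A N) : adicSum a ∈ raising 𝕜 A N := by
  intro k F hF
  have h1 := adicSum_sub_mem ha (k + N) F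
  have h2 := add_mem h1 (Submodule.sum_mem _ fun n (_ : n ∈ Finset.range (k + N)) => h n k F hF)
  rwa [sub_add_cancel] at h2

theorem adicSum_map_mul_form {a : ℕ → FedosovOp 𝕜 A} (ha : ∀ (n : ℕ) F, a n F ∈ adicIdeal A (n : ℤ))
    (h : ∀ n F θ, a n (F * fedMono A θ 0) = a n F * fedMono A θ 0) (F : FedosovFun A)
    (θ : ExteriorAlgebra R (Module.Dual R L)) :
    adicSum a (F * fedMono A θ 0) = adicSum a F * fedMono A θ 0 := by
  refine sub_eq_zero.1 (eq_zero_of_forall_mem fun N => ?_)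
  have h1 := adicSum_sub_mem ha N (F * fedMono A θ 0)
  have h2 := mul_mem_adicIdeal_left (fedMono A θ 0) (adicSum_sub_mem ha N F)
  have h3 := sub_mem h1 h2
  simp only [h, sub_mul, Finset.sum_mul] at h3
  simpa using h3

/-! ### Parity and functions of degree zero -/

theorem symCoeff_parity (k : ℕ) (F : FedosovFun A) :
    symCoeff A k (parity A F) = parityPoly A (symCoeff A k F) :=
  PowerSeries.coeff_mk k fun k => parityPoly A (symCoeff A k F)

theorem parityPoly_tmul (θ : ExteriorAlgebra R (Module.Dual R L))
    (f : SymmetricAlgebra R (Module.Dual R (L ⧸ A))) :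
    parityPoly A (polyTmul A θ f) = polyTmul A (CliffordAlgebra.involute
      (Q := (0 : QuadraticForm R (Module.Dual R L))) θ) f :=
  PolyFun.mapForm_tmul A _ θ f

theorem parityPoly_mul (s t : PolyFun A) :
    parityPoly A (s * t) = parityPoly A s * parityPoly A t := by
  induction s using polyFun_induction with
  | zero => simp
  | add s s' hs hs' => rw [add_mul, map_add, hs, hs', map_add, add_mul]
  | tmul θ m =>
    induction t using polyFun_induction with
    | zero => simp
    | add s s' hs hs' => rw [mul_add, map_add, hs, hs', map_add, mul_add]
    | tmul θ' m' =>
      rw [polyTmul_mul, parityPoly_tmul, parityPoly_tmul, parityPoly_tmul, polyTmul_mul]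
      exact congrArg (fun x => polyTmul A x _) (map_mul CliffordAlgebra.involute θ θ')

theorem parityPoly_parityPoly (s : PolyFun A) : parityPoly A (parityPoly A s) = s := by
  induction s using polyFun_induction with
  | zero => simp
  | add s s' hs hs' => rw [map_add, map_add, hs, hs']
  | tmul θ m =>
    rw [parityPoly_tmul, parityPoly_tmul]
    exact congrArg (fun x => polyTmul A x _) (CliffordAlgebra.involute_involute θ)

theorem parity_mul (F G : FedosovFun A) : parity A (F * G) = parity A F * parity A G := by
  refine ext_symCoeff fun k => ?_
  simp only [symCoeff_parity, symCoeff_mul, map_sum, parityPoly_mul]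

theorem parity_parity (F : FedosovFun A) : parity A (parity A F) = F :=
  ext_symCoeff fun k => by rw [symCoeff_parity, symCoeff_parity, parityPoly_parityPoly]

theorem parity_mem_adicIdeal {k : ℕ} {F : FedosovFun A} (hF : F ∈ adicIdeal A (k : ℤ)) :
    parity A F ∈ adicIdeal A (k : ℤ) :=
  mem_adicIdeal.2 fun i hi => by rw [symCoeff_parity, mem_adicIdeal.1 hF i hi, map_zero]

theorem parity_fedMono_zero (θ : ExteriorAlgebra R (Module.Dual R L)) :
    ∃ θ', parity A (fedMono A θ 0) = fedMono A θ' 0 := by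
  refine ⟨CliffordAlgebra.involute (Q := (0 : QuadraticForm R (Module.Dual R L))) θ,
    ext_symCoeff fun k => ?_⟩
  rw [symCoeff_parity, symCoeff_fedMono, symCoeff_fedMono]
  split_ifs
  · exact parityPoly_tmul _ _
  · simp

/-- The projection of `Γ(Λ^• L^∨ ⊗ S B^∨)` onto `Γ(S B^∨)`. -/
def degreeZeroProj (A : Submodule R L) : PolyFun A →ₗ[R] PolyFun A :=
  PolyFun.mapForm A (Algebra.linearMap R _ ∘ₗ ExteriorAlgebra.algebraMapInv.toLinearMap)

theorem degreeZeroProj_tmul (θ : ExteriorAlgebra R (Module.Dual R L))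
    (f : SymmetricAlgebra R (Module.Dual R (L ⧸ A))) :
    degreeZeroProj A (polyTmul A θ f) =
      ExteriorAlgebra.algebraMapInv θ • polyTmul A 1 f := by
  rw [degreeZeroProj, PolyFun.mapForm_tmul]
  change PolyFun.equiv A (algebraMap R _ _ ⊗ₜ[R] f) = _ • PolyFun.equiv A (1 ⊗ₜ[R] f)
  rw [Algebra.algebraMap_eq_smul_one, ← map_smul, TensorProduct.smul_tmul']
  rfl

theorem mem_exteriorPower_zero {θ : ExteriorAlgebra R (Module.Dual R L)} :
    θ ∈ ⋀[R]^0 (Module.Dual R L) ↔ ∃ r, algebraMap R _ r = θ := by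
  change θ ∈ LinearMap.range (ExteriorAlgebra.ι R) ^ 0 ↔ _
  rw [pow_zero, Submodule.mem_one]

theorem degreeZeroProj_eq {t : PolyFun A} (ht : t ∈ formPart A 0) : degreeZeroProj A t = t := by
  induction ht using Submodule.span_induction with
  | zero => simp
  | add x y _ _ hx hy => rw [map_add, hx, hy]
  | smul r x _ hx => rw [map_smul, hx]
  | mem x hx =>
    obtain ⟨θ, hθ, f, rfl⟩ := hx
    obtain ⟨r, rfl⟩ := mem_exteriorPower_zero.1 hθ
    rw [degreeZeroProj, PolyFun.mapForm_tmul]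
    simp

/-- `Γ(S^k B^∨)` is spanned by the products `η₁ ⊙ ⋯ ⊙ η_k`. -/
theorem mem_span_of_degree_zero {k : ℕ} {t : PolyFun A} (ht : t ∈ formPart A 0)
    (htk : t ∈ symPart A k) :
    t ∈ Submodule.span R {s | ∃ m : Multiset (Module.Dual R (L ⧸ A)), m.card = k ∧
      s = polyTmul A 1 (symProd A m)} := by
  rw [← degreeZeroProj_eq ht]
  refine map_symPart_mem _ _ (fun θ m hm => ?_) htk
  rw [degreeZeroProj_tmul]
  exact Submodule.smul_mem _ _ (Submodule.subset_span ⟨m, hm, rfl⟩)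

/-- Functions of form degree zero are combinations of elements of `Γ(S B^∨)`. -/
theorem formPart_zero_induction {motive : PolyFun A → Prop} {t : PolyFun A}
    (ht : t ∈ formPart A 0) (zero : motive 0) (tmul : ∀ f, motive (polyTmul A 1 f))
    (add : ∀ s t, motive s → motive t → motive (s + t))
    (smul : ∀ (r : R) s, motive s → motive (r • s)) : motive t := by
  induction ht using Submodule.span_induction with
  | zero => exact zero
  | add x y _ _ hx hy => exact add _ _ hx hy
  | smul r x _ hx => exact smul _ _ hx
  | mem x hx =>
    obtain ⟨θ, hθ, f, rfl⟩ := hx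
    obtain ⟨r, rfl⟩ := mem_exteriorPower_zero.1 hθ
    rw [Algebra.algebraMap_eq_smul_one, polyTmul, ← TensorProduct.smul_tmul', map_smul]
    exact smul _ _ (tmul f)

theorem degreeZero_commute {F : FedosovFun A} (hF : F ∈ degreePart A 0) (G : FedosovFun A) :
    F * G = G * F := by
  have key : ∀ s ∈ formPart A 0, ∀ t : PolyFun A, s * t = t * s := by
    intro s hs t
    refine formPart_zero_induction (motive := fun s => s * t = t * s) hs (by simp)
      (fun f => polyTmul_one_commute f t) (fun s s' h h' => ?_) fun r s h => ?_
    · rw [add_mul, mul_add, h, h']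
    · rw [smul_mul_assoc, mul_smul_comm, h]
  refine ext_symCoeff fun k => ?_
  rw [symCoeff_mul, symCoeff_mul, ← Finset.Nat.sum_antidiagonal_swap]
  exact Finset.sum_congr rfl fun x _ => key _ (hF _) _

theorem parity_degreeZero {F : FedosovFun A} (hF : F ∈ degreePart A 0) : parity A F = F := by
  refine ext_symCoeff fun k => ?_
  rw [symCoeff_parity]
  refine formPart_zero_induction (motive := fun t => parityPoly A t = t) (hF k) (map_zero _)
    (fun f => ?_) (fun s t hs ht => ?_) fun r s h => ?_
  · rw [parityPoly_tmul]
    exact congrArg (fun x => polyTmul A x _) (map_one CliffordAlgebra.involute)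
  · rw [map_add, hs, ht]
  · rw [map_smul, h]

theorem mul_mem_degreePart_zero {F G : FedosovFun A} (hF : F ∈ degreePart A 0)
    (hG : G ∈ degreePart A 0) : F * G ∈ degreePart A 0 := by
  have key : ∀ s ∈ formPart A 0, ∀ t ∈ formPart A 0, s * t ∈ formPart A 0 := by
    intro s hs t ht
    have h : formPart A 0 * formPart A 0 ≤ formPart A 0 := by
      unfold formPart
      rw [Submodule.span_mul_span]
      refine Submodule.span_mono ?_
      rintro _ ⟨_, ⟨θ, hθ, f, rfl⟩, _, ⟨θ', hθ', f', rfl⟩, rfl⟩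
      obtain ⟨r, rfl⟩ := mem_exteriorPower_zero.1 hθ
      obtain ⟨r', rfl⟩ := mem_exteriorPower_zero.1 hθ'
      exact ⟨_, mem_exteriorPower_zero.2 ⟨r * r', map_mul _ r r'⟩, f * f', polyTmul_mul A _ _ _ _⟩
    exact h (Submodule.mul_mem_mul hs ht)
  intro k
  rw [symCoeff_mul]
  exact Submodule.sum_mem _ fun x _ => key _ (hF _) _ (hG _)

theorem fedMono_one_mem_degreePart (m : Multiset (Module.Dual R (L ⧸ A))) :
    fedMono A 1 m ∈ degreePart A 0 := by
  intro k
  rw [symCoeff_fedMono]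
  split_ifs
  · exact Submodule.subset_span ⟨1, mem_exteriorPower_zero.2 ⟨1, map_one _⟩, _, rfl⟩
  · exact zero_mem _

/-! ### Symbols -/

/-- The coproduct `η ↦ η ⊗ 1 + 1 ⊗ η` of `Γ(S B^∨)`. -/
def symComul (A : Submodule R L) : SymmetricAlgebra R (Module.Dual R (L ⧸ A)) →ₐ[R]
    SymmetricAlgebra R (Module.Dual R (L ⧸ A)) ⊗[R] SymmetricAlgebra R (Module.Dual R (L ⧸ A)) :=
  SymmetricAlgebra.lift
    (Algebra.TensorProduct.includeLeft.toLinearMap ∘ₗ SymmetricAlgebra.ι R _ +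
      Algebra.TensorProduct.includeRight.toLinearMap ∘ₗ SymmetricAlgebra.ι R _)

theorem symComul_symProd (m : Multiset (Module.Dual R (L ⧸ A))) :
    symComul A (symProd A m) =
      (m.antidiagonal.map fun I => symProd A I.1 ⊗ₜ[R] symProd A I.2).sum := by
  induction m using Multiset.induction with
  | empty => simp [symProd_zero, Algebra.TensorProduct.one_def]
  | cons η m ih =>
    rw [symProd_cons, map_mul, ih, Multiset.antidiagonal_cons, Multiset.map_add, Multiset.sum_add,
      Multiset.map_map, Multiset.map_map, ← Multiset.sum_map_mul_left, ← Multiset.sum_map_add]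
    refine congrArg Multiset.sum (Multiset.map_congr rfl fun I _ => ?_)
    simp [symComul, symProd_cons, add_mul, add_comm]

/-- The convolution product of maps from `Γ(S B^∨)` to `𝓡`. -/
def conv (g h : SymmetricAlgebra R (Module.Dual R (L ⧸ A)) →ₗ[R] FedosovFun A) :
    SymmetricAlgebra R (Module.Dual R (L ⧸ A)) →ₗ[R] FedosovFun A :=
  LinearMap.mul' R (FedosovFun A) ∘ₗ TensorProduct.map g h ∘ₗ (symComul A).toLinearMap

theorem conv_symProd (g h : SymmetricAlgebra R (Module.Dual R (L ⧸ A)) →ₗ[R] FedosovFun A)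
    (m : Multiset (Module.Dual R (L ⧸ A))) :
    conv g h (symProd A m) =
      (m.antidiagonal.map fun I => g (symProd A I.1) * h (symProd A I.2)).sum := by
  simp only [conv, LinearMap.comp_apply, AlgHom.toLinearMap_apply, symComul_symProd,
    map_multiset_sum, Multiset.map_map, Function.comp_def, TensorProduct.map_tmul,
    LinearMap.mul'_apply]

/-- The map `f ↦ s(η ⊙ f)`. -/
def shiftSymbol (η : Module.Dual R (L ⧸ A))
    (s : SymmetricAlgebra R (Module.Dual R (L ⧸ A)) →ₗ[R] FedosovFun A) :
    SymmetricAlgebra R (Module.Dual R (L ⧸ A)) →ₗ[R] FedosovFun A :=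
  s ∘ₗ LinearMap.mulLeft R (SymmetricAlgebra.ι R _ η)

theorem shiftSymbol_symProd (η : Module.Dual R (L ⧸ A))
    (s : SymmetricAlgebra R (Module.Dual R (L ⧸ A)) →ₗ[R] FedosovFun A)
    (m : Multiset (Module.Dual R (L ⧸ A))) :
    shiftSymbol η s (symProd A m) = s (symProd A (η ::ₘ m)) := by
  rw [symProd_cons]; rfl

/-- The inclusion of `Γ(S B^∨)` in `𝓡`, scaled by `c^k` on `Γ(S^k B^∨)`. -/
def symIncl (A : Submodule R L) (c : R) :
    SymmetricAlgebra R (Module.Dual R (L ⧸ A)) →ₐ[R] FedosovFun A :=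
  symLift (c • { toFun := fun η => fedMono A 1 {η}
                 map_add' := fun η η' => ext_symCoeff fun k => by
                   rw [map_add, symCoeff_fedMono, symCoeff_fedMono, symCoeff_fedMono]
                   simp only [Multiset.card_singleton, symProd, Multiset.map_singleton,
                     Multiset.prod_singleton, map_add, polyTmul, TensorProduct.tmul_add]
                   split_ifs <;> simp
                 map_smul' := fun r η => ext_symCoeff fun k => by
                   rw [RingHom.id_apply, map_smul, symCoeff_fedMono, symCoeff_fedMono]
                   simp only [Multiset.card_singleton, symProd, Multiset.map_singleton,
                     Multiset.prod_singleton, map_smul, polyTmul, TensorProduct.tmul_smul]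
                   split_ifs <;> simp })
    fun η η' => by
      simp only [LinearMap.smul_apply, LinearMap.coe_mk, AddHom.coe_mk, smul_mul_assoc,
        mul_smul_comm]
      rw [fedMono_one_commute]

theorem symIncl_symProd (c : R) (m : Multiset (Module.Dual R (L ⧸ A))) :
    symIncl A c (symProd A m) = c ^ m.card • fedMono A 1 m := by
  induction m using Multiset.induction with
  | empty => rw [symProd_zero, map_one, fedMono_one_zero]; simp
  | cons η m ih =>
    rw [symProd_cons, map_mul, ih, symIncl, symLift_ι, fedMono_one_cons]
    simp only [LinearMap.smul_apply, LinearMap.coe_mk, AddHom.coe_mk, smul_mul_assoc,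
        mul_smul_comm, smul_smul, Multiset.card_cons, pow_succ]

/-- The restriction to `Γ(S B^∨)` of the operator with symbol `s`. -/
def symbolMap (s : SymmetricAlgebra R (Module.Dual R (L ⧸ A)) →ₗ[R] FedosovFun A) :
    SymmetricAlgebra R (Module.Dual R (L ⧸ A)) →ₗ[R] FedosovFun A :=
  conv s (symIncl A 1).toLinearMap

theorem symbolMap_symProd (s : SymmetricAlgebra R (Module.Dual R (L ⧸ A)) →ₗ[R] FedosovFun A)
    (m : Multiset (Module.Dual R (L ⧸ A))) :
    symbolMap s (symProd A m) =
      (m.antidiagonal.map fun I => s (symProd A I.1) * fedMono A 1 I.2).sum := by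
  simp only [symbolMap, conv_symProd, AlgHom.toLinearMap_apply, symIncl_symProd, one_pow, one_smul]

theorem conv_symIncl_cons (c : R)
    (s : SymmetricAlgebra R (Module.Dual R (L ⧸ A)) →ₗ[R] FedosovFun A)
    (η : Module.Dual R (L ⧸ A)) (m : Multiset (Module.Dual R (L ⧸ A))) :
    conv s (symIncl A c).toLinearMap (symProd A (η ::ₘ m)) =
      c • (conv s (symIncl A c).toLinearMap (symProd A m) * fedMono A 1 {η}) +
        conv (shiftSymbol η s) (symIncl A c).toLinearMap (symProd A m) := by
  simp only [conv_symProd, AlgHom.toLinearMap_apply, symIncl_symProd, shiftSymbol_symProd]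
  rw [Multiset.antidiagonal_cons, Multiset.map_add, Multiset.sum_add,
    Multiset.map_map, Multiset.map_map, ← Multiset.sum_map_mul_right, Multiset.smul_sum,
    Multiset.map_map]
  congr 2
  · refine Multiset.map_congr rfl fun I _ => ?_
    simp only [Function.comp_apply, Prod.map_fst, Prod.map_snd, id_eq, Multiset.card_cons]
    rw [fedMono_one_cons, fedMono_one_commute {η}, mul_smul_comm, mul_smul_comm, smul_mul_assoc,
      smul_smul, pow_succ', mul_assoc]

/-- The inverse of `symbolMap`: the convolution with the antipode. -/
def symbolOf (g : SymmetricAlgebra R (Module.Dual R (L ⧸ A)) →ₗ[R] FedosovFun A) :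
    SymmetricAlgebra R (Module.Dual R (L ⧸ A)) →ₗ[R] FedosovFun A :=
  conv g (symIncl A (-1)).toLinearMap

theorem symbolMap_symbolOf (g : SymmetricAlgebra R (Module.Dual R (L ⧸ A)) →ₗ[R] FedosovFun A) :
    symbolMap (symbolOf g) = g := by
  refine linearMap_ext_symProd fun m => ?_
  induction m using Multiset.induction generalizing g with
  | empty =>
    have h : symbolOf g (symProd A 0) = g (symProd A 0) := by
      rw [symbolOf, conv_symProd]
      simp [symProd_zero]
    rw [symbolMap_symProd]
    simp [h, fedMono_one_zero]
  | cons η m ih =>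
    have h : shiftSymbol η (symbolOf g) =
        symbolOf (shiftSymbol η g) - LinearMap.mulRight R (fedMono A 1 {η}) ∘ₗ symbolOf g := by
      refine linearMap_ext_symProd fun m => ?_
      rw [shiftSymbol_symProd, symbolOf, conv_symIncl_cons]
      simp [symbolOf]
      abel
    have hsub : ∀ s t : SymmetricAlgebra R (Module.Dual R (L ⧸ A)) →ₗ[R] FedosovFun A,
        symbolMap (s - t) = symbolMap s - symbolMap t := fun s t =>
      linearMap_ext_symProd fun m => by
        simp [symbolMap_symProd, sub_mul, Multiset.sum_map_sub]
    have hmul : symbolMap (LinearMap.mulRight R (fedMono A 1 {η}) ∘ₗ symbolOf g) (symProd A m) =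
        symbolMap (symbolOf g) (symProd A m) * fedMono A 1 {η} := by
      rw [symbolMap_symProd, symbolMap_symProd, ← Multiset.sum_map_mul_right]
      refine congrArg Multiset.sum (Multiset.map_congr rfl fun I _ => ?_)
      rw [LinearMap.comp_apply, LinearMap.mulRight_apply, mul_assoc, mul_assoc,
        fedMono_one_commute {η}]
    rw [symbolMap, conv_symIncl_cons, ← symbolMap, ← symbolMap, h, hsub, LinearMap.sub_apply, hmul,
      ih, ih, shiftSymbol_symProd]
    simp

/-- By induction on the number of factors: the commutator with the multiplication by `η ∈ Γ(B^∨)`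
removes a factor, and replaces the symbol `s` by `f ↦ s(η ⊙ f)`. -/
theorem symbolMap_injective {s t : SymmetricAlgebra R (Module.Dual R (L ⧸ A)) →ₗ[R] FedosovFun A}
    (h : symbolMap s = symbolMap t) : s = t := by
  refine linearMap_ext_symProd fun m => ?_
  induction m using Multiset.induction generalizing s t with
  | empty =>
    have := LinearMap.congr_fun h (symProd A 0)
    simpa [symbolMap_symProd, fedMono_one_zero] using this
  | cons η m ih =>
    have h' : symbolMap (shiftSymbol η s) = symbolMap (shiftSymbol η t) :=
      linearMap_ext_symProd fun m => by
        have h1 := LinearMap.congr_fun h (symProd A (η ::ₘ m))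
        rw [symbolMap, symbolMap, conv_symIncl_cons, conv_symIncl_cons, ← symbolMap, ← symbolMap,
          ← symbolMap, ← symbolMap, h] at h1
        exact add_left_cancel h1
    rw [← shiftSymbol_symProd, ← shiftSymbol_symProd]
    exact ih h'

theorem symbolOf_mem {g : SymmetricAlgebra R (Module.Dual R (L ⧸ A)) →ₗ[R] FedosovFun A} {N : ℕ}
    (h : ∀ m, g (symProd A m) ∈ adicIdeal A ((m.card + N : ℕ) : ℤ))
    (m : Multiset (Module.Dual R (L ⧸ A))) :
    symbolOf g (symProd A m) ∈ adicIdeal A ((m.card + N : ℕ) : ℤ) := by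
  rw [symbolOf, conv_symProd]
  refine multiset_sum_mem _ fun x hx => ?_
  obtain ⟨I, hI, rfl⟩ := Multiset.mem_map.1 hx
  rw [Multiset.mem_antidiagonal] at hI
  rw [AlgHom.toLinearMap_apply, symIncl_symProd, mul_smul_comm]
  refine Submodule.smul_mem _ _ (adicIdeal_anti ?_
    (mul_mem_adicIdeal (h I.1) (fedMono_mem_adicIdeal 1 I.2)))
  rw [← hI, Multiset.card_add]; omega

theorem symbolMap_mem {s : SymmetricAlgebra R (Module.Dual R (L ⧸ A)) →ₗ[R] FedosovFun A} {N : ℕ}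
    (h : ∀ m, s (symProd A m) ∈ adicIdeal A ((m.card + N : ℕ) : ℤ))
    (m : Multiset (Module.Dual R (L ⧸ A))) :
    symbolMap s (symProd A m) ∈ adicIdeal A ((m.card + N : ℕ) : ℤ) := by
  rw [symbolMap_symProd]
  refine multiset_sum_mem _ fun x hx => ?_
  obtain ⟨I, hI, rfl⟩ := Multiset.mem_map.1 hx
  rw [Multiset.mem_antidiagonal] at hI
  refine adicIdeal_anti ?_ (mul_mem_adicIdeal (h I.1) (fedMono_mem_adicIdeal 1 I.2))
  rw [← hI, Multiset.card_add]; omega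

/-! ### The operator with a given symbol -/

/-- The inclusion of `Γ(Λ^• L^∨)` in `𝓡`. -/
def formIncl (A : Submodule R L) : ExteriorAlgebra R (Module.Dual R L) →ₗ[R] FedosovFun A where
  toFun θ := fedMono A θ 0
  map_add' θ θ' := fedMono_add θ θ' 0
  map_smul' r θ := fedMono_smul r θ 0

/-- The map `ω ⊗ f ↦ g(f) ω`. -/
def extendRight (g : SymmetricAlgebra R (Module.Dual R (L ⧸ A)) →ₗ[R] FedosovFun A) :
    PolyFun A →ₗ[R] FedosovFun A :=
  PolyFun.lift ((LinearMap.mul R (FedosovFun A)).flip.compl₁₂ (formIncl A) g)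

theorem extendRight_tmul (g : SymmetricAlgebra R (Module.Dual R (L ⧸ A)) →ₗ[R] FedosovFun A)
    (θ : ExteriorAlgebra R (Module.Dual R L)) (f : SymmetricAlgebra R (Module.Dual R (L ⧸ A))) :
    extendRight g (polyTmul A θ f) = g f * fedMono A θ 0 :=
  PolyFun.lift_tmul _ θ f

theorem extendRight_mul_polyForm
    (g : SymmetricAlgebra R (Module.Dual R (L ⧸ A)) →ₗ[R] FedosovFun A)
    (t : PolyFun A) (θ : ExteriorAlgebra R (Module.Dual R L)) :
    extendRight g (t * polyTmul A θ 1) = extendRight g t * fedMono A θ 0 := by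
  induction t using polyFun_induction with
  | zero => simp
  | add s t hs ht => rw [add_mul, map_add, hs, ht, map_add, add_mul]
  | tmul θ' m =>
    rw [polyTmul_mul, extendRight_tmul, extendRight_tmul, mul_one, mul_assoc, fedMono_mul, add_zero]

theorem symCoeff_mul_fedMono_zero (k : ℕ) (F : FedosovFun A)
    (θ : ExteriorAlgebra R (Module.Dual R L)) :
    symCoeff A k (F * fedMono A θ 0) = symCoeff A k F * polyTmul A θ 1 := by
  rw [symCoeff_mul, Finset.sum_eq_single (k, 0)]
  · rw [symCoeff_fedMono, if_pos (by rfl)]; rfl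
  · intro x hx hne
    rw [symCoeff_fedMono, if_neg, mul_zero]
    intro h0
    have hx' := Finset.HasAntidiagonal.mem_antidiagonal.1 hx
    rw [Multiset.card_zero] at h0
    exact hne (Prod.ext (by simpa [h0] using hx') h0)
  · intro h; exact absurd (Finset.HasAntidiagonal.mem_antidiagonal.2 (add_zero k)) h

theorem extendRight_mem {g : SymmetricAlgebra R (Module.Dual R (L ⧸ A)) →ₗ[R] FedosovFun A} {N : ℕ}
    (h : ∀ m, g (symProd A m) ∈ adicIdeal A ((m.card + N : ℕ) : ℤ)) {k : ℕ} {t : PolyFun A}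
    (ht : t ∈ symPart A k) : extendRight g t ∈ adicIdeal A ((k + N : ℕ) : ℤ) := by
  refine map_symPart_mem _ _ (fun θ m hm => ?_) ht
  subst hm
  rw [extendRight_tmul]
  exact mul_mem_adicIdeal_left _ (h m)

variable (𝕜) in
/-- The operator on `𝓡` whose restriction to `Γ(S B^∨)` is `g`. -/
def verticalExtension (g : SymmetricAlgebra R (Module.Dual R (L ⧸ A)) →ₗ[R] FedosovFun A) :
    FedosovOp 𝕜 A :=
  adicSum fun n => (extendRight g ∘ₗ symCoeff A n).restrictScalars 𝕜

/-- The shift hypothesis on `g` is what makes the sum over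
homogeneous components converge. -/
theorem verticalExtension_spec
    {g : SymmetricAlgebra R (Module.Dual R (L ⧸ A)) →ₗ[R] FedosovFun A} {N : ℕ}
    (h : ∀ m, g (symProd A m) ∈ adicIdeal A ((m.card + N : ℕ) : ℤ)) :
    IsVerticalOp (verticalExtension 𝕜 g) ∧ verticalExtension 𝕜 g ∈ raising 𝕜 A N ∧
      ∀ m, verticalExtension 𝕜 g (fedMono A 1 m) = g (symProd A m) := by
  have ha : ∀ (n : ℕ) F, (extendRight g ∘ₗ symCoeff A n).restrictScalars 𝕜 F ∈
      adicIdeal A (n : ℤ) := fun n F =>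
    adicIdeal_anti (by omega) (extendRight_mem h (symCoeff_mem A n F))
  have hr : verticalExtension 𝕜 g ∈ raising 𝕜 A N :=
    adicSum_mem_raising ha fun n k F hF => by
      rw [LinearMap.restrictScalars_apply, LinearMap.comp_apply]
      rcases lt_or_ge n k with hn | hn
      · rw [mem_adicIdeal.1 hF n hn, map_zero]; exact zero_mem _
      · exact adicIdeal_anti (by omega) (extendRight_mem h (symCoeff_mem A n F))
  refine ⟨⟨isAdicContinuous_of_raising hr, adicSum_map_mul_form ha fun n F θ => ?_⟩, hr,
    fun m => ?_⟩
  · rw [LinearMap.restrictScalars_apply, LinearMap.comp_apply, symCoeff_mul_fedMono_zero,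
      extendRight_mul_polyForm]
    rfl
  · refine sub_eq_zero.1 (eq_zero_of_forall_mem fun p => ?_)
    have h1 := adicSum_sub_mem ha (m.card + 1 + p) (fedMono A 1 m)
    rw [Finset.sum_eq_single m.card] at h1
    · rw [LinearMap.restrictScalars_apply, LinearMap.comp_apply, symCoeff_fedMono, if_pos rfl,
        extendRight_tmul, fedMono_one_zero, mul_one] at h1
      exact adicIdeal_anti (by omega) h1
    · intro n _ hn
      rw [LinearMap.restrictScalars_apply, LinearMap.comp_apply, symCoeff_fedMono, if_neg hn,
        map_zero]
    · intro hn
      exact absurd (Finset.mem_range.2 (by omega)) hn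

/-- For a vertical operator, the formula defining the symbol need only hold on `Γ(S B^∨)`, where it
says that the operator is the convolution of its symbol with the inclusion. -/
theorem hasSymbol_iff {ψ : FedosovOp 𝕜 A} (hψ : IsVerticalOp ψ)
    (s : SymmetricAlgebra R (Module.Dual R (L ⧸ A)) →ₗ[R] FedosovFun A) :
    HasSymbol ψ s ↔ ∀ m, ψ (fedMono A 1 m) = symbolMap s (symProd A m) := by
  constructor
  · intro h m
    rw [h 1 m, symbolMap_symProd]
  · intro h θ m
    rw [vertical_apply_fedMono hψ, h, symbolMap_symProd, ← Multiset.sum_map_mul_right]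
    refine congrArg Multiset.sum (Multiset.map_congr rfl fun I _ => ?_)
    rw [mul_assoc, ← fedMono_eq_mul]

/-- Every vertical operator has a symbol, which is the convolution of its restriction `g` to
`Γ(S B^∨)` with the antipode. -/
theorem exists_hasSymbol {ψ : FedosovOp 𝕜 A} (hψ : IsVerticalOp ψ) :
    ∃ g : SymmetricAlgebra R (Module.Dual R (L ⧸ A)) →ₗ[R] FedosovFun A,
      HasSymbol ψ (symbolOf g) ∧ ∀ m, g (symProd A m) = ψ (fedMono A 1 m) := by
  let ψR : FedosovFun A →ₗ[R] FedosovFun A :=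
    { toFun := ψ, map_add' := map_add ψ, map_smul' := vertical_smul hψ }
  have hg : ∀ m, (ψR ∘ₗ (symIncl A 1).toLinearMap) (symProd A m) = ψ (fedMono A 1 m) := fun m => by
    rw [LinearMap.comp_apply, AlgHom.toLinearMap_apply, symIncl_symProd, one_pow, one_smul]
    rfl
  refine ⟨ψR ∘ₗ (symIncl A 1).toLinearMap, (hasSymbol_iff hψ _).2 fun m => ?_, hg⟩
  rw [symbolMap_symbolOf, hg]

theorem hasSymbol_unique {ψ : FedosovOp 𝕜 A} (hψ : IsVerticalOp ψ)
    {s t : SymmetricAlgebra R (Module.Dual R (L ⧸ A)) →ₗ[R] FedosovFun A}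
    (hs : HasSymbol ψ s) (ht : HasSymbol ψ t) : s = t :=
  symbolMap_injective (linearMap_ext_symProd fun m => by
    rw [← (hasSymbol_iff hψ s).1 hs, (hasSymbol_iff hψ t).1 ht])

/-! ### The operator `h_♮` -/

theorem symCoeff_homotopy_zero (j : LieSplitting A) (F : FedosovFun A) :
    symCoeff A 0 (j.homotopy 𝕜 F) = 0 := by
  let f : ℕ → PolyFun A := fun k => match k with
    | 0 => 0
    | q + 1 => j.homotopyPoly 𝕜 q (symCoeff A q F)
  exact PowerSeries.coeff_mk 0 f

theorem symCoeff_homotopy_succ (j : LieSplitting A) (F : FedosovFun A) (q : ℕ) :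
    symCoeff A (q + 1) (j.homotopy 𝕜 F) = j.homotopyPoly 𝕜 q (symCoeff A q F) := by
  let f : ℕ → PolyFun A := fun k => match k with
    | 0 => 0
    | q + 1 => j.homotopyPoly 𝕜 q (symCoeff A q F)
  exact PowerSeries.coeff_mk (q + 1) f

theorem homotopy_mem (j : LieSplitting A) {k : ℕ} {F : FedosovFun A}
    (hF : F ∈ adicIdeal A (k : ℤ)) : j.homotopy 𝕜 F ∈ adicIdeal A ((k + 1 : ℕ) : ℤ) := by
  refine mem_adicIdeal.2 fun i hi => ?_
  cases i with
  | zero => exact symCoeff_homotopy_zero j F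
  | succ q => rw [symCoeff_homotopy_succ, mem_adicIdeal.1 hF q (by omega), map_zero]

theorem hNat_eq (j : LieSplitting A) {φ ψ : FedosovOp 𝕜 A} (hφ : IsShiftingOp φ)
    (hψ : IsShiftingOp ψ) {s : SymmetricAlgebra R (Module.Dual R (L ⧸ A)) →ₗ[R] FedosovFun A}
    (hs : HasSymbol φ s) (hs' : HasSymbol ψ (j.homotopy 𝕜 ∘ₗ s)) : j.hNat φ = ψ := by
  have h : ∃ ψ : FedosovOp 𝕜 A, IsShiftingOp φ ∧ IsShiftingOp ψ ∧
      ∃ s, HasSymbol φ s ∧ HasSymbol ψ (j.homotopy 𝕜 ∘ₗ s) := ⟨ψ, hφ, hψ, s, hs, hs'⟩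
  obtain ⟨-, h2, t, ht, ht'⟩ := h.choose_spec
  have hst := hasSymbol_unique hφ.1 hs ht
  subst hst
  rw [LieSplitting.hNat, dif_pos h]
  exact vertical_ext h2.1 hψ.1 fun m => by
    rw [(hasSymbol_iff h2.1 _).1 ht', (hasSymbol_iff hψ.1 _).1 hs']

theorem isShiftingOp_of_raising {φ : FedosovOp 𝕜 A} (hφ : IsVerticalOp φ) {N : ℕ}
    (h : φ ∈ raising 𝕜 A N) : IsShiftingOp φ := ⟨hφ, N, shiftsBy_of_raising h⟩

/-- `h` raises the filtration by one, and therefore so does `h_♮`. -/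
theorem hNat_spec (j : LieSplitting A) {φ : FedosovOp 𝕜 A} (hφ : IsVerticalOp φ) {N : ℕ}
    (h : φ ∈ raising 𝕜 A N) :
    IsVerticalOp (j.hNat φ) ∧ j.hNat φ ∈ raising 𝕜 A (N + 1) ∧
      ∃ s, HasSymbol φ s ∧ HasSymbol (j.hNat φ) (j.homotopy 𝕜 ∘ₗ s) := by
  obtain ⟨g, hg, hgm⟩ := exists_hasSymbol hφ
  have h1 := symbolOf_mem (g := g) (N := N) fun m => by
    rw [hgm]; exact raising_apply h (fedMono_mem_adicIdeal 1 m)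
  have h2 := symbolMap_mem (s := j.homotopy 𝕜 ∘ₗ symbolOf g) (N := N + 1) fun m =>
    homotopy_mem (𝕜 := 𝕜) j (h1 m)
  obtain ⟨h3, h4, h5⟩ := verticalExtension_spec (𝕜 := 𝕜) h2
  have hs := (hasSymbol_iff h3 _).2 h5
  rw [hNat_eq j (isShiftingOp_of_raising hφ h) (isShiftingOp_of_raising h3 h4) hg hs]
  exact ⟨h3, h4, _, hg, hs⟩

theorem hNat_add (j : LieSplitting A) {φ ψ : FedosovOp 𝕜 A} (hφ : IsVerticalOp φ)
    (hψ : IsVerticalOp ψ) (h : φ ∈ raising 𝕜 A 0) (h' : ψ ∈ raising 𝕜 A 0) :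
    j.hNat (φ + ψ) = j.hNat φ + j.hNat ψ := by
  obtain ⟨h1, h2, s, hs, hs'⟩ := hNat_spec j hφ h
  obtain ⟨h3, h4, t, ht, ht'⟩ := hNat_spec j hψ h'
  have hadd : ∀ {φ ψ : FedosovOp 𝕜 A} {s t}, HasSymbol φ s → HasSymbol ψ t →
      HasSymbol (φ + ψ) (s + t) := fun hs ht θ m => by
    rw [LinearMap.add_apply, hs, ht, ← Multiset.sum_map_add]
    simp only [LinearMap.add_apply, add_mul]
  refine hNat_eq j (isShiftingOp_of_raising (isVerticalOp_add hφ hψ) (add_mem h h'))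
    (isShiftingOp_of_raising (isVerticalOp_add h1 h3) (add_mem h2 h4))
    (hadd hs ht) ?_
  rw [LinearMap.comp_add]
  exact hadd hs' ht'

/-! ### The Koszul vector field -/

theorem symCoeff_koszul (k : ℕ) (F : FedosovFun A) :
    symCoeff A k (koszul A F) = koszulPoly A (symCoeff A (k + 1) F) :=
  PowerSeries.coeff_mk k fun k => koszulPoly A (symCoeff A (k + 1) F)

theorem polyForm_eq (θ : ExteriorAlgebra R (Module.Dual R L)) :
    polyForm A θ = polyTmul A θ 1 := rfl

theorem polySym_eq (f : SymmetricAlgebra R (Module.Dual R (L ⧸ A))) :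
    polySym A f = polyTmul A 1 f := rfl

theorem symCoeff_fedMono_mul (θ : ExteriorAlgebra R (Module.Dual R L))
    (m : Multiset (Module.Dual R (L ⧸ A))) (k : ℕ) (F : FedosovFun A) :
    symCoeff A (m.card + k) (fedMono A θ m * F) =
      polyTmul A θ (symProd A m) * symCoeff A k F := by
  rw [symCoeff_mul, Finset.sum_eq_single (m.card, k)]
  · rw [symCoeff_fedMono, if_pos rfl]
  · intro x hx hne
    rw [symCoeff_fedMono, if_neg, zero_mul]
    intro h0
    have hx' := Finset.HasAntidiagonal.mem_antidiagonal.1 hx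
    exact hne (Prod.ext h0 (by simpa [h0] using hx'))
  · intro h; exact absurd ((Finset.HasAntidiagonal.mem_antidiagonal (a := (m.card, k))).2 rfl) h

theorem symProd_singleton (η : Module.Dual R (L ⧸ A)) :
    symProd A {η} = SymmetricAlgebra.ι R _ η := by
  simp [symProd]

theorem koszulHom_cons (η : Module.Dual R (L ⧸ A)) (m : Multiset (Module.Dual R (L ⧸ A))) :
    koszulHom A (symProd A (η ::ₘ m)) 0 1 =
      polyTmul A 1 (SymmetricAlgebra.ι R _ η) * koszulHom A (symProd A m) 0 1 +
        polyTmul A (ExteriorAlgebra.ι R (A.mkQ.dualMap η)) (symProd A m) := by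
  rw [symProd_cons, map_mul, Matrix.mul_apply, Fin.sum_univ_two, (koszulHom_mem A m).2.1,
    koszulHom, symLift_ι]
  exact congrArg₂ (· + ·) rfl (polyForm_mul_polySym A _ _)

theorem koszulPoly_mul (η : Module.Dual R (L ⧸ A)) (t : PolyFun A) :
    koszulPoly A (polyTmul A 1 (SymmetricAlgebra.ι R _ η) * t) =
      polyTmul A (ExteriorAlgebra.ι R (A.mkQ.dualMap η)) 1 * t +
        polyTmul A 1 (SymmetricAlgebra.ι R _ η) * koszulPoly A t := by
  induction t using polyFun_induction with
  | zero => simp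
  | add s t hs ht => rw [mul_add, map_add, hs, ht, mul_add, map_add, mul_add]; abel
  | tmul θ m =>
    rw [polyTmul_mul, one_mul, ← symProd_cons, koszulPoly_tmul, koszulPoly_tmul, koszulHom_cons,
      add_mul, polyForm_eq, polyTmul_mul, polyTmul_mul, mul_one, one_mul, mul_assoc, add_comm]

theorem koszulPoly_symPart_zero {t : PolyFun A} (ht : t ∈ symPart A 0) : koszulPoly A t = 0 := by
  refine (Submodule.mem_bot R).1 (map_symPart_mem _ ⊥ (fun θ m hm => ?_) ht)
  rw [koszulPoly_tmul, (koszulHom_mem A m).2.2.2 hm, zero_mul]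
  exact zero_mem _

theorem koszul_generator_mul (η : Module.Dual R (L ⧸ A)) (F : FedosovFun A) :
    koszul A (fedMono A 1 {η} * F) =
      fedMono A (ExteriorAlgebra.ι R (A.mkQ.dualMap η)) 0 * F +
        fedMono A 1 {η} * koszul A F := by
  have h1 : ∀ (k : ℕ) (G : FedosovFun A), symCoeff A (k + 1) (fedMono A 1 {η} * G) =
      polyTmul A 1 (SymmetricAlgebra.ι R _ η) * symCoeff A k G := fun k G => by
    have := symCoeff_fedMono_mul 1 {η} k G
    rwa [Multiset.card_singleton, add_comm, symProd_singleton] at this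
  have h0 : ∀ (k : ℕ) (θ : ExteriorAlgebra R (Module.Dual R L)),
      symCoeff A k (fedMono A θ 0 * F) = polyTmul A θ 1 * symCoeff A k F := fun k θ => by
    have := symCoeff_fedMono_mul θ 0 k F
    rwa [Multiset.card_zero, zero_add] at this
  refine ext_symCoeff fun k => ?_
  rw [symCoeff_koszul, h1, koszulPoly_mul, map_add, h0]
  cases k with
  | succ k => rw [h1, symCoeff_koszul]
  | zero =>
    have h2 : symCoeff A 0 (fedMono A 1 {η} * koszul A F) = 0 :=
      mem_adicIdeal.1 (mul_mem_adicIdeal_left _ (fedMono_mem_adicIdeal 1 {η})) 0 (by simp)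
    rw [koszulPoly_symPart_zero (symCoeff_mem A 0 F), mul_zero, h2]

theorem koszul_one : koszul A (1 : FedosovFun A) = 0 := by
  refine ext_symCoeff fun k => ?_
  rw [symCoeff_koszul, ← fedMono_one_zero, symCoeff_fedMono, if_neg (by simp), map_zero, map_zero]

theorem koszul_mem {k : ℕ} {F : FedosovFun A} (hF : F ∈ adicIdeal A ((k + 1 : ℕ) : ℤ)) :
    koszul A F ∈ adicIdeal A (k : ℤ) :=
  mem_adicIdeal.2 fun i hi => by
    rw [symCoeff_koszul, mem_adicIdeal.1 hF (i + 1) (by omega), map_zero]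

theorem isVerticalOp_koszul : IsVerticalOp (koszulOp 𝕜 A) where
  continuous k := ⟨k + 1, fun _ hF => koszul_mem hF⟩
  map_mul_form F θ := by
    have key : ∀ t : PolyFun A,
        koszulPoly A (t * polyTmul A θ 1) = koszulPoly A t * polyTmul A θ 1 := by
      intro t
      induction t using polyFun_induction with
      | zero => simp
      | add s t hs ht => rw [add_mul, map_add, hs, ht, map_add, add_mul]
      | tmul θ' m =>
        rw [polyTmul_mul, koszulPoly_tmul, koszulPoly_tmul, mul_one, mul_assoc, map_mul,
          polyForm_eq θ]
    change koszul A _ = koszul A F * _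
    refine ext_symCoeff fun k => ?_
    rw [symCoeff_koszul, symCoeff_mul_fedMono_zero, symCoeff_mul_fedMono_zero, key, symCoeff_koszul]

theorem koszul_mul_of_degreeZero {F : FedosovFun A} (hF : F ∈ degreePart A 0)
    (m : Multiset (Module.Dual R (L ⧸ A))) :
    koszul A (F * fedMono A 1 m) = koszul A F * fedMono A 1 m + F * koszul A (fedMono A 1 m) := by
  induction m using Multiset.induction with
  | empty => rw [fedMono_one_zero, koszul_one, mul_one, mul_one, mul_zero, add_zero]
  | cons η m ih =>
    have h1 : F * fedMono A 1 (η ::ₘ m) = fedMono A 1 {η} * (F * fedMono A 1 m) := by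
      rw [fedMono_one_cons, ← mul_assoc, ← mul_assoc, fedMono_one_commute]
    rw [h1, koszul_generator_mul, ih, fedMono_one_cons η m, koszul_generator_mul, mul_add, mul_add,
      ← mul_assoc _ F, ← degreeZero_commute hF, ← mul_assoc _ (koszul A F),
      fedMono_one_commute {η} (koszul A F), ← mul_assoc _ F, fedMono_one_commute {η} F]
    simp only [mul_assoc]
    abel

/-! ### The homotopy formula in degree zero -/

theorem dualMap_toLin_mkQ (j : LieSplitting A) (η : Module.Dual R (L ⧸ A)) :
    j.toLin.dualMap (A.mkQ.dualMap η) = η :=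
  LinearMap.ext fun b => by simp only [LinearMap.dualMap_apply, j.mkQ_toLin]

theorem scale_generator (j : LieSplitting A) (q : ℕ) (η : Module.Dual R (L ⧸ A)) :
    j.scale 𝕜 q (ExteriorAlgebra.ι R (A.mkQ.dualMap η)) =
      algebraMap 𝕜 R (((q + 1 : ℕ) : 𝕜)⁻¹) • ExteriorAlgebra.ι R (A.mkQ.dualMap η) := by
  have h1 : j.projB (A.mkQ.dualMap η) = A.mkQ.dualMap η := by
    rw [LieSplitting.projB, LinearMap.comp_apply, dualMap_toLin_mkQ]
  have h2 : j.weight (ExteriorAlgebra.ι R (A.mkQ.dualMap η)) =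
      Polynomial.monomial 1 (ExteriorAlgebra.ι R (A.mkQ.dualMap η)) := by
    rw [LieSplitting.weight, ExteriorAlgebra.lift_ι_apply]
    simp [h1]
  rw [LieSplitting.scale, LinearMap.comp_apply, AlgHom.toLinearMap_apply, h2]
  rw [Polynomial.lsum_apply, Polynomial.sum_monomial_index]
  · simp [add_comm]
  · simp

theorem mapForm_mul (g : ExteriorAlgebra R (Module.Dual R L) →ₗ[R]
    ExteriorAlgebra R (Module.Dual R L)) (f : SymmetricAlgebra R (Module.Dual R (L ⧸ A)))
    (t : PolyFun A) :
    PolyFun.mapForm A g (polyTmul A 1 f * t) = polyTmul A 1 f * PolyFun.mapForm A g t := by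
  induction t using polyFun_induction with
  | zero => simp
  | add s t hs ht => rw [mul_add, map_add, hs, ht, map_add, mul_add]
  | tmul θ m =>
    rw [polyTmul_mul, PolyFun.mapForm_tmul, PolyFun.mapForm_tmul, polyTmul_mul, one_mul, one_mul]

theorem hatK_mul (j : LieSplitting A) (f : SymmetricAlgebra R (Module.Dual R (L ⧸ A)))
    (t : PolyFun A) : j.hatK (polyTmul A 1 f * t) = polyTmul A 1 f * j.hatK t := by
  induction t using polyFun_induction with
  | zero => simp
  | add s t hs ht => rw [mul_add, map_add, hs, ht, map_add, mul_add]
  | tmul θ m =>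
    rw [polyTmul_mul, LieSplitting.hatK_tmul, LieSplitting.hatK_tmul, one_mul, map_mul,
      ← mul_assoc, ← mul_assoc, polySym_eq f, polyTmul_one_commute]

theorem hatK_koszulHom (j : LieSplitting A) (m : Multiset (Module.Dual R (L ⧸ A))) :
    j.hatK (koszulHom A (symProd A m) 0 1) = m.card • polyTmul A 1 (symProd A m) := by
  induction m using Multiset.induction with
  | empty => simp [(koszulHom_mem A 0).2.2.2 rfl]
  | cons η m ih =>
    have h : j.hatK (polyTmul A (ExteriorAlgebra.ι R (A.mkQ.dualMap η)) (symProd A m)) =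
        polyTmul A 1 (symProd A (η ::ₘ m)) := by
      have h1 : j.contrHom (ExteriorAlgebra.ι R (A.mkQ.dualMap η)) 0 1 =
          polySym A (SymmetricAlgebra.ι R _ η) := by
        rw [LieSplitting.contrHom, ExteriorAlgebra.lift_ι_apply]
        change polySym A (SymmetricAlgebra.ι R _ (j.toLin.dualMap (A.mkQ.dualMap η))) = _
        rw [dualMap_toLin_mkQ]
      rw [LieSplitting.hatK_tmul, h1, ← map_mul, ← symProd_cons, polySym_eq]
    rw [koszulHom_cons, map_add, hatK_mul, ih, h, mul_smul_comm, polyTmul_mul, one_mul,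
      ← symProd_cons, Multiset.card_cons, succ_nsmul]

theorem mapForm_scale_koszulHom (j : LieSplitting A) (q : ℕ)
    (m : Multiset (Module.Dual R (L ⧸ A))) :
    PolyFun.mapForm A (j.scale 𝕜 q) (koszulHom A (symProd A m) 0 1) =
      algebraMap 𝕜 R (((q + 1 : ℕ) : 𝕜)⁻¹) • koszulHom A (symProd A m) 0 1 := by
  induction m using Multiset.induction with
  | empty => simp [(koszulHom_mem A 0).2.2.2 rfl]
  | cons η m ih =>
    rw [koszulHom_cons, map_add, mapForm_mul, ih, PolyFun.mapForm_tmul, scale_generator, smul_add,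
      mul_smul_comm, polyTmul_smul]

/-- The homotopy formula `h k F = F` for functions of degree zero that vanish on the zero
section. -/
theorem homotopy_koszul [CharZero 𝕜] (j : LieSplitting A) {F : FedosovFun A}
    (hF : F ∈ degreePart A 0) (h0 : symCoeff A 0 F = 0) : j.homotopy 𝕜 (koszul A F) = F := by
  refine ext_symCoeff fun k => ?_
  cases k with
  | zero => rw [symCoeff_homotopy_zero, h0]
  | succ q =>
    rw [symCoeff_homotopy_succ, symCoeff_koszul]
    have ht := mem_span_of_degree_zero (hF (q + 1)) (symCoeff_mem A (q + 1) F)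
    generalize symCoeff A (q + 1) F = t at ht
    induction ht using Submodule.span_induction with
    | zero => simp
    | add x y _ _ hx hy => rw [map_add, map_add, hx, hy]
    | smul r x _ hx => rw [map_smul, map_smul, hx]
    | mem x hx =>
      obtain ⟨m, hm, rfl⟩ := hx
      have hc : ((q + 1 : ℕ) : 𝕜) ≠ 0 := Nat.cast_ne_zero.2 q.succ_ne_zero
      rw [koszulPoly_tmul, map_one, mul_one, LieSplitting.homotopyPoly, LinearMap.comp_apply,
        mapForm_scale_koszulHom, map_smul, hatK_koszulHom, hm, ← Nat.cast_smul_eq_nsmul R,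
        smul_smul, ← map_natCast (algebraMap 𝕜 R), ← map_mul, inv_mul_cancel₀ hc, map_one, one_smul]

/-! ### The symbol of a commutator with the Koszul vector field -/

/-- By induction on the number of factors: the commutator with the multiplication by `η` has a known
symbol, and the form `k(η)` passes through `ψ` as a factor on the right. -/
theorem apply_koszul_of_hasSymbol {ψ : FedosovOp 𝕜 A} (hψ : IsVerticalOp ψ)
    {s : SymmetricAlgebra R (Module.Dual R (L ⧸ A)) →ₗ[R] FedosovFun A} (hs : HasSymbol ψ s)
    (m : Multiset (Module.Dual R (L ⧸ A))) :
    ψ (koszul A (fedMono A 1 m)) =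
      (m.antidiagonal.map fun I => s (symProd A I.1) * koszul A (fedMono A 1 I.2)).sum := by
  induction m using Multiset.induction generalizing ψ s with
  | empty => simp [fedMono_one_zero, koszul_one]
  | cons η m ih =>
    -- the commutator with the multiplication by `η` has the symbol `f ↦ s(η ⊙ f)`
    let M : FedosovOp 𝕜 A := LinearMap.mulLeft 𝕜 (fedMono A 1 {η})
    have hM : IsVerticalOp M :=
      ⟨fun k => ⟨k, fun F hF => mul_mem_adicIdeal_right _ hF⟩, fun F θ => (mul_assoc _ _ _).symm⟩
    have hc : IsVerticalOp (ψ * M - M * ψ) :=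
      isVerticalOp_sub (isVerticalOp_mul hψ hM) (isVerticalOp_mul hM hψ)
    have happ : ∀ F, ψ (fedMono A 1 {η} * F) =
        (ψ * M - M * ψ) F + fedMono A 1 {η} * ψ F := fun F => (sub_add_cancel _ _).symm
    have hsc : HasSymbol (ψ * M - M * ψ) (shiftSymbol η s) := (hasSymbol_iff hc _).2 fun m => by
      have h1 := happ (fedMono A 1 m)
      rw [← fedMono_one_cons, (hasSymbol_iff hψ s).1 hs, (hasSymbol_iff hψ s).1 hs, symbolMap,
        conv_symIncl_cons, one_smul, ← fedMono_one_commute, add_comm] at h1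
      exact (add_right_cancel h1).symm
    have h2 := ih hc hsc
    have h3 := ih hψ hs
    have h4 := hs 1 m
    have h5 : fedMono A (ExteriorAlgebra.ι R (A.mkQ.dualMap η)) 0 * fedMono A 1 m =
        fedMono A 1 m * fedMono A (ExteriorAlgebra.ι R (A.mkQ.dualMap η)) 0 :=
      (fedMono_one_commute _ _).symm
    rw [fedMono_one_cons, koszul_generator_mul, map_add, h5, hψ.map_mul_form, happ, h2, h3, h4,
      Multiset.antidiagonal_cons, Multiset.map_add, Multiset.sum_add, Multiset.map_map,
      Multiset.map_map, ← Multiset.sum_map_mul_right, ← Multiset.sum_map_mul_left]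
    have h6 : (m.antidiagonal.map ((fun I : Multiset (Module.Dual R (L ⧸ A)) ×
          Multiset (Module.Dual R (L ⧸ A)) => s (symProd A I.1) * koszul A (fedMono A 1 I.2)) ∘
          Prod.map id (Multiset.cons η))) =
        m.antidiagonal.map fun I => s (symProd A I.1) * fedMono A 1 I.2 *
          fedMono A (ExteriorAlgebra.ι R (A.mkQ.dualMap η)) 0 +
          fedMono A 1 {η} * (s (symProd A I.1) * koszul A (fedMono A 1 I.2)) := by
      refine Multiset.map_congr rfl fun I _ => ?_
      simp only [Function.comp_apply, Prod.map_fst, Prod.map_snd, id_eq]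
      rw [fedMono_one_cons, koszul_generator_mul, mul_add, mul_assoc, fedMono_one_commute I.2,
        ← mul_assoc (fedMono A 1 {η}), fedMono_one_commute {η} (s (symProd A I.1)),
        mul_assoc (s (symProd A I.1))]
    rw [h6, Multiset.sum_map_add]
    simp only [Function.comp_def, Prod.map_fst, Prod.map_snd, id_eq, shiftSymbol_symProd]
    abel

theorem symbolOf_mem_degreePart {g : SymmetricAlgebra R (Module.Dual R (L ⧸ A)) →ₗ[R] FedosovFun A}
    (h : ∀ m, g (symProd A m) ∈ degreePart A 0) (m : Multiset (Module.Dual R (L ⧸ A))) :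
    symbolOf g (symProd A m) ∈ degreePart A 0 := by
  rw [symbolOf, conv_symProd]
  refine multiset_sum_mem _ fun x hx => ?_
  obtain ⟨I, hI, rfl⟩ := Multiset.mem_map.1 hx
  rw [AlgHom.toLinearMap_apply, symIncl_symProd, mul_smul_comm]
  exact Submodule.smul_mem _ _ (mul_mem_degreePart_zero (h _) (fedMono_one_mem_degreePart _))

/-- `h_♮[k, ψ] = ψ` for vertical operators `ψ` of degree zero that raise the filtration: if `s` is
the symbol of `ψ`, then `k ∘ s` is the symbol of `[k, ψ]`, and `h k s = s` by the homotopy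
formula. -/
theorem hNat_koszul [CharZero 𝕜] (j : LieSplitting A) {ψ : FedosovOp 𝕜 A} (hψ : IsVerticalOp ψ)
    (h1 : ψ ∈ raising 𝕜 A 1) (hdeg : ∀ m, ψ (fedMono A 1 m) ∈ degreePart A 0) :
    j.hNat (koszulOp 𝕜 A * ψ - ψ * koszulOp 𝕜 A) = ψ := by
  obtain ⟨g, hg, hgm⟩ := exists_hasSymbol hψ
  have hs1 := symbolOf_mem (g := g) (N := 1) fun m => by
    rw [hgm]; exact raising_apply h1 (fedMono_mem_adicIdeal 1 m)
  have hs2 := symbolOf_mem_degreePart (g := g) fun m => by rw [hgm]; exact hdeg m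
  have hv : IsVerticalOp (koszulOp 𝕜 A * ψ - ψ * koszulOp 𝕜 A) :=
    isVerticalOp_sub (isVerticalOp_mul isVerticalOp_koszul hψ)
      (isVerticalOp_mul hψ isVerticalOp_koszul)
  have hr : koszulOp 𝕜 A * ψ - ψ * koszulOp 𝕜 A ∈ raising 𝕜 A 0 := by
    intro k F hF
    refine sub_mem (koszul_mem (raising_apply h1 hF)) ?_
    cases k with
    | zero => exact mem_adicIdeal_zero _
    | succ k => exact raising_apply h1 (koszul_mem hF)
  have hsym : HasSymbol (koszulOp 𝕜 A * ψ - ψ * koszulOp 𝕜 A) (koszul A ∘ₗ symbolOf g) := by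
    refine (hasSymbol_iff hv _).2 fun m => ?_
    change koszul A (ψ (fedMono A 1 m)) - ψ (koszul A (fedMono A 1 m)) = _
    rw [apply_koszul_of_hasSymbol hψ hg, hg, symbolMap_symProd, map_multiset_sum, Multiset.map_map,
      ← Multiset.sum_map_sub]
    refine congrArg Multiset.sum (Multiset.map_congr rfl fun I _ => ?_)
    rw [Function.comp_apply, koszul_mul_of_degreeZero (hs2 _), add_sub_cancel_right]
    rfl
  refine hNat_eq j (isShiftingOp_of_raising hv hr) (isShiftingOp_of_raising hψ h1) hsym ?_
  have : j.homotopy 𝕜 ∘ₗ koszul A ∘ₗ symbolOf g = symbolOf g :=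
    linearMap_ext_symProd fun m =>
      homotopy_koszul j (hs2 m) (mem_adicIdeal.1 (hs1 m) 0 (by omega))
  rwa [this]

/-! ### Vertical vector fields and Fedosov vector fields -/

theorem parity_iterate_mem {k : ℕ} (p : ℕ) {F : FedosovFun A} (hF : F ∈ adicIdeal A (k : ℤ)) :
    (⇑(parity A))^[p] F ∈ adicIdeal A (k : ℤ) := by
  induction p with
  | zero => exact hF
  | succ p ih => rw [Function.iterate_succ_apply']; exact parity_mem_adicIdeal ih

theorem parity_one : parity A (1 : FedosovFun A) = 1 := by
  rw [← fedMono_one_zero]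
  exact parity_degreeZero (fedMono_one_mem_degreePart 0)

theorem field_one {p n : ℕ} {X : FedosovOp 𝕜 A} (hX : IsVerticalField p n X) : X 1 = 0 := by
  have h := hX.leibniz 1 1
  rw [Function.iterate_fixed parity_one, mul_one, mul_one, one_mul] at h
  exact left_eq_add.1 h

theorem field_mem_raising {p : ℕ} {X : FedosovOp 𝕜 A} (hX : IsVerticalField p 2 X) :
    X ∈ raising 𝕜 A 1 := by
  refine raising_of_fedMono hX.vertical fun m => ?_
  induction m using Multiset.induction with
  | empty => rw [fedMono_one_zero, field_one hX]; exact zero_mem _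
  | cons η m ih =>
    rw [fedMono_one_cons, hX.leibniz, Multiset.card_cons]
    refine add_mem (adicIdeal_anti (by omega)
      (mul_mem_adicIdeal (hX.order η) (fedMono_mem_adicIdeal 1 m)))
      (adicIdeal_anti ?_ (mul_mem_adicIdeal
        (parity_iterate_mem p (fedMono_mem_adicIdeal 1 {η})) ih))
    rw [Multiset.card_singleton]; omega

/-- The part `k + Q = d_L^∇ + X` of a Fedosov vector field preserves the filtration, and it is a
derivation over the differential `d_L` of `Γ(Λ^• L^∨)`. -/
theorem fedosovField_spec {𝓛 : LieAlgebroid 𝕜 R L} {j : LieSplitting A} {D : LConnection 𝓛 A}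
    {Q : FedosovOp 𝕜 A} (hQ : IsFedosovField j D Q) :
    koszulOp 𝕜 A + Q ∈ raising 𝕜 A 0 ∧ ∀ F θ, (koszulOp 𝕜 A + Q) (F * fedMono A θ 0) =
      (koszulOp 𝕜 A + Q) F * fedMono A θ 0 + parity A F * fedMono A (𝓛.dCE θ) 0 := by
  obtain ⟨d, X, hd, hX, -, rfl, -⟩ := hQ
  have e : koszulOp 𝕜 A + (-koszulOp 𝕜 A + d + X) = d + X := by abel
  rw [e]
  refine ⟨add_mem (fun k F hF => mem_adicIdeal.2 fun i hi =>
    hd.symCoeff_eq_zero F i (mem_adicIdeal.1 hF i hi))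
    (raising_anti (Nat.zero_le 1) (field_mem_raising hX)), fun F θ => ?_⟩
  rw [LinearMap.add_apply, LinearMap.add_apply, hd.leibniz, hd.form, hX.vertical.map_mul_form,
    add_mul]
  abel

theorem parityOp_mem_raising : parityOp 𝕜 A ∈ raising 𝕜 A 0 := fun _ _ hF =>
  parity_mem_adicIdeal hF

theorem isVerticalOp_parity_conj {ψ : FedosovOp 𝕜 A} (hψ : IsVerticalOp ψ) :
    IsVerticalOp (parityOp 𝕜 A * ψ * parityOp 𝕜 A) where
  continuous k := by
    obtain ⟨m, hm⟩ := hψ.continuous k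
    exact ⟨m, fun F hF => parity_mem_adicIdeal (hm _ (parity_mem_adicIdeal hF))⟩
  map_mul_form F θ := by
    change parity A (ψ (parity A _)) = parity A (ψ (parity A F)) * _
    obtain ⟨θ', hθ⟩ := parity_fedMono_zero (A := A) θ
    rw [parity_mul, hθ, hψ.map_mul_form, parity_mul, ← hθ, parity_parity]

/-- The commutator of a vertical operator with a derivation over a differential `d` of
`Γ(Λ^• L^∨)` is again vertical: the two terms that involve `d` cancel. -/
theorem isVerticalOp_oddCommutator {d : ExteriorAlgebra R (Module.Dual R L) →
      ExteriorAlgebra R (Module.Dual R L)} {D ψ : FedosovOp 𝕜 A} (hD : D ∈ raising 𝕜 A 0)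
    (h : ∀ F θ, D (F * fedMono A θ 0) = D F * fedMono A θ 0 + parity A F * fedMono A (d θ) 0)
    (hψ : IsVerticalOp ψ) : IsVerticalOp (oddCommutator D ψ) where
  continuous k := by
    obtain ⟨m, hm⟩ := hψ.continuous k
    obtain ⟨n, hn⟩ := (isVerticalOp_parity_conj hψ).continuous k
    exact ⟨max m n, fun F hF => sub_mem
      (raising_apply hD (hm F (adicIdeal_anti (le_max_left _ _) hF)))
      (hn _ (raising_apply hD (adicIdeal_anti (le_max_right _ _) hF)))⟩
  map_mul_form F θ := by
    have h1 : (parityOp 𝕜 A * ψ * parityOp 𝕜 A) (parity A F) = parity A (ψ F) := by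
      change parity A (ψ (parity A (parity A F))) = _
      rw [parity_parity]
    change D (ψ _) - (parityOp 𝕜 A * ψ * parityOp 𝕜 A) (D _) =
      (D (ψ F) - (parityOp 𝕜 A * ψ * parityOp 𝕜 A) (D F)) * _
    rw [hψ.map_mul_form, h, h, map_add, (isVerticalOp_parity_conj hψ).map_mul_form,
      (isVerticalOp_parity_conj hψ).map_mul_form, h1, sub_mul]
    abel

section Perturbation

variable {𝓛 : LieAlgebroid 𝕜 R L} {j₁ j₂ : LieSplitting A} {D₁ D₂ : LConnection 𝓛 A}
  {Q₁ Q₂ : FedosovOp 𝕜 A}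

/-- `ΔQ` is vertical because both Fedosov fields are derivations over the same differential
`d_L`. -/
theorem difference_spec (hQ₁ : IsFedosovField j₁ D₁ Q₁) (hQ₂ : IsFedosovField j₂ D₂ Q₂) :
    IsVerticalOp (Q₁ - Q₂) ∧ Q₁ - Q₂ ∈ raising 𝕜 A 0 := by
  obtain ⟨h1, h1'⟩ := fedosovField_spec hQ₁
  obtain ⟨h2, h2'⟩ := fedosovField_spec hQ₂
  have e : Q₁ - Q₂ = (koszulOp 𝕜 A + Q₁) - (koszulOp 𝕜 A + Q₂) := by abel
  have hr : Q₁ - Q₂ ∈ raising 𝕜 A 0 := by rw [e]; exact sub_mem h1 h2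
  refine ⟨⟨isAdicContinuous_of_raising hr, fun F θ => ?_⟩, hr⟩
  rw [e, LinearMap.sub_apply, LinearMap.sub_apply, h1', h2', sub_mul]
  abel

/-- The operator `ð` preserves the filtration: in `ΔQ` and in `k + Q₂`, the Koszul fields cancel. -/
theorem ethOp_spec (hQ₁ : IsFedosovField j₁ D₁ Q₁) (hQ₂ : IsFedosovField j₂ D₂ Q₂)
    {ψ : FedosovOp 𝕜 A} (hψ : IsVerticalOp ψ) {N : ℕ} (h : ψ ∈ raising 𝕜 A N) :
    IsVerticalOp (ethOp Q₁ Q₂ ψ) ∧ ethOp Q₁ Q₂ ψ ∈ raising 𝕜 A N := by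
  obtain ⟨h1, h2⟩ := difference_spec hQ₁ hQ₂
  obtain ⟨h3, h4⟩ := fedosovField_spec hQ₂
  refine ⟨isVerticalOp_add (isVerticalOp_mul h1 hψ) (isVerticalOp_oddCommutator h3 h4 hψ),
    add_mem ?_ (sub_mem ?_ ?_)⟩
  · have := mul_mem_raising h2 h
    rwa [zero_add] at this
  · have := mul_mem_raising h3 h
    rwa [zero_add] at this
  · have := mul_mem_raising (mul_mem_raising (mul_mem_raising parityOp_mem_raising h)
      parityOp_mem_raising) h3
    rwa [zero_add] at this

theorem ethOp_add (ψ χ : FedosovOp 𝕜 A) :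
    ethOp Q₁ Q₂ (ψ + χ) = ethOp Q₁ Q₂ ψ + ethOp Q₁ Q₂ χ := by
  unfold ethOp oddCommutator
  noncomm_ring

theorem iterate_spec (j : LieSplitting A) (hQ₁ : IsFedosovField j₁ D₁ Q₁)
    (hQ₂ : IsFedosovField j₂ D₂ Q₂) {ψ : FedosovOp 𝕜 A} (hψ : IsVerticalOp ψ) {N : ℕ}
    (h : ψ ∈ raising 𝕜 A N) (n : ℕ) :
    IsVerticalOp ((fun φ => j.hNat (ethOp Q₁ Q₂ φ))^[n] ψ) ∧
      (fun φ => j.hNat (ethOp Q₁ Q₂ φ))^[n] ψ ∈ raising 𝕜 A (N + n) := by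
  induction n with
  | zero => exact ⟨hψ, h⟩
  | succ n ih =>
    rw [Function.iterate_succ_apply']
    obtain ⟨h1, h2⟩ := ethOp_spec hQ₁ hQ₂ ih.1 ih.2
    obtain ⟨h3, h4, -⟩ := hNat_spec j h1 h2
    exact ⟨h3, h4⟩

theorem iterate_add (j : LieSplitting A) (hQ₁ : IsFedosovField j₁ D₁ Q₁)
    (hQ₂ : IsFedosovField j₂ D₂ Q₂) {ψ χ : FedosovOp 𝕜 A} (hψ : IsVerticalOp ψ)
    (h : ψ ∈ raising 𝕜 A 0) (hχ : IsVerticalOp χ) (h' : χ ∈ raising 𝕜 A 0) (n : ℕ) :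
    (fun φ => j.hNat (ethOp Q₁ Q₂ φ))^[n] (ψ + χ) =
      (fun φ => j.hNat (ethOp Q₁ Q₂ φ))^[n] ψ + (fun φ => j.hNat (ethOp Q₁ Q₂ φ))^[n] χ := by
  induction n with
  | zero => rfl
  | succ n ih =>
    rw [Function.iterate_succ_apply', Function.iterate_succ_apply',
      Function.iterate_succ_apply', ih, ethOp_add]
    obtain ⟨h1, h2⟩ := iterate_spec j hQ₁ hQ₂ hψ h n
    obtain ⟨h3, h4⟩ := iterate_spec j hQ₁ hQ₂ hχ h' n
    obtain ⟨h5, h6⟩ := ethOp_spec hQ₁ hQ₂ h1 (raising_anti (Nat.zero_le _) h2)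
    obtain ⟨h7, h8⟩ := ethOp_spec hQ₁ hQ₂ h3 (raising_anti (Nat.zero_le _) h4)
    exact hNat_add j h5 h7 h6 h8

theorem iterTerm_mem_raising (j : LieSplitting A) (hQ₁ : IsFedosovField j₁ D₁ Q₁)
    (hQ₂ : IsFedosovField j₂ D₂ Q₂) (n : ℕ) : j.iterTerm Q₁ Q₂ n ∈ raising 𝕜 A (n + 1) := by
  obtain ⟨h1, h2⟩ := difference_spec hQ₁ hQ₂
  obtain ⟨h3, h4, -⟩ := hNat_spec j h1 h2
  rw [add_comm, ← zero_add 1]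
  exact (iterate_spec j hQ₁ hQ₂ h3 h4 n).2

/-! ### Vertical isomorphisms are unipotent -/

/-- The evaluation of functions of degree zero on the zero section. -/
def augmentation (A : Submodule R L) : PolyFun A →ₐ[R] R :=
  (Algebra.TensorProduct.lift ExteriorAlgebra.algebraMapInv SymmetricAlgebra.algebraMapInv
    fun _ _ => Commute.all _ _).comp (PolyFun.equiv A).symm.toAlgHom

theorem symCoeff_zero_pow (F : FedosovFun A) (n : ℕ) :
    symCoeff A 0 (F ^ n) = symCoeff A 0 F ^ n := by
  induction n with
  | zero =>
    rw [pow_zero, pow_zero, ← fedMono_one_zero, symCoeff_fedMono, if_pos Multiset.card_zero.symm,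
      symProd_zero, ← polyForm_eq, map_one]
  | succ n ih => rw [pow_succ, pow_succ, ← ih, symCoeff_mul]; simp

/-- A function of degree zero with a power in `𝓘` vanishes on the zero section, as `R` is
reduced. -/
theorem symCoeff_zero_eq_zero_of_pow_mem [IsReduced R] {F : FedosovFun A}
    (hF : F ∈ degreePart A 0) {n : ℕ} (h : F ^ n ∈ adicIdeal A ((1 : ℕ) : ℤ)) :
    symCoeff A 0 F = 0 := by
  have h1 : ∃ r : R, symCoeff A 0 F = r • 1 := by
    have ht := mem_span_of_degree_zero (hF 0) (symCoeff_mem A 0 F)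
    generalize symCoeff A 0 F = t at ht
    induction ht using Submodule.span_induction with
    | zero => exact ⟨0, by simp⟩
    | add x y _ _ hx hy =>
      obtain ⟨r, rfl⟩ := hx
      obtain ⟨s, rfl⟩ := hy
      exact ⟨r + s, (add_smul _ _ _).symm⟩
    | smul c x _ hx => obtain ⟨r, rfl⟩ := hx; exact ⟨c * r, smul_smul _ _ _⟩
    | mem x hx =>
      obtain ⟨m, hm, rfl⟩ := hx
      obtain rfl := Multiset.card_eq_zero.1 hm
      exact ⟨1, by rw [one_smul, symProd_zero, ← polyForm_eq, map_one]⟩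
  obtain ⟨r, hr⟩ := h1
  have h2 := mem_adicIdeal.1 h 0 Nat.zero_lt_one
  rw [symCoeff_zero_pow, hr, ← Algebra.algebraMap_eq_smul_one, ← map_pow] at h2
  have h3 := congrArg (augmentation A) h2
  rw [AlgHom.commutes, map_zero, Algebra.algebraMap_self, RingHom.id_apply] at h3
  rw [hr, IsReduced.eq_zero r ⟨n, h3⟩, zero_smul]

theorem verticalIso_apply_mem {φ : FedosovOp 𝕜 A} (hφ : IsVerticalIso Q₂ Q₁ φ)
    (m : Multiset (Module.Dual R (L ⧸ A))) : φ (fedMono A 1 m) ∈ degreePart A 0 :=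
  hφ.degree 0 _ (fedMono_one_mem_degreePart m)

/-- By continuity, `φ(η)^n = φ(η^n)` lies in `𝓘` for large `n`, and so `φ(η)` lies in `𝓘`. -/
theorem verticalIso_mem_raising_zero [IsReduced R] {φ : FedosovOp 𝕜 A}
    (hφ : IsVerticalIso Q₂ Q₁ φ) : φ ∈ raising 𝕜 A 0 := by
  have h1 : ∀ η, φ (fedMono A 1 {η}) ∈ adicIdeal A ((1 : ℕ) : ℤ) := fun η => by
    obtain ⟨n, hn⟩ := hφ.vertical.continuous 1
    have hpow : φ (fedMono A 1 (Multiset.replicate n η)) = φ (fedMono A 1 {η}) ^ n := by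
      clear hn
      induction n with
      | zero => rw [Multiset.replicate_zero, fedMono_one_zero, hφ.map_one, pow_zero]
      | succ n ih => rw [Multiset.replicate_succ, fedMono_one_cons, hφ.map_mul, ih, pow_succ']
    have h2 := hn _ (by
      have := fedMono_mem_adicIdeal (A := A) 1 (Multiset.replicate n η)
      rwa [Multiset.card_replicate] at this)
    rw [hpow] at h2
    refine mem_adicIdeal.2 fun i hi => ?_
    obtain rfl : i = 0 := by omega
    exact symCoeff_zero_eq_zero_of_pow_mem (verticalIso_apply_mem hφ {η}) h2
  refine raising_of_fedMono hφ.vertical fun m => ?_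
  induction m using Multiset.induction with
  | empty => exact mem_adicIdeal_zero _
  | cons η m ih =>
    rw [fedMono_one_cons, hφ.map_mul, Multiset.card_cons]
    exact adicIdeal_anti (by omega) (mul_mem_adicIdeal (h1 η) ih)

/-- A vertical isomorphism differs from the identity by an operator that raises the filtration:
modulo `𝓘`, the relation `φ Q₂ = Q₁ φ` says that `k(φ(η) - η) = 0`, and `h` recovers `φ(η) - η`
modulo `𝓘²`. -/
theorem verticalIso_sub_one_mem_raising [IsReduced R] [CharZero 𝕜]
    (hQ₁ : IsFedosovField j₁ D₁ Q₁) (hQ₂ : IsFedosovField j₂ D₂ Q₂) {φ : FedosovOp 𝕜 A}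
    (hφ : IsVerticalIso Q₂ Q₁ φ) : φ - 1 ∈ raising 𝕜 A 1 := by
  have h0 := verticalIso_mem_raising_zero hφ
  have hη : ∀ η, φ (fedMono A 1 {η}) - fedMono A 1 {η} ∈ adicIdeal A ((2 : ℕ) : ℤ) := fun η => by
    have hI : fedMono A 1 {η} ∈ adicIdeal A ((1 : ℕ) : ℤ) := fedMono_mem_adicIdeal 1 {η}
    have hφI : φ (fedMono A 1 {η}) ∈ adicIdeal A ((1 : ℕ) : ℤ) := raising_apply h0 hI
    have hk : koszul A (fedMono A 1 {η}) =
        fedMono A (ExteriorAlgebra.ι R (A.mkQ.dualMap η)) 0 := by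
      have := koszul_generator_mul (A := A) η 1
      rwa [mul_one, mul_one, koszul_one, mul_zero, add_zero] at this
    have hφk : φ (koszul A (fedMono A 1 {η})) = koszul A (fedMono A 1 {η}) := by
      have := hφ.vertical.map_mul_form 1 (ExteriorAlgebra.ι R (A.mkQ.dualMap η))
      rw [hφ.map_one, one_mul] at this
      rw [hk, this]
    have hcomm : φ (Q₂ (fedMono A 1 {η})) = Q₁ (φ (fedMono A 1 {η})) :=
      LinearMap.congr_fun hφ.comm (fedMono A 1 {η})
    have h1 := raising_apply (fedosovField_spec hQ₁).1 hφI
    have h2 := raising_apply h0 (raising_apply (fedosovField_spec hQ₂).1 hI)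
    have h3 : koszul A (φ (fedMono A 1 {η}) - fedMono A 1 {η}) ∈ adicIdeal A ((1 : ℕ) : ℤ) := by
      have h4 := sub_mem h1 h2
      rw [LinearMap.add_apply, LinearMap.add_apply, map_add, hcomm, add_sub_add_right_eq_sub] at h4
      change koszul A (φ (fedMono A 1 {η})) - φ (koszul A (fedMono A 1 {η})) ∈ _ at h4
      rwa [hφk, ← map_sub] at h4
    have h5 := homotopy_koszul (𝕜 := 𝕜) j₁
      (sub_mem (verticalIso_apply_mem hφ {η}) (fedMono_one_mem_degreePart {η}))
      (mem_adicIdeal.1 (sub_mem hφI hI) 0 Nat.zero_lt_one)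
    rw [← h5]
    exact homotopy_mem j₁ h3
  refine raising_of_fedMono (isVerticalOp_sub hφ.vertical isVerticalOp_one) fun m => ?_
  rw [LinearMap.sub_apply, Module.End.one_apply]
  induction m using Multiset.induction with
  | empty => rw [fedMono_one_zero, hφ.map_one, sub_self]; exact zero_mem _
  | cons η m ih =>
    rw [fedMono_one_cons, hφ.map_mul, Multiset.card_cons]
    have e : φ (fedMono A 1 {η}) * φ (fedMono A 1 m) - fedMono A 1 {η} * fedMono A 1 m =
        (φ (fedMono A 1 {η}) - fedMono A 1 {η}) * φ (fedMono A 1 m) +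
          fedMono A 1 {η} * (φ (fedMono A 1 m) - fedMono A 1 m) := by
      rw [sub_mul, mul_sub]; abel
    rw [e]
    have h1 : fedMono A 1 {η} ∈ adicIdeal A ((1 : ℕ) : ℤ) := fedMono_mem_adicIdeal 1 {η}
    exact add_mem (adicIdeal_anti (by omega) (mul_mem_adicIdeal (hη η)
      (raising_apply h0 (fedMono_mem_adicIdeal 1 m))))
      (adicIdeal_anti (by omega) (mul_mem_adicIdeal h1 ih))

/-- `φ - 1` is a fixed point of `ψ ↦ h_♮(ΔQ) + h_♮(ð ψ)`: the relation `φ Q₂ = Q₁ φ` amounts to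
`[k, φ - 1] = ΔQ + ð(φ - 1)`, to which `h_♮` is applied. -/
theorem verticalIso_sub_one_eq [IsReduced R] [CharZero 𝕜] (j : LieSplitting A)
    (hQ₁ : IsFedosovField j₁ D₁ Q₁) (hQ₂ : IsFedosovField j₂ D₂ Q₂) {φ : FedosovOp 𝕜 A}
    (hφ : IsVerticalIso Q₂ Q₁ φ) :
    φ - 1 = j.hNat (Q₁ - Q₂) + j.hNat (ethOp Q₁ Q₂ (φ - 1)) := by
  have hv : IsVerticalOp (φ - 1) := isVerticalOp_sub hφ.vertical isVerticalOp_one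
  have hr := verticalIso_sub_one_mem_raising hQ₁ hQ₂ hφ
  have hdeg : ∀ m, (φ - 1) (fedMono A 1 m) ∈ degreePart A 0 := fun m =>
    sub_mem (verticalIso_apply_mem hφ m) (fedMono_one_mem_degreePart m)
  have hpar : parityOp 𝕜 A * (φ - 1) * parityOp 𝕜 A = φ - 1 :=
    vertical_ext (isVerticalOp_parity_conj hv) hv fun m => by
      change parity A ((φ - 1) (parity A (fedMono A 1 m))) = _
      rw [parity_degreeZero (fedMono_one_mem_degreePart m), parity_degreeZero (hdeg m)]
  have e : koszulOp 𝕜 A * (φ - 1) - (φ - 1) * koszulOp 𝕜 A =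
      (Q₁ - Q₂) + ethOp Q₁ Q₂ (φ - 1) := by
    unfold ethOp oddCommutator
    rw [hpar]
    have hcomm := hφ.comm
    have : (Q₁ - Q₂) + ((Q₁ - Q₂) * (φ - 1) +
        ((koszulOp 𝕜 A + Q₂) * (φ - 1) - (φ - 1) * (koszulOp 𝕜 A + Q₂))) =
        koszulOp 𝕜 A * (φ - 1) - (φ - 1) * koszulOp 𝕜 A + (Q₁ * φ - φ * Q₂) := by noncomm_ring
    rw [this, hcomm, sub_self, add_zero]
  obtain ⟨h1, h2⟩ := difference_spec hQ₁ hQ₂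
  obtain ⟨h3, h4⟩ := ethOp_spec hQ₁ hQ₂ hv hr
  rw [← hNat_add j h1 h3 h2 (raising_anti (Nat.zero_le _) h4), ← e, hNat_koszul j hv hr hdeg]

/-- The partial sums of `∑_i (h_♮ ð)^i (h_♮(ΔQ))` converge to `φ - 1`: the remainder is
`(h_♮ ð)^n (φ - 1)`. -/
theorem verticalIso_sub_sum_mem_raising [IsReduced R] [CharZero 𝕜] (j : LieSplitting A)
    (hQ₁ : IsFedosovField j₁ D₁ Q₁) (hQ₂ : IsFedosovField j₂ D₂ Q₂) {φ : FedosovOp 𝕜 A}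
    (hφ : IsVerticalIso Q₂ Q₁ φ) (n : ℕ) :
    (φ - 1) - ∑ i ∈ Finset.range n, j.iterTerm Q₁ Q₂ i ∈ raising 𝕜 A (1 + n) := by
  have hv : IsVerticalOp (φ - 1) := isVerticalOp_sub hφ.vertical isVerticalOp_one
  have hr := verticalIso_sub_one_mem_raising hQ₁ hQ₂ hφ
  obtain ⟨h1, h2⟩ := difference_spec hQ₁ hQ₂
  obtain ⟨h3, h4, -⟩ := hNat_spec j h1 h2
  obtain ⟨h5, h6⟩ := ethOp_spec hQ₁ hQ₂ hv hr
  obtain ⟨h7, h8, -⟩ := hNat_spec j h5 h6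
  have key : (φ - 1) - ∑ i ∈ Finset.range n, j.iterTerm Q₁ Q₂ i =
      (fun φ => j.hNat (ethOp Q₁ Q₂ φ))^[n] (φ - 1) := by
    induction n with
    | zero => simp
    | succ n ih =>
      rw [Finset.sum_range_succ, ← sub_sub, ih]
      conv_lhs => rw [verticalIso_sub_one_eq j hQ₁ hQ₂ hφ]
      rw [iterate_add j hQ₁ hQ₂ h3 (raising_anti (Nat.zero_le _) h4) h7
        (raising_anti (Nat.zero_le _) h8), Function.iterate_succ_apply, LieSplitting.iterTerm,
        add_sub_cancel_left]
  rw [key]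
  exact (iterate_spec j hQ₁ hQ₂ hv hr n).2

end Perturbation

/-! ### Congruences between operators -/

theorem mul_mem_raising_left {K : ℕ} {ψ χ : FedosovOp 𝕜 A} (hψ : ψ ∈ raising 𝕜 A 0)
    (hχ : χ ∈ raising 𝕜 A K) : ψ * χ ∈ raising 𝕜 A K := by
  have := mul_mem_raising hψ hχ
  rwa [zero_add] at this

theorem mul_mem_raising_right {K : ℕ} {ψ χ : FedosovOp 𝕜 A} (hψ : ψ ∈ raising 𝕜 A K)
    (hχ : χ ∈ raising 𝕜 A 0) : ψ * χ ∈ raising 𝕜 A K := by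
  have := mul_mem_raising hψ hχ
  rwa [add_zero] at this

theorem pow_mem_raising_zero {ψ : FedosovOp 𝕜 A} (hψ : ψ ∈ raising 𝕜 A 0) (n : ℕ) :
    ψ ^ n ∈ raising 𝕜 A 0 := by
  induction n with
  | zero => exact one_mem_raising
  | succ n ih => rw [pow_succ]; exact mul_mem_raising_right ih hψ

theorem pow_sub_pow_mem_raising {K : ℕ} {ψ χ : FedosovOp 𝕜 A} (hψ : ψ ∈ raising 𝕜 A 0)
    (hχ : χ ∈ raising 𝕜 A 0) (h : ψ - χ ∈ raising 𝕜 A K) (n : ℕ) :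
    ψ ^ n - χ ^ n ∈ raising 𝕜 A K := by
  induction n with
  | zero => rw [pow_zero, pow_zero, sub_self]; exact zero_mem _
  | succ n ih =>
    have e : ψ ^ (n + 1) - χ ^ (n + 1) = ψ ^ n * (ψ - χ) + (ψ ^ n - χ ^ n) * χ := by
      rw [pow_succ, pow_succ]; noncomm_ring
    rw [e]
    exact add_mem (mul_mem_raising_left (pow_mem_raising_zero hψ n) h)
      (mul_mem_raising_right ih hχ)

/-! ### Powers, logarithm and exponential of unipotent operators -/

/-- The truncated binomial series `∑_{k < K} (t choose k) N^k`. -/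
def powSeries (N : FedosovOp 𝕜 A) (K : ℕ) (t : 𝕜) : FedosovOp 𝕜 A :=
  ∑ k ∈ Finset.range K, (binomialPoly 𝕜 k).eval t • N ^ k

/-- The truncated logarithm `∑_{n < K} (-1)^n N^{n + 1} / (n + 1)`. -/
def logSeries (N : FedosovOp 𝕜 A) (K : ℕ) : FedosovOp 𝕜 A :=
  ∑ n ∈ Finset.range K, ((-1 : 𝕜) ^ n / ((n : 𝕜) + 1)) • N ^ (n + 1)

/-- The logarithm `∑_n (-1)^n N^{n + 1} / (n + 1)` of `1 + N`. -/
def logOp (N : FedosovOp 𝕜 A) : FedosovOp 𝕜 A :=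
  adicSum fun n => ((-1 : 𝕜) ^ n / ((n : 𝕜) + 1)) • N ^ (n + 1)

section Unipotent

variable {φ : FedosovOp 𝕜 A}

theorem logTerm_mem_raising {N : FedosovOp 𝕜 A} (hN : N ∈ raising 𝕜 A 1) (n : ℕ) :
    ((-1 : 𝕜) ^ n / ((n : 𝕜) + 1)) • N ^ (n + 1) ∈ raising 𝕜 A (n + 1) :=
  Submodule.smul_mem _ _ (pow_mem_raising hN (n + 1))

theorem logOp_sub_logSeries {N : FedosovOp 𝕜 A} (hN : N ∈ raising 𝕜 A 1) (K : ℕ) :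
    logOp N - logSeries N K ∈ raising 𝕜 A K :=
  adicSum_sub_mem_raising (fun n => raising_anti n.le_succ (logTerm_mem_raising hN n)) K

theorem logSeries_mem_raising {N : FedosovOp 𝕜 A} (hN : N ∈ raising 𝕜 A 1) (K : ℕ) :
    logSeries N K ∈ raising 𝕜 A 1 :=
  Submodule.sum_mem _ fun n _ => raising_anti (by omega) (logTerm_mem_raising hN n)

theorem logOp_mem_raising {N : FedosovOp 𝕜 A} (hN : N ∈ raising 𝕜 A 1) :
    logOp N ∈ raising 𝕜 A 1 := by
  have := add_mem (logOp_sub_logSeries hN 1) (logSeries_mem_raising hN 1)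
  rwa [sub_add_cancel] at this

/-- The coefficient of `t` in `∑_k (t choose k) N^k` is the logarithm of `1 + N`. -/
theorem sum_coeff_one [CharZero 𝕜] (N : FedosovOp 𝕜 A) (K : ℕ) :
    ∑ k ∈ Finset.range (K + 1), (binomialPoly 𝕜 k).coeff 1 • N ^ k = logSeries N K := by
  rw [Finset.sum_range_succ', binomialPoly_zero_coeff_one, zero_smul, add_zero]
  exact Finset.sum_congr rfl fun n _ => by rw [binomialPoly_succ_coeff_one]

theorem sum_coeff_zero [CharZero 𝕜] (N : FedosovOp 𝕜 A) (K : ℕ) :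
    ∑ k ∈ Finset.range (K + 1), (binomialPoly 𝕜 k).coeff 0 • N ^ k = 1 := by
  rw [Finset.sum_range_succ', Finset.sum_eq_zero, zero_add, binomialPoly_coeff_zero, if_pos rfl,
    one_smul, pow_zero]
  intro k _
  rw [binomialPoly_coeff_zero, if_neg k.succ_ne_zero, zero_smul]

theorem powSeries_mem_raising (h : φ - 1 ∈ raising 𝕜 A 1) (K : ℕ) (t : 𝕜) :
    powSeries (φ - 1) K t ∈ raising 𝕜 A 0 :=
  Submodule.sum_mem _ fun k _ =>
    Submodule.smul_mem _ _ (raising_anti (Nat.zero_le k) (pow_mem_raising h k))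

/-- `φ^n = ∑_k (n choose k) (φ - 1)^k`, where the terms with `k ≥ K` are negligible. -/
theorem pow_sub_powSeries_mem [CharZero 𝕜] (h : φ - 1 ∈ raising 𝕜 A 1) (K n : ℕ) :
    φ ^ n - powSeries (φ - 1) K (n : 𝕜) ∈ raising 𝕜 A K := by
  have h1 : φ ^ n = ∑ k ∈ Finset.range (n + 1), (n.choose k : 𝕜) • (φ - 1) ^ k := by
    have := (Commute.one_right (φ - 1)).add_pow n
    rw [sub_add_cancel] at this
    rw [this]
    refine Finset.sum_congr rfl fun k _ => ?_
    rw [one_pow, mul_one, ← nsmul_eq_mul', Nat.cast_smul_eq_nsmul]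
  have h2 : ∑ k ∈ Finset.range (n + 1), (n.choose k : 𝕜) • (φ - 1) ^ k =
      ∑ k ∈ Finset.range (K + (n + 1)), (n.choose k : 𝕜) • (φ - 1) ^ k := by
    refine Finset.sum_subset (Finset.range_subset_range.2 (by omega)) fun k _ hk => ?_
    rw [Finset.mem_range, not_lt] at hk
    rw [Nat.choose_eq_zero_of_lt (by omega), Nat.cast_zero, zero_smul]
  rw [h1, h2, powSeries, ← Finset.sum_range_add_sum_Ico _ (show K ≤ K + (n + 1) by omega)]
  simp only [binomialPoly_eval]
  rw [add_sub_cancel_left]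
  exact Submodule.sum_mem _ fun k hk => Submodule.smul_mem _ _
    (raising_anti (Finset.mem_Ico.1 hk).1 (pow_mem_raising h k))

/-- The coefficient of `t` in `φ^t(F G) = φ^t(F) φ^t(G)`, which holds at all natural numbers `t`. -/
theorem logSeries_leibniz [CharZero 𝕜] (h : φ - 1 ∈ raising 𝕜 A 1)
    (hmul : ∀ F G, φ (F * G) = φ F * φ G)
    (K : ℕ) (F G : FedosovFun A) :
    logSeries (φ - 1) K (F * G) -
      (logSeries (φ - 1) K F * G + F * logSeries (φ - 1) K G) ∈
        adicIdeal A ((K + 1 : ℕ) : ℤ) := by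
  have hpow : ∀ n : ℕ, (φ ^ n) (F * G) = (φ ^ n) F * (φ ^ n) G := fun n => by
    induction n with
    | zero => rfl
    | succ n ih =>
      rw [pow_succ', Module.End.mul_apply, Module.End.mul_apply, Module.End.mul_apply, ih, hmul]
  have h1 := functional_sum_sub_sum_mem (adicSpace 𝕜 A (K + 1)) (Finset.range (K + 1))
    (Finset.range (K + 1) ×ˢ Finset.range (K + 1)) (binomialPoly 𝕜)
    (fun x => binomialPoly 𝕜 x.1 * binomialPoly 𝕜 x.2) (fun k => ((φ - 1) ^ k) (F * G))
    (fun x => ((φ - 1) ^ x.1) F * ((φ - 1) ^ x.2) G) (fun n => by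
      have hs : ∀ H, (φ ^ n - powSeries (φ - 1) (K + 1) (n : 𝕜) : FedosovOp 𝕜 A) H ∈
          adicIdeal A ((K + 1 : ℕ) : ℤ) :=
        raising_apply_mem (pow_sub_powSeries_mem h (K + 1) n)
      have h2 := sub_mem (add_mem (mul_mem_adicIdeal_left ((φ ^ n) G) (hs F))
        (mul_mem_adicIdeal_right (powSeries (φ - 1) (K + 1) (n : 𝕜) F) (hs G))) (hs (F * G))
      change _ ∈ adicIdeal A ((K + 1 : ℕ) : ℤ)
      convert h2 using 1
      have e1 : ∑ k ∈ Finset.range (K + 1), (binomialPoly 𝕜 k).eval (n : 𝕜) •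
          ((φ - 1) ^ k) (F * G) = powSeries (φ - 1) (K + 1) (n : 𝕜) (F * G) := by
        simp only [powSeries, LinearMap.sum_apply, LinearMap.smul_apply]
      have e2 : ∑ x ∈ Finset.range (K + 1) ×ˢ Finset.range (K + 1),
          (binomialPoly 𝕜 x.1 * binomialPoly 𝕜 x.2).eval (n : 𝕜) •
          (((φ - 1) ^ x.1) F * ((φ - 1) ^ x.2) G) =
          powSeries (φ - 1) (K + 1) (n : 𝕜) F * powSeries (φ - 1) (K + 1) (n : 𝕜) G := by
        simp only [powSeries, LinearMap.sum_apply, LinearMap.smul_apply, Finset.sum_mul_sum,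
          Finset.sum_product, smul_mul_smul_comm, Polynomial.eval_mul]
      rw [e1, e2]
      simp only [LinearMap.sub_apply, hpow, sub_mul, mul_sub]
      abel) (Polynomial.lcoeff 𝕜 1)
  have e1 : ∑ k ∈ Finset.range (K + 1), (binomialPoly 𝕜 k).coeff 1 • ((φ - 1) ^ k) (F * G) =
      logSeries (φ - 1) K (F * G) := by
    rw [← sum_coeff_one, LinearMap.sum_apply]
    rfl
  have e2 : ∑ x ∈ Finset.range (K + 1) ×ˢ Finset.range (K + 1),
      (binomialPoly 𝕜 x.1 * binomialPoly 𝕜 x.2).coeff 1 •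
        (((φ - 1) ^ x.1) F * ((φ - 1) ^ x.2) G) =
      logSeries (φ - 1) K F * G + F * logSeries (φ - 1) K G := by
    have e3 : ∀ H, H = ∑ k ∈ Finset.range (K + 1),
        (binomialPoly 𝕜 k).coeff 0 • ((φ - 1) ^ k) H := fun H => by
      have := LinearMap.congr_fun (sum_coeff_zero (φ - 1) K) H
      rw [LinearMap.sum_apply] at this
      exact this.symm
    have e4 : ∀ H, logSeries (φ - 1) K H = ∑ k ∈ Finset.range (K + 1),
        (binomialPoly 𝕜 k).coeff 1 • ((φ - 1) ^ k) H := fun H => by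
      rw [← sum_coeff_one, LinearMap.sum_apply]
      rfl
    rw [e4 F, e4 G]
    conv_rhs =>
      congr
      · rw [e3 G]
      · rw [e3 F]
    rw [Finset.sum_mul_sum, Finset.sum_mul_sum, Finset.sum_product, ← Finset.sum_add_distrib]
    refine Finset.sum_congr rfl fun k _ => ?_
    rw [← Finset.sum_add_distrib]
    refine Finset.sum_congr rfl fun l _ => ?_
    rw [Polynomial.mul_coeff_one, smul_mul_smul_comm, smul_mul_smul_comm, ← add_smul, add_comm]
  simp only [Polynomial.lcoeff_apply] at h1
  rw [e1, e2] at h1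
  exact h1

theorem logOp_leibniz [CharZero 𝕜] (h : φ - 1 ∈ raising 𝕜 A 1)
    (hmul : ∀ F G, φ (F * G) = φ F * φ G)
    (F G : FedosovFun A) :
    logOp (φ - 1) (F * G) = logOp (φ - 1) F * G + F * logOp (φ - 1) G := by
  refine sub_eq_zero.1 (eq_zero_of_forall_mem fun K => ?_)
  have hs : ∀ H, (logOp (φ - 1) - logSeries (φ - 1) K : FedosovOp 𝕜 A) H ∈ adicIdeal A (K : ℤ) :=
    raising_apply_mem (logOp_sub_logSeries h K)
  have h1 := adicIdeal_anti K.le_succ (logSeries_leibniz h hmul K F G)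
  have h2 := add_mem h1 (sub_mem (hs (F * G)) (add_mem (mul_mem_adicIdeal_left G (hs F))
    (mul_mem_adicIdeal_right F (hs G))))
  convert h2 using 1
  simp only [LinearMap.sub_apply, sub_mul, mul_sub]
  abel

/-- The coefficient of `t^m` in `φ^t = ∑_k (t choose k) N^k` is `(log φ)^m / m!`, up to operators
that raise the filtration. -/
theorem sum_coeff_sub_mem [CharZero 𝕜] (h : φ - 1 ∈ raising 𝕜 A 1) (K m : ℕ) :
    ∑ k ∈ Finset.range (K + 1), (binomialPoly 𝕜 k).coeff m • (φ - 1) ^ k -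
      ((m.factorial : 𝕜)⁻¹) • logSeries (𝕜 := 𝕜) (A := A) (φ - 1) K ^ m ∈ raising 𝕜 A (K + 1) := by
  set T := logSeries (φ - 1) K with hT
  have hT0 : T ∈ raising 𝕜 A 0 := raising_anti (Nat.zero_le 1) (logSeries_mem_raising h K)
  -- differentiate `φ^{n + t} = φ^n φ^t` at `t = 0`
  have h1 : ∀ n : ℕ, ∑ k ∈ Finset.range (K + 1),
      (binomialPoly 𝕜 k).derivative.eval (n : 𝕜) • (φ - 1) ^ k -
      ∑ k ∈ Finset.range (K + 1), (binomialPoly 𝕜 k).eval (n : 𝕜) • ((φ - 1) ^ k * T) ∈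
        raising 𝕜 A (K + 1) := fun n => by
    have h2 := functional_sum_sub_sum_mem (raising 𝕜 A (K + 1)) (Finset.range (K + 1))
      (Finset.range (K + 1)) (fun k => Polynomial.taylor (n : 𝕜) (binomialPoly 𝕜 k))
      (binomialPoly 𝕜) (fun k => (φ - 1) ^ k)
      (fun k => powSeries (φ - 1) (K + 1) (n : 𝕜) * (φ - 1) ^ k) (fun t => by
        have h3 := pow_sub_powSeries_mem h (K + 1) (t + n)
        have h4 := pow_sub_powSeries_mem h (K + 1) t
        have h5 := pow_sub_powSeries_mem h (K + 1) n
        have hφ : φ ∈ raising 𝕜 A 0 := by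
          have := add_mem (raising_anti (Nat.zero_le 1) h) (one_mem_raising (𝕜 := 𝕜) (A := A))
          rwa [sub_add_cancel] at this
        have h6 := sub_mem (add_mem (mul_mem_raising_right h5 (pow_mem_raising_zero hφ t))
          (mul_mem_raising_left (powSeries_mem_raising h (K + 1) (n : 𝕜)) h4)) h3
        convert h6 using 1
        have e1 : ∑ k ∈ Finset.range (K + 1),
            (Polynomial.taylor (n : 𝕜) (binomialPoly 𝕜 k)).eval (t : 𝕜) • (φ - 1) ^ k =
            powSeries (φ - 1) (K + 1) ((t + n : ℕ) : 𝕜) := by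
          simp only [powSeries, Polynomial.taylor_eval, Nat.cast_add]
        have e2 : ∑ k ∈ Finset.range (K + 1), (binomialPoly 𝕜 k).eval (t : 𝕜) •
            (powSeries (φ - 1) (K + 1) (n : 𝕜) * (φ - 1) ^ k) =
            powSeries (φ - 1) (K + 1) (n : 𝕜) * powSeries (φ - 1) (K + 1) (t : 𝕜) := by
          simp only [← mul_smul_comm, ← Finset.mul_sum, powSeries]
        rw [e1, e2, add_comm t n, pow_add]
        noncomm_ring) (Polynomial.lcoeff 𝕜 1)
    simp only [Polynomial.lcoeff_apply, Polynomial.taylor_coeff_one, ← mul_smul_comm,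
      ← Finset.mul_sum] at h2
    rw [sum_coeff_one] at h2
    simpa only [← smul_mul_assoc, ← Finset.sum_mul, powSeries] using h2
  -- compare the coefficients of `n^m`
  have h2 : ∀ m : ℕ, ∑ k ∈ Finset.range (K + 1),
      ((binomialPoly 𝕜 k).coeff (m + 1) * ((m : 𝕜) + 1)) • (φ - 1) ^ k -
      (∑ k ∈ Finset.range (K + 1), (binomialPoly 𝕜 k).coeff m • (φ - 1) ^ k) * T ∈
        raising 𝕜 A (K + 1) := fun m => by
    have h3 := functional_sum_sub_sum_mem (raising 𝕜 A (K + 1)) _ _ _ _ _ _ h1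
      (Polynomial.lcoeff 𝕜 m)
    simpa only [Polynomial.lcoeff_apply, Polynomial.coeff_derivative, ← smul_mul_assoc,
      ← Finset.sum_mul] using h3
  induction m with
  | zero =>
    rw [sum_coeff_zero, Nat.factorial_zero, Nat.cast_one, inv_one, one_smul, pow_zero, sub_self]
    exact zero_mem _
  | succ m ih =>
    have hm : ((m : 𝕜) + 1) ≠ 0 := Nat.cast_add_one_ne_zero m
    have h3 := Submodule.smul_mem _ ((m : 𝕜) + 1)⁻¹
      (add_mem (h2 m) (mul_mem_raising_right ih hT0))
    convert h3 using 1
    simp only [mul_comm _ ((m : 𝕜) + 1), mul_smul, ← Finset.smul_sum]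
    rw [sub_mul, sub_add_sub_cancel, smul_sub, smul_smul, inv_mul_cancel₀ hm, one_smul,
      smul_mul_assoc, smul_smul, ← pow_succ, Nat.factorial_succ, Nat.cast_mul, mul_inv,
      Nat.cast_add_one]

/-- `exp (log φ) = φ`. -/
theorem sub_exp_logOp_mem [CharZero 𝕜] (h : φ - 1 ∈ raising 𝕜 A 1) (K : ℕ) :
    φ - ∑ m ∈ Finset.range (K + 2), ((m.factorial : 𝕜)⁻¹) • logOp (𝕜 := 𝕜) (A := A) (φ - 1) ^ m ∈
      raising 𝕜 A (K + 1) := by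
  have h1 := pow_sub_powSeries_mem h (K + 2) 1
  have e1 : powSeries (φ - 1) (K + 2) ((1 : ℕ) : 𝕜) = ∑ m ∈ Finset.range (K + 2),
      ∑ k ∈ Finset.range (K + 1 + 1), (binomialPoly 𝕜 k).coeff m • (φ - 1) ^ k := by
    rw [Finset.sum_comm, powSeries]
    refine Finset.sum_congr rfl fun k hk => ?_
    rw [← Finset.sum_smul, Polynomial.eval_eq_sum_range'
      (binomialPoly_natDegree_lt (Finset.mem_range.1 hk))]
    simp
  have hlog := logOp_sub_logSeries h (K + 1)
  have h0 : logOp (φ - 1) ∈ raising 𝕜 A 0 := raising_anti (Nat.zero_le 1) (logOp_mem_raising h)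
  have h0' := raising_anti (Nat.zero_le 1) (logSeries_mem_raising h (K + 1))
  have h2 : ∑ m ∈ Finset.range (K + 2),
      (∑ k ∈ Finset.range (K + 1 + 1), (binomialPoly 𝕜 k).coeff m • (φ - 1) ^ k -
        ((m.factorial : 𝕜)⁻¹) • logSeries (𝕜 := 𝕜) (A := A) (φ - 1) (K + 1) ^ m) ∈
        raising 𝕜 A (K + 1) :=
    Submodule.sum_mem _ fun m _ => raising_anti (Nat.le_succ _) (sum_coeff_sub_mem h (K + 1) m)
  have h3 : ∑ m ∈ Finset.range (K + 2), ((m.factorial : 𝕜)⁻¹) •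
      (logOp (φ - 1) ^ m - logSeries (φ - 1) (K + 1) ^ m) ∈ raising 𝕜 A (K + 1) :=
    Submodule.sum_mem _ fun m _ => Submodule.smul_mem _ _ (pow_sub_pow_mem_raising h0 h0' hlog m)
  have h4 := sub_mem (add_mem (raising_anti (Nat.le_succ _) h1) h2) h3
  rw [e1, pow_one] at h4
  simp only [Finset.sum_sub_distrib, smul_sub] at h4
  convert h4 using 1
  abel

end Unipotent

/-! ### Unconditional sums of operators -/

/-- A series whose terms outside a finite set raise the filtration by more and more converges
unconditionally and uniformly. -/
theorem hasUniformSum_of_raising {ι : Type*} {a : ι → FedosovOp 𝕜 A} {φ : FedosovOp 𝕜 A}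
    (h : ∀ K : ℕ, ∃ s : Finset ι, φ - ∑ i ∈ s, a i ∈ raising 𝕜 A K ∧
      ∀ i ∉ s, a i ∈ raising 𝕜 A K) : HasUniformSum a φ := by
  classical
  intro K
  obtain ⟨s₀, h1, h2⟩ := h K
  refine ⟨s₀, fun s hs F => raising_apply_mem ?_ F⟩
  rw [← Finset.sum_sdiff hs, add_comm, ← sub_sub]
  exact sub_mem h1 (Submodule.sum_mem _ fun i hi => h2 i (Finset.mem_sdiff.1 hi).2)

theorem sum_list_prod {S : Type*} [Semiring S] (u : ℕ → S) (s : Finset ℕ) (m : ℕ) :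
    ∑ f ∈ Fintype.piFinset (fun _ : Fin m => s), (List.ofFn fun a => u (f a)).prod =
      (∑ i ∈ s, u i) ^ m := by
  induction m with
  | zero => simp
  | succ m ih =>
    rw [pow_succ', ← ih, Finset.sum_mul_sum, ← Finset.sum_product']
    refine Finset.sum_nbij' (fun f => (f 0, Fin.tail f)) (fun x => Fin.cons x.1 x.2) ?_ ?_ ?_ ?_ ?_
    · intro f hf
      rw [Fintype.mem_piFinset] at hf
      exact Finset.mem_product.2 ⟨hf 0, Fintype.mem_piFinset.2 fun a => hf a.succ⟩
    · intro x hx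
      obtain ⟨h1, h2⟩ := Finset.mem_product.1 hx
      exact Fintype.mem_piFinset.2 (Fin.cases h1 (Fintype.mem_piFinset.1 h2))
    · intro f _
      exact Fin.cons_self_tail f
    · intro x _
      rfl
    · intro f _
      rw [List.ofFn_succ, List.prod_cons]
      rfl

theorem list_prod_mem_raising {u : ℕ → FedosovOp 𝕜 A} (hu : ∀ i, u i ∈ raising 𝕜 A (i + 1))
    {m : ℕ} (f : Fin m → ℕ) :
    (List.ofFn fun a => u (f a)).prod ∈ raising 𝕜 A (∑ a, (f a + 1)) := by
  induction m with
  | zero => exact one_mem_raising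
  | succ m ih =>
    rw [List.ofFn_succ, List.prod_cons, Fin.sum_univ_succ]
    exact mul_mem_raising (hu _) (ih fun a => f a.succ)

/-- The logarithmic series of `∑_i u_i`, with all products expanded. -/
theorem hasUniformSum_logOp_expand {N : FedosovOp 𝕜 A} (hN : N ∈ raising 𝕜 A 1)
    {u : ℕ → FedosovOp 𝕜 A} (hu : ∀ i, u i ∈ raising 𝕜 A (i + 1))
    (hsum : ∀ n, N - ∑ i ∈ Finset.range n, u i ∈ raising 𝕜 A (1 + n)) :
    HasUniformSum (fun i : Σ n : ℕ, (Fin (n + 1) → ℕ) =>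
      ((-1 : 𝕜) ^ i.1 / ((i.1 : 𝕜) + 1)) • (List.ofFn fun a => u (i.2 a)).prod) (logOp N) := by
  refine hasUniformSum_of_raising fun K => ⟨(Finset.range K).sigma fun n =>
    Fintype.piFinset fun _ => Finset.range K, ?_, ?_⟩
  · rw [Finset.sum_sigma]
    simp only [← Finset.smul_sum, sum_list_prod]
    have hU : ∑ i ∈ Finset.range K, u i ∈ raising 𝕜 A 0 :=
      Submodule.sum_mem _ fun i _ => raising_anti (Nat.zero_le _) (hu i)
    have h1 : ∑ n ∈ Finset.range K, ((-1 : 𝕜) ^ n / ((n : 𝕜) + 1)) •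
        (N ^ (n + 1) - (∑ i ∈ Finset.range K, u i) ^ (n + 1)) ∈ raising 𝕜 A K :=
      Submodule.sum_mem _ fun n _ => Submodule.smul_mem _ _ (pow_sub_pow_mem_raising
        (raising_anti (Nat.zero_le 1) hN) hU (raising_anti (by omega) (hsum K)) (n + 1))
    have h2 := add_mem (logOp_sub_logSeries hN K) h1
    simp only [smul_sub, Finset.sum_sub_distrib] at h2
    rwa [← logSeries, sub_add_sub_cancel] at h2
  · rintro ⟨n, f⟩ hi
    refine Submodule.smul_mem _ _ (raising_anti ?_ (list_prod_mem_raising hu f))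
    by_contra! hlt
    refine hi (Finset.mem_sigma.2 ⟨Finset.mem_range.2 ?_,
      Fintype.mem_piFinset.2 fun a => Finset.mem_range.2 ?_⟩)
    · have : ∑ _a : Fin (n + 1), 1 ≤ ∑ a, (f a + 1) := Finset.sum_le_sum fun a _ => by omega
      simp only [Finset.sum_const, Finset.card_univ, Fintype.card_fin, smul_eq_mul, mul_one] at this
      change n < K
      omega
    · have := Finset.single_le_sum (f := fun a => f a + 1) (fun _ _ => Nat.zero_le _)
        (Finset.mem_univ a)
      change f a < K
      simp only at this
      omega

theorem hasUniformSum_logOp {N : FedosovOp 𝕜 A} (hN : N ∈ raising 𝕜 A 1) :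
    HasUniformSum (fun n : ℕ => ((-1 : 𝕜) ^ n / ((n : 𝕜) + 1)) • N ^ (n + 1)) (logOp N) :=
  hasUniformSum_of_raising fun K => ⟨Finset.range K, logOp_sub_logSeries hN K, fun n hn =>
    raising_anti (by rw [Finset.mem_range] at hn; omega) (logTerm_mem_raising hN n)⟩

theorem expTerm_mem_raising {Y : FedosovOp 𝕜 A} (hY : Y ∈ raising 𝕜 A 1) (n : ℕ) :
    ((n.factorial : 𝕜)⁻¹) • Y ^ n ∈ raising 𝕜 A n :=
  Submodule.smul_mem _ _ (pow_mem_raising hY n)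

theorem hasUniformSum_exp_logOp [CharZero 𝕜] {φ : FedosovOp 𝕜 A} (h : φ - 1 ∈ raising 𝕜 A 1) :
    HasUniformSum (fun n : ℕ => ((n.factorial : 𝕜)⁻¹) • logOp (𝕜 := 𝕜) (A := A) (φ - 1) ^ n) φ :=
  hasUniformSum_of_raising fun K => ⟨Finset.range (K + 2),
    raising_anti K.le_succ (sub_exp_logOp_mem h K), fun n hn =>
    raising_anti (by rw [Finset.mem_range] at hn; omega)
      (expTerm_mem_raising (logOp_mem_raising h) n)⟩

/-- The exponential series is injective on operators that raise the filtration. -/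
theorem exp_injective {φ Y Y' : FedosovOp 𝕜 A} (hY : Y ∈ raising 𝕜 A 1) (hY' : Y' ∈ raising 𝕜 A 1)
    (h : HasUniformSum (fun n : ℕ => ((n.factorial : 𝕜)⁻¹) • Y ^ n) φ)
    (h' : HasUniformSum (fun n : ℕ => ((n.factorial : 𝕜)⁻¹) • Y' ^ n) φ) : Y' = Y := by
  -- if `Y' - Y` raises the filtration by `r`, then `Y'^n - Y^n` raises it by `r + 1` for `n ≥ 2`
  have hpow : ∀ r n : ℕ, Y' - Y ∈ raising 𝕜 A r →
      Y' ^ (n + 1) - Y ^ (n + 1) ∈ raising 𝕜 A (r + n) := fun r n hr => by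
    induction n with
    | zero => simpa using hr
    | succ n ih =>
      have e : Y' ^ (n + 1 + 1) - Y ^ (n + 1 + 1) =
          Y' ^ (n + 1) * (Y' - Y) + (Y' ^ (n + 1) - Y ^ (n + 1)) * Y := by
        rw [pow_succ _ (n + 1), pow_succ _ (n + 1)]; noncomm_ring
      rw [e]
      exact add_mem (raising_anti (by omega) (mul_mem_raising (pow_mem_raising hY' (n + 1)) hr))
        (raising_anti (by omega) (mul_mem_raising ih hY))
  have key : ∀ r : ℕ, Y' - Y ∈ raising 𝕜 A r := fun r => by
    induction r with
    | zero => exact sub_mem (raising_anti (Nat.zero_le 1) hY') (raising_anti (Nat.zero_le 1) hY)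
    | succ r ih =>
      classical
      intro k F hF
      obtain ⟨s, hs⟩ := h (k + (r + 1))
      obtain ⟨s', hs'⟩ := h' (k + (r + 1))
      have h1 := sub_mem
        (hs (s ∪ s' ∪ {0, 1}) (Finset.subset_union_left.trans Finset.subset_union_left) F)
        (hs' (s ∪ s' ∪ {0, 1}) (Finset.subset_union_right.trans Finset.subset_union_left) F)
      set t := s ∪ s' ∪ {0, 1}
      have ht : ({0, 1} : Finset ℕ) ⊆ t := Finset.subset_union_right
      have h2 : ∑ n ∈ t \ {0, 1}, (((n.factorial : 𝕜)⁻¹) • Y' ^ n - ((n.factorial : 𝕜)⁻¹) • Y ^ n) ∈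
          raising 𝕜 A (r + 1) := by
        refine Submodule.sum_mem _ fun n hn => ?_
        rw [← smul_sub]
        refine Submodule.smul_mem _ _ ?_
        have hn' : 2 ≤ n := by
          simp only [Finset.mem_sdiff, Finset.mem_insert, Finset.mem_singleton] at hn
          omega
        obtain ⟨p, rfl⟩ := Nat.exists_eq_add_of_le' hn'
        exact raising_anti (by omega) (hpow r (p + 1) ih)
      have e : (φ - ∑ n ∈ t, ((n.factorial : 𝕜)⁻¹) • Y ^ n) -
          (φ - ∑ n ∈ t, ((n.factorial : 𝕜)⁻¹) • Y' ^ n) = (Y' - Y) +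
          ∑ n ∈ t \ {0, 1}, (((n.factorial : 𝕜)⁻¹) • Y' ^ n - ((n.factorial : 𝕜)⁻¹) • Y ^ n) := by
        rw [sub_sub_sub_cancel_left, ← Finset.sum_sub_distrib, ← Finset.sum_sdiff ht,
          Finset.sum_pair zero_ne_one]
        simp [add_comm]
      have h3 := sub_mem h1 (raising_apply h2 hF)
      rw [← LinearMap.sub_apply, e, LinearMap.add_apply, add_sub_cancel_right] at h3
      exact h3
  exact sub_eq_zero.1 (eq_zero_of_forall_raising key)

theorem isVerticalOp_logOp {N : FedosovOp 𝕜 A} (hv : IsVerticalOp N) (hN : N ∈ raising 𝕜 A 1) :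
    IsVerticalOp (logOp N) where
  continuous := isAdicContinuous_of_raising (logOp_mem_raising hN)
  map_mul_form := adicSum_map_mul_form
    (fun n => raising_apply_mem (raising_anti n.le_succ (logTerm_mem_raising hN n)))
    fun n => (isVerticalOp_smul _ (isVerticalOp_pow hv (n + 1))).map_mul_form

theorem hasFormDegree_logOp {N : FedosovOp 𝕜 A} (h : HasFormDegree 0 N) :
    HasFormDegree 0 (logOp N) := by
  have hpow : ∀ n q, ∀ F ∈ degreePart A q, (N ^ n) F ∈ degreePart A q := fun n q F hF => by
    induction n with
    | zero => exact hF
    | succ n ih => rw [pow_succ']; exact h q _ ih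
  intro q F hF k
  rw [logOp, symCoeff_adicSum]
  refine Submodule.sum_mem _ fun n _ => ?_
  rw [LinearMap.smul_apply, symCoeff_smul]
  exact Submodule.smul_of_tower_mem _ _ (hpow (n + 1) q F hF k)

/-! ### The logarithm of a vertical isomorphism -/

/-- The logarithm of a vertical isomorphism, for an arbitrary Lie algebroid over a reduced algebra
of functions. -/
theorem verticalIso_exp_log [CharZero 𝕜] [IsReduced R] {𝓛 : LieAlgebroid 𝕜 R L}
    (j : LieSplitting A) {j₁ j₂ : LieSplitting A} {D₁ D₂ : LConnection 𝓛 A}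
    {Q₁ Q₂ : FedosovOp 𝕜 A} (hQ₁ : IsFedosovField j₁ D₁ Q₁) (hQ₂ : IsFedosovField j₂ D₂ Q₂)
    {φ : FedosovOp 𝕜 A} (hφ : IsVerticalIso Q₂ Q₁ φ) :
    ∃ Y : FedosovOp 𝕜 A,
      IsVerticalField 0 2 Y ∧
      HasUniformSum (fun n : ℕ => ((n.factorial : 𝕜)⁻¹) • Y ^ n) φ ∧
      HasUniformSum (fun n : ℕ => ((-1 : 𝕜) ^ n / ((n : 𝕜) + 1)) • (φ - 1) ^ (n + 1)) Y ∧
      HasUniformSum (fun i : Σ n : ℕ, (Fin (n + 1) → ℕ) =>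
        ((-1 : 𝕜) ^ i.1 / ((i.1 : 𝕜) + 1)) •
          (List.ofFn fun a => j.iterTerm Q₁ Q₂ (i.2 a)).prod) Y ∧
      ∀ Y' : FedosovOp 𝕜 A, IsVerticalField 0 2 Y' →
        HasUniformSum (fun n : ℕ => ((n.factorial : 𝕜)⁻¹) • Y' ^ n) φ → Y' = Y := by
  have hr := verticalIso_sub_one_mem_raising hQ₁ hQ₂ hφ
  have hv : IsVerticalOp (φ - 1) := isVerticalOp_sub hφ.vertical isVerticalOp_one
  have hlog := logOp_mem_raising hr
  refine ⟨logOp (φ - 1), ⟨isVerticalOp_logOp hv hr, hasFormDegree_logOp fun q F hF =>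
    sub_mem (hφ.degree q F hF) hF, fun F G => logOp_leibniz hr hφ.map_mul F G, fun η => ?_⟩,
    hasUniformSum_exp_logOp hr, hasUniformSum_logOp hr,
    hasUniformSum_logOp_expand hr (iterTerm_mem_raising j hQ₁ hQ₂)
      (verticalIso_sub_sum_mem_raising j hQ₁ hQ₂ hφ),
    fun Y' hY' h => exp_injective hlog (field_mem_raising hY') (hasUniformSum_exp_logOp hr) h⟩
  exact raising_apply (k := 1) hlog (fedMono_mem_adicIdeal 1 {η})

theorem isReduced_smoothFun (𝕜 : Type*) [RCLike 𝕜] (E : Type*) [NormedAddCommGroup E]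
    [NormedSpace ℝ E] (M : Type*) [TopologicalSpace M] [ChartedSpace E M] :
    IsReduced (SmoothFun 𝕜 E M) :=
  isReduced_of_injective (smoothFunSubalgebra 𝕜 E M).val Subtype.val_injective

end Fedosov

end

theorem corollary3p10
    {𝕜 : Type*} [RCLike 𝕜]
    {E : Type*} [NormedAddCommGroup E] [NormedSpace ℝ E] [FiniteDimensional ℝ E]
    {M : Type*} [TopologicalSpace M] [ChartedSpace E M] [IsManifold 𝓘(ℝ, E) ∞ M]
    [T2Space M] [SecondCountableTopology M]
    {F : Type*} [NormedAddCommGroup F] [NormedSpace ℝ F] [NormedSpace 𝕜 F] [IsScalarTower ℝ 𝕜 F]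
    [FiniteDimensional 𝕜 F]
    {V : M → Type*} [TopologicalSpace (Bundle.TotalSpace F V)]
    [∀ x, AddCommGroup (V x)] [∀ x, Module ℝ (V x)] [∀ x, Module 𝕜 (V x)]
    [∀ x, IsScalarTower ℝ 𝕜 (V x)] [∀ x, TopologicalSpace (V x)]
    [FiberBundle F V] [VectorBundle ℝ F V] [VectorBundle 𝕜 F V]
    [ContMDiffVectorBundle ∞ F V 𝓘(ℝ, E)]
    (𝓛 : LieAlgebroid 𝕜 (SmoothFun 𝕜 E M) (SmoothSec 𝕜 E F V))
    (A : ∀ x, Submodule 𝕜 (V x)) (hA : IsLiePair 𝕜 F V 𝓛 A)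
    (j j₁ j₂ : LieSplitting (SubbundleSec 𝕜 E F V A))
    (D₁ D₂ : LConnection 𝓛 (SubbundleSec 𝕜 E F V A))
    (hD₁ : D₁.IsTorsionFree) (hD₂ : D₂.IsTorsionFree)
    (Q₁ Q₂ : FedosovOp 𝕜 (SubbundleSec 𝕜 E F V A))
    (hQ₁ : IsFedosovField j₁ D₁ Q₁) (hQ₂ : IsFedosovField j₂ D₂ Q₂)
    (φ : FedosovOp 𝕜 (SubbundleSec 𝕜 E F V A)) (hφ : IsVerticalIso Q₂ Q₁ φ) :
    ∃ Y : FedosovOp 𝕜 (SubbundleSec 𝕜 E F V A),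
      IsVerticalField 0 2 Y ∧
      HasUniformSum (fun n : ℕ => ((n.factorial : 𝕜)⁻¹) • Y ^ n) φ ∧
      HasUniformSum (fun n : ℕ => ((-1 : 𝕜) ^ n / ((n : 𝕜) + 1)) • (φ - 1) ^ (n + 1)) Y ∧
      HasUniformSum (fun i : Σ n : ℕ, (Fin (n + 1) → ℕ) =>
        ((-1 : 𝕜) ^ i.1 / ((i.1 : 𝕜) + 1)) •
          (List.ofFn fun a => j.iterTerm Q₁ Q₂ (i.2 a)).prod) Y ∧
      ∀ Y' : FedosovOp 𝕜 (SubbundleSec 𝕜 E F V A), IsVerticalField 0 2 Y' →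
        HasUniformSum (fun n : ℕ => ((n.factorial : 𝕜)⁻¹) • Y' ^ n) φ → Y' = Y := by
  have := Fedosov.isReduced_smoothFun 𝕜 E M
  exact Fedosov.verticalIso_exp_log j hQ₁ hQ₂ hφ
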